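/- Let $n\ge 2$ and let $D_n$ be the Coxeter group of type $D$: the group of permutations of $\{-n,\dots,-1,1,\dots,n\}$ generated by $S=\{s_{1'},s_1,\dots,s_{n-1}\}$, where $s_i=(-i-1,-i)(i,i+1)$ and $s_{1'}=(-2,1)(-1,2)$. For $J\subseteq S$ let $W_J=\langle J\rangle$, let $X_J$ be the set of elements of minimal length in their left coset $wW_J$, and let $\mathcal X_J=\sum_{w\in X_J}w$. For a commutative ring $R$ let $\Sigma_R$ be the subalgebra of the group ring $R[D_n]$ generated by all $\mathcal X_J$; put $\Sigma(D_n,p)=\Sigma_{\mathbb Z}/p\,\Sigma_{\mathbb Z}$ for a prime $p$ (so that $\Sigma_{D_n}=\Sigma_{\mathbb Q}$). Let $\varphi_J$ be the permutation character of $D_n$ on the right cosets of $W_J$, and let $c_J$ be a Coxeter element of $J$, that is, a product of all elements of $J$, each once, in an arbitrary order. Let $\mathcal C(n)$ be the disjoint union of $\mathcal C_{<n}$ (compositions $\kappa$ of integers $0\le m\le n-2$, including the empty composition $[\ ]$ of $0$), $\mathcal C_1$ (compositions of $n$ with $\kappa_1=1$), and two copies $\mathcal C_n,\mathcal C_n'$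 of the set of compositions of $n$ with $\kappa_1\ge 2$. To $\kappa=[\kappa_1,\dots,\kappa_k]\in\mathcal C(n)$ corresponds the following subset of $S$: - $\{s_{n-m+\kappa_1+\dots+\kappa_j}: 0\le j\le k-1\}$ if $\kappa\in\mathcal C_{<n}$ is a composition of $m$; - $\{s_{1'},s_1\}\cup\{s_{\kappa_1+\dots+\kappa_j}: 2\le j\le k-1\}$ if $\kappa\in\mathcal C_1$; - $\{s_{1'}\}\cup\{s_{\kappa_1+\dots+\kappa_j}: 1\le j\le k-1\}$ if $\kappa\in\mathcal C_n$; - $\{s_1\}\cup\{s_{\kappa_1+\dots+\kappa_j}: 1\le j\le k-1\}$ if $\kappa\in\mathcal C_n'$. A composition is a partition if it is non-increasing, and it is $p$-regular if none of its parts is divisible by $p$. For a field $k$, say that a set $I$ of subsets of $S$ indexes the irreducible representations of $\Sigma_k$ if for each $J\in I$ there is an algebra homomorphism $\chi_J:\Sigma_k\to k$ with $\chi_J(\mathcal X_K)=\varphi_K(c_J)$ for all $K\subseteq S$ (the column $c_J$ of the matrix $[\varphi_K(c_J)]$), and the resulting one-dimensional representations $\chi_J$, $J\in I$, are pairwise non-isomorphic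 and are, up to isomorphism, all irreducible representations of $\Sigma_k$. The same phrase for $\Sigma(D_n,p)$ refers to ring homomorphisms $\Sigma(D_n,p)\to\mathbb F_p$ and to the matrix reduced modulo $p$. Then, for every choice of the Coxeter elements $c_J$: 1. For every commutative ring $R$ the $\mathcal X_J$, $J\subseteq S$, form an $R$-basis of $\Sigma_R$ (Solomon). 2. For every field $k$ of characteristic zero (in particular $k=\mathbb Q$), the irreducible representations of $\Sigma_k$ are indexed by the subsets $J$ of $S$ whose complement corresponds to a partition in $\mathcal C(n)\setminus\mathcal C_n'$ or to a partition in $\mathcal C_n'$ with all parts even. 3. For every prime $p\ne 2$, the irreducible representations of $\Sigma(D_n,p)$ are indexed by the subsets $J$ of $S$ whose complement corresponds to a $p$-regular partition in $\mathcal C(n)\setminus\mathcal C_n'$ or to a $p$-regular partition in $\mathcal C_n'$ with all parts even. 4. If $n$ is even, the irreducible representations of $\Sigma(D_n,2)$ are indexed by the subset whose complement corresponds to $[\ ]$. 5. If $n$ is odd, the irreducible representations of $\Sigma(D_n,2)$ are indexed by the subsets whose complements correspond to $[\ ]$ and to $[n]\in\mathcal C_n$. -/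

import Mathlib

open scoped Pointwise

universe u v

namespace DescentD

/-- The points `{-n, …, -1, 1, …, n}`. -/
noncomputable abbrev points (n : ℕ) : Finset ℤ := (Finset.Icc (-(n : ℤ)) n).erase 0

/-- The transposition `(a b)` of the points (the identity if `a` or `b` is not a point). -/
noncomputable def transposition (n : ℕ) (a b : ℤ) : Equiv.Perm (points n) :=
  if h : a ∈ points n ∧ b ∈ points n then Equiv.swap ⟨a, h.1⟩ ⟨b, h.2⟩ else 1

/-- The Coxeter generators of type `D`, labelled by `Fin n`: the label `0` stands for
`s_{1'} = (-2, 1)(-1, 2)` and a label `i ≥ 1` stands for `s_i = (-i-1, -i)(i, i+1)`.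
(All of this is meant for `n ≥ 2`.) -/
noncomputable def gen (n : ℕ) (i : Fin n) : Equiv.Perm (points n) :=
  if (i : ℕ) = 0 then transposition n (-2) 1 * transposition n (-1) 2
  else transposition n (-(i : ℤ) - 1) (-(i : ℤ)) * transposition n (i : ℤ) ((i : ℤ) + 1)

/-- The Coxeter group `D_n`, as the group of permutations of the points generated by `S`. -/
def D (n : ℕ) : Subgroup (Equiv.Perm (points n)) := Subgroup.closure (Set.range (gen n))

/-- The Coxeter generators as elements of `D_n`. Subsets of `S = {s_{1'}, s_1, …, s_{n-1}}` are
represented by finsets of labels. -/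
noncomputable def s (n : ℕ) (i : Fin n) : D n :=
  ⟨gen n i, Subgroup.subset_closure (Set.mem_range_self i)⟩

/-- Coxeter length: the least length of a word in the generators that represents `w`. -/
noncomputable def length {n : ℕ} (w : D n) : ℕ :=
  sInf {r | ∃ l : List (Fin n), l.length = r ∧ (l.map (s n)).prod = w}

/-- The parabolic subgroup `W_J`. -/
def parabolic {n : ℕ} (J : Finset (Fin n)) : Subgroup (D n) :=
  Subgroup.closure (s n '' (J : Set (Fin n)))

/-- `X_J`: the elements of minimal length in their left coset `w W_J`. -/
def minReps {n : ℕ} (J : Finset (Fin n)) : Set (D n) :=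
  {w | ∀ v ∈ parabolic J, length w ≤ length (w * v)}

/-- The formal sum of the elements of `X_J`, in the group ring `R[D_n]`. -/
noncomputable def sumX (R : Type*) [CommRing R] (n : ℕ) (J : Finset (Fin n)) :
    MonoidAlgebra R (D n) :=
  ∑ w ∈ (Set.toFinite (minReps J)).toFinset, MonoidAlgebra.of R (D n) w

/-- The descent algebra of `D_n` with coefficients in `R`: the subalgebra of the group ring
generated by the formal sums of the `X_J`. (By Solomon's theorem it is their linear span, and the
formal sums form a basis of it; the main theorem records this.)
For `R` a field of characteristic zero this is `Σ_{D_n}`; for `R = ℤ` it is the ring `𝒵_{D_n}`. -/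
noncomputable def descentAlgebra (R : Type*) [CommRing R] (n : ℕ) :
    Subalgebra R (MonoidAlgebra R (D n)) :=
  Algebra.adjoin R (Set.range (sumX R n))

/-- The formal sum of `X_J` as an element of the descent algebra. -/
noncomputable def basisX (R : Type*) [CommRing R] (n : ℕ) (J : Finset (Fin n)) :
    descentAlgebra R n :=
  ⟨sumX R n J, Algebra.subset_adjoin (Set.mem_range_self J)⟩

/-- The ideal `𝒫` of `𝒵_{D_n}` of all multiples of `p`. -/
noncomputable def multiples (n p : ℕ) : Ideal (descentAlgebra ℤ n) :=
  Ideal.span {(p : descentAlgebra ℤ n)}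

instance multiples_isTwoSided (n p : ℕ) : (multiples n p).IsTwoSided where
  mul_mem_of_left {a} b ha := by
    obtain ⟨c, rfl⟩ := Ideal.mem_span_singleton'.1 ha
    refine Ideal.mem_span_singleton'.2 ⟨c * b, ?_⟩
    rw [mul_assoc, mul_assoc, (Nat.cast_commute p b).eq]

/-- The `p`-modular descent algebra `Σ(D_n, p) = 𝒵 / 𝒫`. -/
abbrev ModularDescentAlgebra (n p : ℕ) : Type := descentAlgebra ℤ n ⧸ multiples n p

/-- The image of the formal sum of `X_J` in `Σ(D_n, p)`. -/
noncomputable def basisXbar (n p : ℕ) (J : Finset (Fin n)) : ModularDescentAlgebra n p :=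
  Ideal.Quotient.mk (multiples n p) (basisX ℤ n J)

/-- The permutation character `φ_J` of `D_n` acting on the right cosets of `W_J`: its value at `w`
is the number of right cosets `C = W_J g` with `C w = C`. -/
noncomputable def permChar {n : ℕ} (J : Finset (Fin n)) (w : D n) : ℕ :=
  {C : Set (D n) | (∃ g : D n, C = MulOpposite.op g • (parabolic J : Set (D n))) ∧
    MulOpposite.op w • C = C}.ncard

/-- `c` is a Coxeter element of `J`: a product of all the elements of `J` taken in some order. -/
def IsCoxeterElement {n : ℕ} (J : Finset (Fin n)) (c : D n) : Prop :=
  ∃ l : List (Fin n), l.Nodup ∧ l.toFinset = J ∧ (l.map (s n)).prod = c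

/-- The multiset `𝒞(n)`, the disjoint union of `𝒞_{<n}` (compositions of some `m ≤ n - 2`), `𝒞_1`
(compositions of `n` with first component `1`), and two copies `𝒞_n`, `𝒞_n'` of the set of
compositions of `n` with first component at least `2`. -/
inductive Comps (n : ℕ) : Type
  | below (m : ℕ) (hm : m + 2 ≤ n) (κ : Composition m) : Comps n
  | one (κ : Composition n) (h : κ.blocks.head? = some 1) : Comps n
  | top (κ : Composition n) (h : ∃ a ∈ κ.blocks.head?, 2 ≤ a) : Comps n
  | topPrime (κ : Composition n) (h : ∃ a ∈ κ.blocks.head?, 2 ≤ a) : Comps n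

namespace Comps

/-- The list of components. -/
def components {n : ℕ} : Comps n → List ℕ
  | below _ _ κ => κ.blocks
  | one κ _ => κ.blocks
  | top κ _ => κ.blocks
  | topPrime κ _ => κ.blocks

/-- Membership in the primed copy `𝒞_n'`. -/
def InPrime {n : ℕ} : Comps n → Prop
  | topPrime _ _ => True
  | _ => False

/-- A composition is a partition if its list of components is non-increasing. -/
def IsPartition {n : ℕ} (κ : Comps n) : Prop := κ.components.Pairwise (· ≥ ·)

/-- All components are even. -/
def AllEven {n : ℕ} (κ : Comps n) : Prop := ∀ a ∈ κ.components, Even a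

/-- `m`-regularity: no part is divisible by `m`. -/
def IsRegular {n : ℕ} (m : ℕ) (κ : Comps n) : Prop := ∀ a ∈ κ.components, ¬ m ∣ a

/-- The subset of `S` that corresponds to an element of `𝒞(n)`; `κ.sizeUpTo j` is
`κ_1 + ⋯ + κ_j`, and the label `0` is `s_{1'}`. -/
def subset {n : ℕ} : Comps n → Finset (Fin n)
  | below m _ κ =>
      {i | ∃ j < κ.length, (i : ℕ) = (n - m) + κ.sizeUpTo j}
  | one κ _ =>
      {i | (i : ℕ) = 0 ∨ (i : ℕ) = 1 ∨ ∃ j < κ.length, 2 ≤ j ∧ (i : ℕ) = κ.sizeUpTo j}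
  | top κ _ =>
      {i | (i : ℕ) = 0 ∨ ∃ j < κ.length, 1 ≤ j ∧ (i : ℕ) = κ.sizeUpTo j}
  | topPrime κ _ =>
      {i | (i : ℕ) = 1 ∨ ∃ j < κ.length, 1 ≤ j ∧ (i : ℕ) = κ.sizeUpTo j}

end Comps

/-- The subsets `J` of `S` whose complement corresponds to a partition in `𝒞(n) ∖ 𝒞_n'` or to a
partition in `𝒞_n'` with all parts even. -/
def indexZero (n : ℕ) : Set (Finset (Fin n)) :=
  {J | ∃ κ : Comps n, Jᶜ = κ.subset ∧ κ.IsPartition ∧ (¬ κ.InPrime ∨ κ.InPrime ∧ κ.AllEven)}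

/-- The subsets `J` of `S` whose complement corresponds to a `p`-regular partition in
`𝒞(n) ∖ 𝒞_n'` or to a `p`-regular partition in `𝒞_n'` with all parts even. -/
def indexReg (n p : ℕ) : Set (Finset (Fin n)) :=
  {J | ∃ κ : Comps n, Jᶜ = κ.subset ∧ κ.IsPartition ∧ κ.IsRegular p ∧
    (¬ κ.InPrime ∨ κ.InPrime ∧ κ.AllEven)}

/-- The subset of `S` whose complement corresponds to `[ ]`. -/
def indexTwoEven (n : ℕ) : Set (Finset (Fin n)) :=
  {J | ∃ κ : Comps n, Jᶜ = κ.subset ∧ κ.components = []}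

/-- The subsets of `S` whose complements correspond to `[ ]` or to `[n]` (in `𝒞_n`). -/
def indexTwoOdd (n : ℕ) : Set (Finset (Fin n)) :=
  {J | ∃ κ : Comps n, Jᶜ = κ.subset ∧
    (κ.components = [] ∨ ¬ κ.InPrime ∧ κ.components = [n])}

/-- The one-dimensional representation given by a ring homomorphism `χ : R → F`: the space `F`,
on which `a : R` acts as multiplication by `χ a`. -/
@[nolint unusedArguments]
def CharModule {R F : Type*} [Ring R] [Field F] (_χ : R →+* F) : Type _ := F

instance {R F : Type*} [Ring R] [Field F] (χ : R →+* F) : AddCommGroup (CharModule χ) :=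
  inferInstanceAs (AddCommGroup F)

instance {R F : Type*} [Ring R] [Field F] (χ : R →+* F) : Module R (CharModule χ) :=
  Module.compHom F χ

/-- The one-dimensional representations `χ i` are the irreducible representations of `R`: each is
irreducible, they are pairwise non-isomorphic, and every irreducible representation (here: with
underlying set in an arbitrary universe `w`) is isomorphic to one of them. -/
structure AreTheIrreps.{w, a, b, c} {R : Type a} {F : Type b} {ι : Type c} [Ring R] [Field F]
    (χ : ι → R →+* F) : Prop where
  simple : ∀ i, IsSimpleModule R (CharModule (χ i))
  irredundant : ∀ i j, Nonempty (CharModule (χ i) ≃ₗ[R] CharModule (χ j)) → i = j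
  complete : ∀ (M : Type w) [AddCommGroup M] [Module R M], IsSimpleModule R M →
    ∃ i, Nonempty (M ≃ₗ[R] CharModule (χ i))

/-- The columns of the matrix `[φ_K(c_J)]`, for `J` in the set `I`, are the irreducible
representations of the descent algebra over the field `k`: for each `J ∈ I` there is a
one-dimensional representation with value `φ_K(c_J)` at the formal sum of `X_K`, for all `K`, and
these are the irreducible representations, without repetition. -/
def IndexesIrreps.{w, a} (k : Type a) [Field k] (n : ℕ) (c : Finset (Fin n) → D n)
    (I : Set (Finset (Fin n))) : Prop :=
  ∃ χ : I → (descentAlgebra k n →ₐ[k] k),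
    (∀ (J : I) (K : Finset (Fin n)), χ J (basisX k n K) = (permChar K (c J) : k)) ∧
    AreTheIrreps.{w, _, _, _} (fun J => (χ J).toRingHom)

/-- The same for `Σ(D_n, p)` and the columns of `[φ_K(c_J)]` reduced modulo `p`. -/
def IndexesModularIrreps.{w} (n p : ℕ) [Fact p.Prime] (c : Finset (Fin n) → D n)
    (I : Set (Finset (Fin n))) : Prop :=
  ∃ χ : I → (ModularDescentAlgebra n p →+* ZMod p),
    (∀ (J : I) (K : Finset (Fin n)), χ J (basisXbar n p K) = (permChar K (c J) : ZMod p)) ∧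
    AreTheIrreps.{w, _, _, _} χ

end DescentD

open DescentD

set_option linter.unusedSectionVars false

namespace DescentD

/-! ### The action of `D_n` on the integers and on odd vectors -/

/-! The group acts on odd integer vectors supported on the points, and everything is expressed
through the faces of the arrangement of hyperplanes `v x = v y` with `x + y ≠ 0`. The faces of type
`J` are represented by the orbit of `wt J`, and the shortest elements of the cosets of `W_J` are the
chambers closest to the fundamental one among those that have a given face of type `J`. So the sum
of `X_J` is a sum over faces (`sumX_eq`). Products of such sums are governed by the associative Tits
product `star` of faces, which gives Solomon's theorem with structure constants that count pairs of
faces (`sumX_mul`). The constants vanish unless `L ⊆ J` (`structConst_eq_zero`), and a diagonal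
constant counts the faces of type `K` in the flat of `wt J`, the intersection of the hyperplanes
that contain it (`structConst_self`). A Coxeter element of `J` fixes exactly this flat, so the count
is also the value of the permutation character (`permChar_coxeter`).

By triangularity each diagonal is a one-dimensional character. In a simple module, a non-zero vector
of the form `x J • m` with `J` minimal is a common eigenvector, so there are no other simple modules
(`areTheIrreps_of_triangular`). What remains is to decide which columns `cnt · (wt J)` agree modulo
the characteristic.

A flat is described by blocks of coordinates that agree up to sign, together with the coordinates
that vanish. Columns are shown to agree by letting an element `g` with `g ^ p = 1` act on the faces
in a flat: their number is congruent to the number of faces in the fixed subflat (`cnt_modEq`). For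
odd `p`, rotating `p` blocks of equal size shows that merging them changes no count
(`cnt_modEq_merge`). Splitting blocks whose size is divisible by `p` leads to a `p`-regular flat
(`exists_regular`). Ordering the blocks by size, and reversing a block of odd size if there is one
and the sign is wrong, leads into the index set (`exists_mem_indexReg`).

To separate columns, blocks are merged until there are fewer than `p` of each size. Then a
`p`-subgroup of the stabilizer of the flat cannot move blocks, and by Sylow's theorem the number of
faces of the flat's own type is prime to `p` (`not_dvd_cnt`). Two such flats with equal columns
contain conjugates of each other, hence are conjugate. Merging preserves the number of coordinates
in blocks with a given `p`-free part of the size, and it preserves the signs, whose product is an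
invariant of flats with only even blocks and no zeros (`invariants_of_cnt_eq`). For `p`-regular
partitions these data determine the index (`eq_of_mem_indexReg`). In characteristic zero neither
splitting nor merging is needed.

For `p = 2` the elements used are sign changes. If `n` is even, `-1` lies in `D_n` and all columns
agree with that of the zero flat. If `n` is odd, the only exceptions are the conjugates of the line
through the all-ones vector, up to a sign, and a single count tells this line from zero. -/

theorem mem_points {n : ℕ} {x : ℤ} : x ∈ points n ↔ x ≠ 0 ∧ -(n : ℤ) ≤ x ∧ x ≤ n := by
  simp [points]

theorem neg_mem_points {n : ℕ} {x : ℤ} : -x ∈ points n ↔ x ∈ points n := by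
  simp only [mem_points]; omega

/-- The action of `D_n` on `ℤ`, trivial outside the points. -/
noncomputable def act (n : ℕ) : D n →* Equiv.Perm ℤ :=
  Equiv.Perm.ofSubtype.comp (D n).subtype

theorem act_injective (n : ℕ) : Function.Injective (act n) :=
  Equiv.Perm.ofSubtype_injective.comp Subtype.val_injective

/-- The action of a generator on `ℤ`. -/
def genFun (i : ℕ) (x : ℤ) : ℤ :=
  if i = 0 then
    if x = 1 then -2 else if x = 2 then -1 else if x = -1 then 2 else if x = -2 then 1 else x
  else
    if x = i then i + 1 else if x = i + 1 then i else
      if x = -i then -(i + 1) else if x = -(i + 1) then -i else x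

theorem ofSubtype_transposition {n : ℕ} {a b : ℤ} (ha : a ∈ points n) (hb : b ∈ points n) :
    Equiv.Perm.ofSubtype (transposition n a b) = Equiv.swap a b := by
  rw [transposition, dif_pos ⟨ha, hb⟩, Equiv.Perm.ofSubtype_swap_eq]

theorem act_s {n : ℕ} (hn : 2 ≤ n) (i : Fin n) (x : ℤ) : act n (s n i) x = genFun i x := by
  have hi := i.2
  simp only [act, s, gen, MonoidHom.comp_apply, Subgroup.coe_subtype]
  split_ifs with h
  · rw [map_mul, ofSubtype_transposition, ofSubtype_transposition]
    · simp only [Equiv.Perm.mul_apply, Equiv.swap_apply_def, genFun, h]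
      simp only [if_true]
      grind
    all_goals rw [mem_points]; omega
  · rw [map_mul, ofSubtype_transposition, ofSubtype_transposition]
    · simp only [Equiv.Perm.mul_apply, Equiv.swap_apply_def, genFun, h]
      simp only [if_false]
      grind
    all_goals rw [mem_points]; omega

theorem genFun_neg (i : ℕ) (x : ℤ) : genFun i (-x) = -genFun i x := by
  simp only [genFun]; split_ifs <;> omega

theorem genFun_genFun (i : ℕ) (x : ℤ) : genFun i (genFun i x) = x := by
  unfold genFun; grind

theorem closure_s (n : ℕ) : Subgroup.closure (Set.range (s n)) = ⊤ := by
  apply Subgroup.map_injective (D n).subtype_injective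
  rw [MonoidHom.map_closure, ← Set.range_comp, ← MonoidHom.range_eq_map, Subgroup.range_subtype]
  rfl

theorem s_mul_s {n : ℕ} (hn : 2 ≤ n) (i : Fin n) : s n i * s n i = 1 := by
  apply act_injective n
  ext x
  rw [map_mul, Equiv.Perm.mul_apply, act_s hn, act_s hn, genFun_genFun]; simp

theorem s_inv {n : ℕ} (hn : 2 ≤ n) (i : Fin n) : (s n i)⁻¹ = s n i :=
  inv_eq_of_mul_eq_one_left (s_mul_s hn i)

theorem D_induction {n : ℕ} (hn : 2 ≤ n) {P : D n → Prop} (h1 : P 1)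
    (hs : ∀ i w, P w → P (s n i * w)) (w : D n) : P w := by
  have hw : w ∈ Subgroup.closure (Set.range (s n)) := by rw [closure_s]; trivial
  induction hw using Subgroup.closure_induction_left with
  | one => exact h1
  | mul_left x hx y hy ih => obtain ⟨i, rfl⟩ := hx; exact hs i y ih
  | inv_mul_cancel x hx y hy ih =>
    obtain ⟨i, rfl⟩ := hx; rw [s_inv hn]; exact hs i y ih

theorem act_neg {n : ℕ} (hn : 2 ≤ n) (w : D n) (x : ℤ) : act n w (-x) = -act n w x := by
  induction w using D_induction hn generalizing x with
  | h1 => simp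
  | hs i w ih => rw [map_mul, Equiv.Perm.mul_apply, Equiv.Perm.mul_apply, ih, act_s hn, act_s hn,
      genFun_neg]

theorem act_mem_points {n : ℕ} (w : D n) {x : ℤ} : act n w x ∈ points n ↔ x ∈ points n :=
  Equiv.Perm.ofSubtype_apply_mem_iff_mem _ x

theorem act_of_notMem {n : ℕ} (w : D n) {x : ℤ} (hx : x ∉ points n) : act n w x = x :=
  Equiv.Perm.ofSubtype_apply_of_not_mem _ hx

theorem act_inv_act {n : ℕ} (w : D n) (x : ℤ) : act n w⁻¹ (act n w x) = x := by
  rw [← Equiv.Perm.mul_apply, ← map_mul]; simp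

theorem act_act_inv {n : ℕ} (w : D n) (x : ℤ) : act n w (act n w⁻¹ x) = x := by
  rw [← Equiv.Perm.mul_apply, ← map_mul]; simp

/-- The odd integer vectors supported on the points. -/
def Vec (n : ℕ) : AddSubgroup (ℤ → ℤ) where
  carrier := {v | (∀ x, v (-x) = -v x) ∧ ∀ x, x ∉ points n → v x = 0}
  zero_mem' := by simp
  add_mem' := by
    rintro a b ⟨ha, ha'⟩ ⟨hb, hb'⟩
    refine ⟨fun x => ?_, fun x hx => ?_⟩
    · simp only [Pi.add_apply, ha, hb]; ring
    · simp [ha' x hx, hb' x hx]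
  neg_mem' := by
    rintro a ⟨ha, ha'⟩
    exact ⟨fun x => by simp [ha], fun x hx => by simp [ha' x hx]⟩

theorem vec_neg {n : ℕ} (v : Vec n) (x : ℤ) : v.1 (-x) = -v.1 x := v.2.1 x

theorem vec_eq_zero {n : ℕ} (v : Vec n) {x : ℤ} (hx : x ∉ points n) : v.1 x = 0 :=
  v.2.2 x hx

theorem vec_ext {n : ℕ} {v w : Vec n} (h : ∀ x ∈ points n, v.1 x = w.1 x) : v = w := by
  apply Subtype.ext; funext x
  by_cases hx : x ∈ points n
  · exact h x hx
  · rw [vec_eq_zero v hx, vec_eq_zero w hx]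

/-- Build an odd vector from an odd function. -/
noncomputable def mkVec (n : ℕ) (f : ℤ → ℤ) (hf : ∀ x, f (-x) = -f x) : Vec n :=
  ⟨fun x => if x ∈ points n then f x else 0, fun x => by
    simp only [neg_mem_points, hf]; split_ifs <;> simp, fun x hx => by simp [hx]⟩

theorem mkVec_apply {n : ℕ} {f : ℤ → ℤ} {hf : ∀ x, f (-x) = -f x} {x : ℤ} (hx : x ∈ points n) :
    (mkVec n f hf).1 x = f x := if_pos hx

/-! ### Odd vectors, roots, dominance and inversions. -/

section Action

variable {n : ℕ} [Fact (2 ≤ n)]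

theorem two_le (n : ℕ) [h : Fact (2 ≤ n)] : 2 ≤ n := h.out

noncomputable instance : MulAction (D n) (Vec n) where
  smul w v := ⟨fun x => v.1 (act n w⁻¹ x), fun x => by
    change v.1 _ = -v.1 _
    rw [act_neg (two_le n), vec_neg v],
    fun x hx => vec_eq_zero v (by rwa [act_mem_points])⟩
  one_smul v := by
    apply Subtype.ext; funext x
    change v.1 (act n 1⁻¹ x) = v.1 x
    simp
  mul_smul a b v := by
    apply Subtype.ext; funext x
    change v.1 (act n (a * b)⁻¹ x) = v.1 (act n b⁻¹ (act n a⁻¹ x))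
    rw [mul_inv_rev, map_mul]; rfl

theorem smul_apply (w : D n) (v : Vec n) (x : ℤ) : (w • v).1 x = v.1 (act n w⁻¹ x) := rfl

theorem smul_apply_act (w : D n) (v : Vec n) (x : ℤ) : (w • v).1 (act n w x) = v.1 x := by
  rw [smul_apply, act_inv_act]

theorem s_smul_apply (i : Fin n) (v : Vec n) (x : ℤ) : (s n i • v).1 x = v.1 (genFun i x) := by
  rw [smul_apply, s_inv (two_le n), act_s (two_le n)]

/-- The left and right points of a simple root. -/
def lpt (i : ℕ) : ℤ := if i = 0 then -1 else i
/-- The right point of a simple root. -/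
def rpt (i : ℕ) : ℤ := if i = 0 then 2 else i + 1

theorem lpt_mem (i : Fin n) : lpt i ∈ points n := by
  have := i.2; have := two_le n
  rw [mem_points, lpt]; split_ifs <;> omega

theorem rpt_mem (i : Fin n) : rpt i ∈ points n := by
  have := i.2; have := two_le n
  rw [mem_points, rpt]; split_ifs <;> omega

theorem lpt_lt_rpt (i : ℕ) : lpt i < rpt i := by rw [lpt, rpt]; split_ifs <;> omega
theorem lpt_add_rpt (i : ℕ) : lpt i + rpt i ≠ 0 := by rw [lpt, rpt]; split_ifs <;> omega

/-- The simple roots. -/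
def al (i : Fin n) : Vec n →+ ℤ where
  toFun v := v.1 (rpt i) - v.1 (lpt i)
  map_zero' := by simp
  map_add' a b := by simp; ring

theorem al_apply (i : Fin n) (v : Vec n) : al i v = v.1 (rpt i) - v.1 (lpt i) := rfl

/-- `Rt n x y`: the functional `v ↦ v y - v x` is a root (or zero). -/
def Rt (n : ℕ) (x y : ℤ) : Prop := x ∈ points n ∧ y ∈ points n ∧ x + y ≠ 0

theorem Rt.symm {x y : ℤ} (h : Rt n x y) : Rt n y x := ⟨h.2.1, h.1, by rw [add_comm]; exact h.2.2⟩

theorem Rt.neg {x y : ℤ} (h : Rt n x y) : Rt n (-y) (-x) :=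
  ⟨neg_mem_points.2 h.2.1, neg_mem_points.2 h.1, by have := h.2.2; omega⟩

theorem Rt.act {x y : ℤ} (h : Rt n x y) (w : D n) : Rt n (act n w x) (act n w y) := by
  refine ⟨(act_mem_points w).2 h.1, (act_mem_points w).2 h.2.1, fun h0 => h.2.2 ?_⟩
  have : DescentD.act n w x = DescentD.act n w (-y) := by rw [act_neg (two_le n)]; omega
  have := (DescentD.act n w).injective this
  omega

theorem Rt_simple (i : Fin n) : Rt n (lpt i) (rpt i) := ⟨lpt_mem i, rpt_mem i, lpt_add_rpt i⟩

/-- Positive roots are non-negative combinations of simple roots. -/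
theorem exists_decomp {x y : ℤ} (h : Rt n x y) (hxy : x ≤ y) :
    ∃ c : Fin n → ℕ, ∀ v : Vec n, v.1 y - v.1 x = ∑ i, (c i : ℤ) * al i v := by
  have hn := two_le n
  let P (x y : ℤ) : Prop := ∃ c : Fin n → ℕ, ∀ v : Vec n, v.1 y - v.1 x = ∑ i, (c i : ℤ) * al i v
  have trans : ∀ {x y z}, P x y → P y z → P x z := by
    rintro x y z ⟨c, hc⟩ ⟨d, hd⟩
    refine ⟨c + d, fun v => ?_⟩
    have : v.1 z - v.1 x = (v.1 y - v.1 x) + (v.1 z - v.1 y) := by ring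
    rw [this, hc, hd, ← Finset.sum_add_distrib]
    simp [add_mul]
  have neg : ∀ {x y}, P x y → P (-y) (-x) := by
    rintro x y ⟨c, hc⟩
    refine ⟨c, fun v => ?_⟩
    rw [← hc, vec_neg v, vec_neg v]; ring
  have refl : ∀ x, P x x := fun x => ⟨0, by simp⟩
  have simple : ∀ i : Fin n, P (lpt i) (rpt i) := fun i =>
    ⟨Pi.single i 1, fun v => by simp [Pi.single_apply, al_apply]⟩
  have pos : ∀ a b : ℤ, 1 ≤ a → a ≤ b → b ≤ n → P a b := by
    intro a b ha hab
    induction b, hab using Int.leInduction with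
    | base => intro _; exact refl a
    | succ b hb ih =>
      intro hbn
      have := simple ⟨b.toNat, by omega⟩
      rw [lpt, rpt] at this
      have h0 : b.toNat ≠ 0 := by omega
      simp only [h0, if_false] at this
      rw [Int.toNat_of_nonneg (by omega)] at this
      exact trans (ih (by omega)) this
  -- The chain runs from `-a` to `-1`, crosses to `2` by the simple root of `s_{1'}`, and climbs to
  -- `b`; here `a < b` guarantees `2 ≤ b`.
  have key : ∀ a b : ℤ, 1 ≤ a → a < b → b ≤ n → P (-a) b := by
    intro a b ha hab hb
    have h0 := simple ⟨0, by omega⟩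
    simp only [lpt, rpt, if_true] at h0
    exact trans (neg (pos 1 a le_rfl ha (by omega))) (trans h0 (pos 2 b (by omega) (by omega) hb))
  obtain ⟨hx, hy, hne⟩ := h
  rw [mem_points] at hx hy
  change P x y
  rcases lt_or_gt_of_ne hx.1 with h1 | h1
  · rcases lt_or_gt_of_ne hy.1 with h2 | h2
    · simpa using neg (pos (-y) (-x) (by omega) (by omega) (by omega))
    -- The pairs `(x, y)` and `(-y, -x)` describe the same functional, so the smaller absolute value
    -- may be put on the negative side.
    · rcases lt_or_gt_of_ne hne with h3 | h3
      · simpa using neg (key y (-x) (by omega) (by omega) (by omega))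
      · simpa using key (-x) y (by omega) (by omega) (by omega)
  · exact pos x y (by omega) hxy (by omega)

/-- Dominant vectors. -/
def Dominant (v : Vec n) : Prop := ∀ i : Fin n, 0 ≤ al i v

theorem Dominant.le {v : Vec n} (hv : Dominant v) {x y : ℤ} (h : Rt n x y) (hxy : x ≤ y) :
    v.1 x ≤ v.1 y := by
  obtain ⟨c, hc⟩ := exists_decomp h hxy
  have := hc v
  have : 0 ≤ v.1 y - v.1 x := by
    rw [this]; exact Finset.sum_nonneg fun i _ => mul_nonneg (by positivity) (hv i)
  omega

/-- The vector `ρ`, the identity on the points. -/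
noncomputable def rho (n : ℕ) : Vec n := mkVec n id (fun _ => rfl)

theorem rho_apply {x : ℤ} (hx : x ∈ points n) : (rho n).1 x = x := mkVec_apply hx

theorem smul_rho_apply (w : D n) {x : ℤ} (hx : x ∈ points n) : (w • rho n).1 x = act n w⁻¹ x := by
  rw [smul_apply, rho_apply]; rwa [act_mem_points]

/-- The pairs of points that describe positive roots on which `v` is negative. -/
noncomputable def invSet (v : Vec n) : Finset (ℤ × ℤ) :=
  open Classical in
  (points n ×ˢ points n).filter fun q => Rt n q.1 q.2 ∧ q.1 < q.2 ∧ v.1 q.2 < v.1 q.1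

theorem mem_invSet {v : Vec n} {q : ℤ × ℤ} :
    q ∈ invSet v ↔ Rt n q.1 q.2 ∧ q.1 < q.2 ∧ v.1 q.2 < v.1 q.1 := by
  classical
  simp only [invSet, Finset.mem_filter, Finset.mem_product]
  exact ⟨fun h => h.2, fun h => ⟨⟨h.1.1, h.1.2.1⟩, h⟩⟩

/-- A simple reflection permutes the positive roots other than its own simple root, which is
excluded here in both of its descriptions by pairs. -/
theorem genFun_lt {i : ℕ} {x y : ℤ} (hx : x ≠ 0) (hy : y ≠ 0) (hne : x + y ≠ 0) (h : x < y)
    (h1 : ¬ (x = lpt i ∧ y = rpt i)) (h2 : ¬ (x = -rpt i ∧ y = -lpt i)) :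
    genFun i x < genFun i y := by
  simp only [genFun, lpt, rpt] at *
  split_ifs at * <;> omega

theorem genFun_lpt (i : ℕ) : genFun i (lpt i) = rpt i := by
  simp only [genFun, lpt, rpt]; split_ifs <;> omega

theorem genFun_rpt (i : ℕ) : genFun i (rpt i) = lpt i := by
  simp only [genFun, lpt, rpt]; split_ifs <;> omega

theorem al_s_smul (i : Fin n) (v : Vec n) : al i (s n i • v) = -al i v := by
  rw [al_apply, al_apply, s_smul_apply, s_smul_apply, genFun_lpt, genFun_rpt]; ring

theorem Rt.genFun {x y : ℤ} (h : Rt n x y) (i : Fin n) :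
    Rt n (genFun i x) (genFun i y) := by
  have := h.act (s n i); rwa [act_s (two_le n), act_s (two_le n)] at this

/-- A simple reflection that makes a negative simple coordinate positive removes two inversions. -/
theorem card_invSet_s_smul {i : Fin n} {v : Vec n} (hi : al i v < 0) :
    (invSet v).card = (invSet (s n i • v)).card + 2 := by
  classical
  have hlr := lpt_lt_rpt i
  have hne := lpt_add_rpt i
  -- The simple root is recorded by two pairs, which accounts for the summand `2`. The reflection
  -- matches the remaining inversions of `v` with the inversions of its image.
  set q1 : ℤ × ℤ := (lpt i, rpt i) with hq1
  set q2 : ℤ × ℤ := (-rpt i, -lpt i) with hq2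
  have hq : q1 ≠ q2 := by simp only [hq1, hq2, ne_eq, Prod.mk.injEq]; omega
  have hR := Rt_simple i
  rw [al_apply] at hi
  have m1 : q1 ∈ invSet v := mem_invSet.2 ⟨hR, hlr, by simp only [hq1]; omega⟩
  have m2 : q2 ∈ invSet v := mem_invSet.2 ⟨hR.neg, by simp only [hq2]; omega, by
    simp only [hq2, vec_neg v]; omega⟩
  have hsub : ({q1, q2} : Finset (ℤ × ℤ)) ⊆ invSet v := by
    intro q hq; simp only [Finset.mem_insert, Finset.mem_singleton] at hq
    rcases hq with rfl | rfl <;> assumption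
  have hc : (invSet v \ {q1, q2}).card = (invSet (s n i • v)).card := by
    refine Finset.card_bij' (fun q _ => (genFun i q.1, genFun i q.2))
      (fun q _ => (genFun i q.1, genFun i q.2)) ?_ ?_ ?_ ?_
    · rintro ⟨x, y⟩ h
      simp only [Finset.mem_sdiff, mem_invSet, Finset.mem_insert, Finset.mem_singleton, hq1, hq2,
        Prod.mk.injEq, not_or] at h
      obtain ⟨⟨hr, hlt, hv⟩, h1, h2⟩ := h
      refine mem_invSet.2 ⟨hr.genFun i, genFun_lt (mem_points.1 hr.1).1 (mem_points.1 hr.2.1).1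
        hr.2.2 hlt h1 h2, ?_⟩
      simpa [s_smul_apply, genFun_genFun] using hv
    · rintro ⟨x, y⟩ h
      rw [mem_invSet] at h
      obtain ⟨hr, hlt, hv⟩ := h
      simp only [s_smul_apply] at hv hr hlt
      have h1 : ¬ (x = lpt i ∧ y = rpt i) := by
        rintro ⟨rfl, rfl⟩; rw [genFun_lpt, genFun_rpt] at hv; omega
      have h2 : ¬ (x = -rpt i ∧ y = -lpt i) := by
        rintro ⟨rfl, rfl⟩
        rw [genFun_neg, genFun_neg, genFun_lpt, genFun_rpt, vec_neg v, vec_neg v] at hv; omega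
      simp only [Finset.mem_sdiff, mem_invSet, Finset.mem_insert, Finset.mem_singleton, hq1, hq2,
        Prod.mk.injEq, not_or]
      have hlt' := genFun_lt (mem_points.1 hr.1).1 (mem_points.1 hr.2.1).1 hr.2.2 hlt h1 h2
      refine ⟨⟨hr.genFun i, hlt', hv⟩, fun ⟨e1, e2⟩ => ?_, fun ⟨e1, e2⟩ => ?_⟩
      · have e1 := congrArg (genFun i) e1; have e2 := congrArg (genFun i) e2
        rw [genFun_genFun] at e1 e2
        rw [genFun_lpt] at e1; rw [genFun_rpt] at e2; omega
      · have e1 := congrArg (genFun i) e1; have e2 := congrArg (genFun i) e2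
        rw [genFun_genFun, genFun_neg] at e1 e2
        rw [genFun_rpt] at e1; rw [genFun_lpt] at e2; omega
    · rintro ⟨x, y⟩ _; simp [genFun_genFun]
    · rintro ⟨x, y⟩ _; simp [genFun_genFun]
  have := Finset.card_sdiff_add_card_eq_card hsub
  rw [Finset.card_pair hq] at this
  omega

/-- Every vector can be moved to a dominant one. -/
theorem exists_dominant (v : Vec n) : ∃ g : D n, Dominant (g • v) := by
  induction hk : (invSet v).card using Nat.strong_induction_on generalizing v with
  | _ k ih =>
    by_cases hd : Dominant v
    · exact ⟨1, by rwa [one_smul]⟩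
    · obtain ⟨i, hi⟩ : ∃ i, al i v < 0 := by simpa [Dominant] using hd
      have := card_invSet_s_smul hi
      obtain ⟨g, hg⟩ := ih _ (by omega) (s n i • v) rfl
      exact ⟨g * s n i, by rwa [mul_smul]⟩

end Action

/-! ### Odd permutations of the points and their signs -/

theorem perm_inv_apply {α : Type*} (σ : Equiv.Perm α) (x : α) : σ⁻¹ (σ x) = x :=
  σ.symm_apply_apply x

theorem perm_apply_inv {α : Type*} (σ : Equiv.Perm α) (x : α) : σ (σ⁻¹ x) = x :=
  σ.apply_symm_apply x

/-- The odd permutations of `ℤ` that fix everything outside the points. -/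
def oddPerms (n : ℕ) : Subgroup (Equiv.Perm ℤ) where
  carrier := {τ | (∀ x, τ (-x) = -τ x) ∧ ∀ x, x ∉ points n → τ x = x}
  one_mem' := by simp
  mul_mem' := by
    rintro a b ⟨ha, ha'⟩ ⟨hb, hb'⟩
    exact ⟨fun x => by simp [hb, ha], fun x hx => by simp [hb' x hx, ha' x hx]⟩
  inv_mem' := by
    rintro a ⟨ha, ha'⟩
    refine ⟨fun x => ?_, fun x hx => ?_⟩
    · rw [Equiv.Perm.inv_eq_iff_eq, ha, perm_apply_inv]
    · rw [Equiv.Perm.inv_eq_iff_eq, ha' x hx]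

theorem oddPerms_neg {n : ℕ} {τ : Equiv.Perm ℤ} (h : τ ∈ oddPerms n) (x : ℤ) : τ (-x) = -τ x :=
  h.1 x

theorem oddPerms_mem {n : ℕ} {τ : Equiv.Perm ℤ} (h : τ ∈ oddPerms n) {x : ℤ} (hx : x ∈ points n) :
    τ x ∈ points n := by
  by_contra h0
  have := h.2 _ h0
  rw [EmbeddingLike.apply_eq_iff_eq] at this
  rw [this] at h0
  exact h0 hx

theorem act_mem_oddPerms {n : ℕ} [Fact (2 ≤ n)] (w : D n) : act n w ∈ oddPerms n :=
  ⟨act_neg (two_le n) w, fun _ hx => act_of_notMem w hx⟩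

/-- The product of the signs of the images of `1, …, n`. -/
noncomputable def eps (n : ℕ) (τ : Equiv.Perm ℤ) : ℤ := ∏ x ∈ Finset.Icc (1 : ℤ) n, (τ x).sign

theorem odd_eq_sign_mul {f : ℤ → ℤ} (hf : ∀ x, f (-x) = -f x) {x : ℤ} (hx : x ≠ 0) :
    f x = x.sign * f |x| := by
  rcases lt_or_gt_of_ne hx with h | h
  · rw [abs_of_neg h, hf, Int.sign_eq_neg_one_of_neg h]; ring
  · rw [abs_of_pos h, Int.sign_eq_one_of_pos h]; ring

theorem abs_mem_Icc {n : ℕ} {x : ℤ} (hx : x ∈ points n) : |x| ∈ Finset.Icc (1 : ℤ) n := by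
  rw [mem_points] at hx; rw [Finset.mem_Icc]
  rcases abs_cases x with h | h <;> omega

theorem mem_points_of_Icc {n : ℕ} {x : ℤ} (hx : x ∈ Finset.Icc (1 : ℤ) n) : x ∈ points n := by
  rw [Finset.mem_Icc] at hx; rw [mem_points]; omega

/-- Up to sign, `τ` permutes `1, …, n`; oddness of `f` turns each sign of an image into a factor.
This gives both the multiplicativity of `eps` and the invariance of products of coordinates under
`D_n`. -/
theorem prod_odd_comp {n : ℕ} {τ : Equiv.Perm ℤ} (h : τ ∈ oddPerms n) {f : ℤ → ℤ}
    (hf : ∀ x, f (-x) = -f x) :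
    ∏ x ∈ Finset.Icc (1 : ℤ) n, f (τ x) = eps n τ * ∏ x ∈ Finset.Icc (1 : ℤ) n, f x := by
  have h1 : ∏ x ∈ Finset.Icc (1 : ℤ) n, f (τ x) =
      ∏ x ∈ Finset.Icc (1 : ℤ) n, ((τ x).sign * f |τ x|) :=
    Finset.prod_congr rfl fun x hx => odd_eq_sign_mul hf
      (mem_points.1 (oddPerms_mem h (mem_points_of_Icc hx))).1
  rw [h1, Finset.prod_mul_distrib, eps]
  congr 1
  have key : ∀ σ ∈ oddPerms n, ∀ x ∈ Finset.Icc (1 : ℤ) n, |σ⁻¹ (|σ x|)| = x := by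
    intro σ hσ x hx
    rcases abs_choice (σ x) with h | h <;> rw [h]
    · simp only [perm_inv_apply]
      rw [Finset.mem_Icc] at hx; exact abs_of_pos (by omega)
    · rw [oddPerms_neg (inv_mem hσ), perm_inv_apply, abs_neg]
      rw [Finset.mem_Icc] at hx; exact abs_of_pos (by omega)
  refine Finset.prod_bij' (fun x _ => |τ x|) (fun x _ => |τ⁻¹ x|)
    (fun x hx => abs_mem_Icc (oddPerms_mem h (mem_points_of_Icc hx)))
    (fun x hx => abs_mem_Icc (oddPerms_mem (inv_mem h) (mem_points_of_Icc hx)))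
    (fun x hx => key τ h x hx) (fun x hx => ?_) (fun x _ => rfl)
  simpa using key τ⁻¹ (inv_mem h) x hx

theorem eps_mul {n : ℕ} {σ τ : Equiv.Perm ℤ} (hσ : σ ∈ oddPerms n) (hτ : τ ∈ oddPerms n) :
    eps n (σ * τ) = eps n σ * eps n τ := by
  have := prod_odd_comp hτ (f := fun x => (σ x).sign) (fun x => by
    rw [oddPerms_neg hσ, Int.sign_neg])
  rw [mul_comm]; exact this

theorem eps_one (n : ℕ) : eps n 1 = 1 := by
  refine Finset.prod_eq_one fun x hx => ?_
  rw [Finset.mem_Icc] at hx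
  exact Int.sign_eq_one_of_pos (by simp; omega)

theorem Icc_eq_insert {n : ℕ} (hn : 2 ≤ n) :
    Finset.Icc (1 : ℤ) n = insert 1 (insert 2 (Finset.Icc (3 : ℤ) n)) := by
  ext x; simp only [Finset.mem_insert, Finset.mem_Icc]; omega

theorem eps_act {n : ℕ} [Fact (2 ≤ n)] (w : D n) : eps n (act n w) = 1 := by
  have hn := two_le n
  induction w using D_induction hn with
  | h1 => rw [map_one, eps_one]
  | hs i w ih =>
    rw [map_mul, eps_mul (act_mem_oddPerms _) (act_mem_oddPerms _), ih, mul_one, eps]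
    simp only [act_s hn]
    by_cases hi : (i : ℕ) = 0
    · rw [Icc_eq_insert hn, Finset.prod_insert (by simp), Finset.prod_insert (by simp),
        Finset.prod_eq_one]
      · simp [genFun, hi]
      · intro x hx
        rw [Finset.mem_Icc] at hx
        refine Int.sign_eq_one_of_pos ?_
        simp only [genFun]; split_ifs <;> omega
    · refine Finset.prod_eq_one fun x hx => ?_
      rw [Finset.mem_Icc] at hx
      refine Int.sign_eq_one_of_pos ?_
      simp only [genFun]; split_ifs <;> omega

/-! ### Which odd permutations lie in `D_n`, uniqueness of dominant vectors, length and faces. -/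

section Action

variable {n : ℕ} [Fact (2 ≤ n)]

/-- The inequalities give `|τ 1| < τ 2 < ⋯ < τ n`, and the even number of sign changes makes `τ 1`
positive. An increasing map of `1, …, n` into itself is the identity. -/
theorem eq_one_of_increasing {τ : Equiv.Perm ℤ} (hτ : τ ∈ oddPerms n) (he : eps n τ = 1)
    (hi : ∀ i : Fin n, τ (lpt i) < τ (rpt i)) : τ = 1 := by
  have hn := two_le n
  have step : ∀ x : ℤ, 1 ≤ x → x < n → τ x < τ (x + 1) := by
    intro x h1 h2
    have := hi ⟨x.toNat, by omega⟩
    rw [lpt, rpt] at this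
    have h0 : x.toNat ≠ 0 := by omega
    simp only [h0, if_false] at this
    rwa [Int.toNat_of_nonneg (by omega)] at this
  have h12 : -τ 1 < τ 2 := by
    have := hi ⟨0, by omega⟩
    simp only [lpt, rpt, if_true] at this
    rwa [oddPerms_neg hτ] at this
  have hmem : ∀ x : ℤ, 1 ≤ x → x ≤ n → τ x ∈ points n := fun x h1 h2 =>
    oddPerms_mem hτ (mem_points_of_Icc (Finset.mem_Icc.2 ⟨h1, h2⟩))
  have h1ne : τ 1 ≠ 0 := (mem_points.1 (hmem 1 le_rfl (by omega))).1
  have h12' := step 1 le_rfl (by omega)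
  norm_num at h12'
  have h2pos : ∀ x : ℤ, 2 ≤ x → x ≤ n → 0 < τ x := by
    intro x hx
    induction x, hx using Int.leInduction with
    | base => intro _; omega
    | succ x hx ih => intro h; have := step x (by omega) (by omega); have := ih (by omega); omega
  have h1pos : 0 < τ 1 := by
    by_contra h
    have hneg : τ 1 < 0 := by omega
    have : Finset.Icc (1 : ℤ) n = insert 1 (Finset.Icc (2 : ℤ) n) := by
      ext x; simp only [Finset.mem_insert, Finset.mem_Icc]; omega
    rw [eps, this, Finset.prod_insert (by simp), Finset.prod_eq_one,
      Int.sign_eq_neg_one_of_neg hneg] at he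
    · norm_num at he
    · intro x hx; rw [Finset.mem_Icc] at hx
      exact Int.sign_eq_one_of_pos (h2pos x hx.1 hx.2)
  have lower : ∀ x : ℤ, 1 ≤ x → x ≤ n → x ≤ τ x := by
    intro x hx
    induction x, hx using Int.leInduction with
    | base => intro _; omega
    | succ x hx ih => intro h; have := step x (by omega) (by omega); have := ih (by omega); omega
  have upper : ∀ k : ℕ, (k : ℤ) < n → τ (n - k) ≤ n - k := by
    intro k
    induction k with
    | zero => intro _; have := (mem_points.1 (hmem n (by omega) le_rfl)).2.2; simpa using this
    | succ k ih =>
      intro h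
      have h1 := ih (by push_cast at h; omega)
      have h2 := step (n - (k + 1 : ℕ)) (by omega) (by push_cast; omega)
      rw [show (n : ℤ) - (k + 1 : ℕ) + 1 = n - k by push_cast; ring] at h2
      push_cast at *
      omega
  have eq : ∀ x : ℤ, 1 ≤ x → x ≤ n → τ x = x := by
    intro x h1 h2
    have := upper (n - x).toNat (by omega)
    rw [Int.toNat_of_nonneg (by omega)] at this
    have := lower x h1 h2
    simp only [sub_sub_cancel] at *
    omega
  ext x
  rw [Equiv.Perm.one_apply]
  by_cases hx : x ∈ points n
  · rw [mem_points] at hx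
    rcases lt_or_gt_of_ne hx.1 with h | h
    · have := eq (-x) (by omega) (by omega)
      rw [oddPerms_neg hτ] at this; omega
    · exact eq x (by omega) (by omega)
  · exact hτ.2 x hx

/-- An odd permutation of the points with an even number of sign changes is in `D_n`. -/
theorem exists_act_eq {τ : Equiv.Perm ℤ} (hτ : τ ∈ oddPerms n) (he : eps n τ = 1) :
    ∃ g : D n, act n g = τ := by
  -- The vector `x ↦ τ⁻¹ x` is a signed rearrangement of `ρ`. An element `g` that makes it dominant
  -- makes `τ⁻¹ * act n g⁻¹` increasing, hence trivial.
  obtain ⟨g, hg⟩ := exists_dominant (mkVec n ⇑τ⁻¹ (oddPerms_neg (inv_mem hτ)))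
  have hmem := mul_mem (inv_mem hτ) (act_mem_oddPerms g⁻¹)
  have hinv : eps n τ⁻¹ = 1 := by
    have := eps_mul (inv_mem hτ) hτ
    rw [inv_mul_cancel, eps_one, he, mul_one] at this; exact this.symm
  have h1 : τ⁻¹ * act n g⁻¹ = 1 := by
    refine eq_one_of_increasing hmem ?_ fun i => ?_
    · rw [eps_mul (inv_mem hτ) (act_mem_oddPerms _), eps_act, hinv, mul_one]
    · have := hg i
      rw [al_apply, smul_apply, smul_apply, mkVec_apply ((act_mem_points _).2 (lpt_mem i)),
        mkVec_apply ((act_mem_points _).2 (rpt_mem i))] at this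
      have hne : (τ⁻¹ * act n g⁻¹) (lpt i) ≠ (τ⁻¹ * act n g⁻¹) (rpt i) := by
        rw [Ne, EmbeddingLike.apply_eq_iff_eq]; exact (lpt_lt_rpt i).ne
      simp only [Equiv.Perm.mul_apply] at hne ⊢
      omega
  exact ⟨g⁻¹, (inv_mul_eq_one.1 h1).symm⟩

/-- `ρ` has trivial stabilizer among the elements that keep it dominant. -/
theorem eq_one_of_dominant_rho {g : D n} (h : Dominant (g • rho n)) : g = 1 := by
  have : act n g⁻¹ = 1 := by
    refine eq_one_of_increasing (act_mem_oddPerms _) (eps_act _) fun i => ?_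
    have := h i
    rw [al_apply, smul_rho_apply _ (lpt_mem i), smul_rho_apply _ (rpt_mem i)] at this
    have hne : act n g⁻¹ (lpt i) ≠ act n g⁻¹ (rpt i) := by
      rw [Ne, EmbeddingLike.apply_eq_iff_eq]; exact (lpt_lt_rpt i).ne
    omega
  rw [← map_one (act n)] at this
  exact inv_eq_one.1 (act_injective n this)

theorem al_rho_ne (g : D n) (i : Fin n) : al i (g • rho n) ≠ 0 := by
  rw [al_apply, smul_rho_apply _ (lpt_mem i), smul_rho_apply _ (rpt_mem i), sub_ne_zero, Ne,
    EmbeddingLike.apply_eq_iff_eq]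
  exact (lpt_lt_rpt i).ne'

theorem s_smul_eq_self {i : Fin n} {v : Vec n} (h : al i v = 0) : s n i • v = v := by
  apply Subtype.ext; funext x
  rw [s_smul_apply]
  rw [al_apply] at h
  by_cases h1 : x = lpt i
  · rw [h1, genFun_lpt]; omega
  by_cases h2 : x = rpt i
  · rw [h2, genFun_rpt]; omega
  by_cases h3 : x = -lpt i
  · rw [h3, genFun_neg, genFun_lpt, vec_neg, vec_neg]; omega
  by_cases h4 : x = -rpt i
  · rw [h4, genFun_neg, genFun_rpt, vec_neg, vec_neg]; omega
  simp only [genFun, lpt, rpt] at *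
  split_ifs at * <;> omega

/-- A dominant vector is the only dominant one in its orbit, and its stabilizer is generated by
simple reflections. -/
theorem dominant_unique {v : Vec n} (hv : Dominant v) {g : D n} (hg : Dominant (g • v)) :
    g • v = v ∧ g ∈ Subgroup.closure (s n '' {i | al i v = 0}) := by
  induction hk : (invSet (g⁻¹ • rho n)).card using Nat.strong_induction_on generalizing g with
  | _ k ih =>
    by_cases hd : Dominant (g⁻¹ • rho n)
    · have := eq_one_of_dominant_rho hd
      rw [inv_eq_one] at this
      subst this
      exact ⟨one_smul _ _, one_mem _⟩
    · obtain ⟨i, hi⟩ : ∃ i, al i (g⁻¹ • rho n) < 0 := by simpa [Dominant] using hd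
      have hc := card_invSet_s_smul hi
      -- Here `g` sends the simple root `i` to a negative root. Dominance of `g • v` then bounds `al
      -- i v` above by zero, so the reflection fixes `v` and can be split off `g`.
      have h0 : al i v = 0 := by
        refine le_antisymm ?_ (hv i)
        rw [al_apply, smul_rho_apply _ (lpt_mem i), smul_rho_apply _ (rpt_mem i), inv_inv] at hi
        have := hg.le (((Rt_simple i).act g).symm) (by omega)
        rw [smul_apply_act, smul_apply_act] at this
        rw [al_apply]; omega
      have hs := s_smul_eq_self h0
      have hgs : (g * s n i) • v = g • v := by rw [mul_smul, hs]
      have hinv : (g * s n i)⁻¹ • rho n = s n i • g⁻¹ • rho n := by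
        rw [mul_inv_rev, s_inv (two_le n), mul_smul]
      obtain ⟨h1, h2⟩ := ih _ (by rw [hinv]; omega) (g := g * s n i) (by rwa [hgs]) rfl
      refine ⟨hgs ▸ h1, ?_⟩
      have h3 : s n i ∈ Subgroup.closure (s n '' {i | al i v = 0}) :=
        Subgroup.subset_closure ⟨i, h0, rfl⟩
      have := mul_mem h2 h3
      rwa [mul_assoc, s_mul_s (two_le n), mul_one] at this

/-! ### The length function -/

theorem inv_mul_s_smul_rho (w : D n) (i : Fin n) :
    (w * s n i)⁻¹ • rho n = s n i • w⁻¹ • rho n := by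
  rw [mul_inv_rev, s_inv (two_le n), mul_smul]

theorem card_invSet_mul_s_of_pos {w : D n} {i : Fin n} (h : 0 < al i (w⁻¹ • rho n)) :
    (invSet ((w * s n i)⁻¹ • rho n)).card = (invSet (w⁻¹ • rho n)).card + 2 := by
  have := card_invSet_s_smul (i := i) (v := s n i • w⁻¹ • rho n) (by rw [al_s_smul]; omega)
  rw [smul_smul (s n i) (s n i), s_mul_s (two_le n), one_smul] at this
  rw [inv_mul_s_smul_rho, this]

theorem card_invSet_mul_s_of_neg {w : D n} {i : Fin n} (h : al i (w⁻¹ • rho n) < 0) :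
    (invSet (w⁻¹ • rho n)).card = (invSet ((w * s n i)⁻¹ • rho n)).card + 2 := by
  rw [inv_mul_s_smul_rho]; exact card_invSet_s_smul h

theorem invSet_rho : invSet (rho n) = ∅ := by
  ext ⟨x, y⟩
  simp only [mem_invSet, Finset.notMem_empty, iff_false]
  rintro ⟨h, h1, h2⟩
  rw [rho_apply h.1, rho_apply h.2.1] at h2
  omega

theorem card_invSet_le (l : List (Fin n)) :
    (invSet ((l.map (s n)).prod⁻¹ • rho n)).card ≤ 2 * l.length := by
  induction l using List.reverseRecOn with
  | nil => simp [invSet_rho]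
  | append_singleton l i ih =>
    simp only [List.map_append, List.map_cons, List.map_nil, List.prod_append, List.prod_cons,
      List.prod_nil, mul_one, List.length_append, List.length_cons, List.length_nil]
    rcases lt_or_gt_of_ne (al_rho_ne (l.map (s n)).prod⁻¹ i) with h | h
    · have := card_invSet_mul_s_of_neg h; omega
    · have := card_invSet_mul_s_of_pos h; omega

theorem exists_word (w : D n) : ∃ l : List (Fin n), (l.map (s n)).prod = w ∧
    2 * l.length = (invSet (w⁻¹ • rho n)).card := by
  induction hk : (invSet (w⁻¹ • rho n)).card using Nat.strong_induction_on generalizing w with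
  | _ k ih =>
    by_cases hd : Dominant (w⁻¹ • rho n)
    · have := eq_one_of_dominant_rho hd
      rw [inv_eq_one] at this
      subst this
      refine ⟨[], rfl, ?_⟩
      rw [← hk]; simp [invSet_rho]
    · obtain ⟨i, hi⟩ : ∃ i, al i (w⁻¹ • rho n) < 0 := by simpa [Dominant] using hd
      have hc := card_invSet_mul_s_of_neg hi
      obtain ⟨l, hl, hl'⟩ := ih _ (by omega) (w * s n i) rfl
      refine ⟨l ++ [i], ?_, ?_⟩
      · simp [hl, mul_assoc, s_mul_s (two_le n)]
      · simp; omega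

/-- A letter changes the number of inversions by two, which bounds it by twice the length of any
word; removing descents one at a time produces a word that attains the bound. -/
theorem two_mul_length (w : D n) : 2 * length w = (invSet (w⁻¹ • rho n)).card := by
  obtain ⟨l, hl, hl'⟩ := exists_word w
  have hmem : l.length ∈ {r | ∃ l : List (Fin n), l.length = r ∧ (l.map (s n)).prod = w} :=
    ⟨l, rfl, hl⟩
  have h1 : length w ≤ l.length := Nat.sInf_le hmem
  obtain ⟨m, hm, hm'⟩ := Nat.sInf_mem ⟨_, hmem⟩
  have h2 : m.length = length w := hm
  have h3 := card_invSet_le m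
  rw [hm'] at h3
  omega

/-! ### Faces -/

/-- Two vectors lie in the same face of the Coxeter arrangement. -/
def SameFace (v w : Vec n) : Prop := ∀ x y, Rt n x y → (v.1 x < v.1 y ↔ w.1 x < w.1 y)

theorem SameFace.refl (v : Vec n) : SameFace v v := fun _ _ _ => Iff.rfl
theorem SameFace.symm {v w : Vec n} (h : SameFace v w) : SameFace w v :=
  fun x y hxy => (h x y hxy).symm
theorem SameFace.trans {u v w : Vec n} (h : SameFace u v) (h' : SameFace v w) : SameFace u w :=
  fun x y hxy => (h x y hxy).trans (h' x y hxy)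

theorem SameFace.smul {v w : Vec n} (h : SameFace v w) (g : D n) : SameFace (g • v) (g • w) :=
  fun _ _ hxy => h _ _ (hxy.act g⁻¹)

theorem SameFace.eq_iff {v w : Vec n} (h : SameFace v w) {x y : ℤ} (hxy : Rt n x y) :
    v.1 x = v.1 y ↔ w.1 x = w.1 y := by
  have h1 := h x y hxy
  have h2 := h y x hxy.symm
  omega

theorem SameFace.al_pos {v w : Vec n} (h : SameFace v w) (i : Fin n) : 0 < al i v ↔ 0 < al i w := by
  have := h _ _ (Rt_simple i)
  rw [al_apply, al_apply]; omega

theorem SameFace.al_eq {v w : Vec n} (h : SameFace v w) (i : Fin n) : al i v = 0 ↔ al i w = 0 := by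
  have := h.eq_iff (Rt_simple i)
  rw [al_apply, al_apply]; omega

theorem SameFace.dominant {v w : Vec n} (h : SameFace v w) (hv : Dominant v) : Dominant w := by
  intro i
  have h1 := h.al_eq i
  have h2 := h.al_pos i
  have := hv i
  omega

/-- A positive root is a non-negative combination of simple roots, so its sign at a dominant vector
depends only on which simple roots vanish there. -/
theorem sameFace_of_dominant {v w : Vec n} (hv : Dominant v) (hw : Dominant w)
    (h : ∀ i, al i v = 0 ↔ al i w = 0) : SameFace v w := by
  have key : ∀ {v w : Vec n}, Dominant v → Dominant w → (∀ i, al i v = 0 ↔ al i w = 0) →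
      ∀ x y, Rt n x y → v.1 x < v.1 y → w.1 x < w.1 y := by
    intro v w hv hw h x y hr hlt
    have hxy : x ≤ y := by
      by_contra h0
      have := hv.le hr.symm (by omega)
      omega
    obtain ⟨c, hc⟩ := exists_decomp hr hxy
    have h1 := hc v
    obtain ⟨i, -, hi⟩ : ∃ i ∈ Finset.univ, 0 < (c i : ℤ) * al i v := by
      by_contra! h0
      have := Finset.sum_nonpos h0
      omega
    have h2 := hc w
    have : 0 < ∑ i, (c i : ℤ) * al i w := by
      refine Finset.sum_pos' (fun j _ => mul_nonneg (by positivity) (hw j)) ⟨i, Finset.mem_univ _, ?_⟩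
      have hci : 0 < (c i : ℤ) := by
        by_contra h3
        have : (c i : ℤ) = 0 := by omega
        rw [this] at hi; simp at hi
      have : al i v ≠ 0 := by rintro h3; rw [h3] at hi; simp at hi
      have := (h i).not.1 this
      have := hw i
      exact mul_pos hci (by omega)
    omega
  intro x y hr
  exact ⟨key hv hw h x y hr, key hw hv (fun i => (h i).symm) x y hr⟩

/-- The sign as used for fundamental weights. -/
def sg (x : ℤ) : ℤ := if 0 < x then 1 else if x < 0 then -1 else 0

/-- The fundamental weights, up to positive factors. -/
noncomputable def om (i : Fin n) : Vec n :=
  mkVec n (fun x => if (i : ℕ) = 0 then 2 * sg x else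
    if (i : ℕ) = 1 then (if x = 1 ∨ x = -1 then -sg x else sg x) else
    if (i : ℤ) < x ∨ x < -(i : ℤ) then sg x else 0) (fun x => by unfold sg; grind)

theorem al_om_of_ne {i j : Fin n} (h : i ≠ j) : al j (om i) = 0 := by
  have h' : (i : ℕ) ≠ j := fun e => h (Fin.ext e)
  rw [al_apply, om, mkVec_apply (lpt_mem j), mkVec_apply (rpt_mem j)]
  unfold sg lpt rpt; grind

theorem al_om_self (i : Fin n) : 0 < al i (om i) := by
  rw [al_apply, om, mkVec_apply (lpt_mem i), mkVec_apply (rpt_mem i)]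
  unfold sg lpt rpt; grind

/-- The dominant vector that represents the standard face of type `J`. -/
noncomputable def wt (J : Finset (Fin n)) : Vec n := ∑ i ∈ Jᶜ, om i

theorem al_wt_of_mem {J : Finset (Fin n)} {i : Fin n} (h : i ∈ J) : al i (wt J) = 0 := by
  rw [wt, map_sum]
  refine Finset.sum_eq_zero fun j hj => al_om_of_ne ?_
  rintro rfl; exact (Finset.mem_compl.1 hj) h

theorem al_wt_of_notMem {J : Finset (Fin n)} {i : Fin n} (h : i ∉ J) : al i (wt J) = al i (om i) := by
  rw [wt, map_sum]
  exact Finset.sum_eq_single_of_mem i (Finset.mem_compl.2 h) fun j _ hj => al_om_of_ne hj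

theorem al_wt_eq_zero {J : Finset (Fin n)} {i : Fin n} : al i (wt J) = 0 ↔ i ∈ J := by
  refine ⟨fun h => ?_, al_wt_of_mem⟩
  by_contra h0
  rw [al_wt_of_notMem h0] at h
  have := al_om_self i
  omega

theorem dominant_wt (J : Finset (Fin n)) : Dominant (wt J) := by
  intro i
  by_cases h : i ∈ J
  · rw [al_wt_of_mem h]
  · rw [al_wt_of_notMem h]; exact (al_om_self i).le

theorem exists_sameFace (v : Vec n) : ∃ (J : Finset (Fin n)) (g : D n), SameFace v (g • wt J) := by
  classical
  obtain ⟨g, hg⟩ := exists_dominant v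
  refine ⟨Finset.univ.filter fun i => al i (g • v) = 0, g⁻¹, ?_⟩
  have : SameFace (g • v) (wt (Finset.univ.filter fun i => al i (g • v) = 0)) :=
    sameFace_of_dominant hg (dominant_wt _) fun i => by rw [al_wt_eq_zero]; simp
  have := this.smul g⁻¹
  rwa [inv_smul_smul] at this

/-- With the chosen representatives, equality of faces is equality of vectors. Hence faces of type
`J` can be counted as elements of the orbit of `wt J`. -/
theorem sameFace_wt_unique {J L : Finset (Fin n)} {g h : D n}
    (H : SameFace (g • wt J) (h • wt L)) : J = L ∧ g • wt J = h • wt L := by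
  have h1 := H.smul h⁻¹
  rw [inv_smul_smul, ← mul_smul] at h1
  have h2 := h1.symm.dominant (dominant_wt L)
  obtain ⟨h3, -⟩ := dominant_unique (dominant_wt J) h2
  rw [h3] at h1
  have : J = L := by
    ext i; rw [← al_wt_eq_zero, ← al_wt_eq_zero]; exact h1.al_eq i
  subst this
  rw [mul_smul, inv_smul_eq_iff] at h3
  exact ⟨rfl, h3⟩

/-- This identifies the cosets of `W_J` with the faces of type `J`; the non-trivial direction is the
description of stabilizers in `dominant_unique`. -/
theorem smul_wt_eq_self_iff {J : Finset (Fin n)} {g : D n} : g • wt J = wt J ↔ g ∈ parabolic J := by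
  constructor
  · intro h
    have := (dominant_unique (dominant_wt J) (g := g) (by rw [h]; exact dominant_wt J)).2
    have e : {i | al i (wt J) = 0} = (J : Set (Fin n)) := by ext i; simp [al_wt_eq_zero]
    rwa [e] at this
  · intro h
    rw [← MulAction.mem_stabilizer_iff]
    revert g
    change parabolic J ≤ _
    rw [parabolic, Subgroup.closure_le]
    rintro _ ⟨i, hi, rfl⟩
    exact s_smul_eq_self (al_wt_of_mem hi)

theorem eq_of_sameFace_rho {g h : D n} (H : SameFace (g • rho n) (h • rho n)) : g = h := by
  have h1 := H.smul h⁻¹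
  rw [inv_smul_smul, ← mul_smul] at h1
  have hr : Dominant (rho n) := fun i => by
    rw [al_apply, rho_apply (lpt_mem i), rho_apply (rpt_mem i)]; have := lpt_lt_rpt i; omega
  have := eq_one_of_dominant_rho (h1.symm.dominant hr)
  rwa [inv_mul_eq_one, eq_comm] at this

theorem dominant_rho : Dominant (rho n) := fun i => by
  rw [al_apply, rho_apply (lpt_mem i), rho_apply (rpt_mem i)]; have := lpt_lt_rpt i; omega

/-- Vectors that lie on no reflecting hyperplane. -/
def Regular (v : Vec n) : Prop := ∀ x y, Rt n x y → x ≠ y → v.1 x ≠ v.1 y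

theorem Regular.exists_chamber {v : Vec n} (hv : Regular v) : ∃ g : D n, SameFace (g • rho n) v := by
  obtain ⟨J, g, h⟩ := exists_sameFace v
  refine ⟨g, SameFace.trans (SameFace.smul ?_ g) h.symm⟩
  refine sameFace_of_dominant dominant_rho (dominant_wt J) fun i => ?_
  have h1 := h.smul g⁻¹
  rw [inv_smul_smul] at h1
  refine iff_of_false ?_ ?_
  · rw [al_apply, rho_apply (lpt_mem i), rho_apply (rpt_mem i)]; have := lpt_lt_rpt i; omega
  · rw [← h1.al_eq, al_apply, smul_apply, smul_apply, sub_eq_zero, inv_inv]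
    refine (hv _ _ ((Rt_simple i).act g) ?_).symm
    rw [Ne, EmbeddingLike.apply_eq_iff_eq]; exact (lpt_lt_rpt i).ne

/-- The lexicographic combination: a large multiple of `u` plus `v`. -/
noncomputable def star (u v : Vec n) : Vec n := (1 + 2 * ∑ x ∈ points n, |v.1 x|) • u + v

/-- The multiplier `1 + 2 * ∑ |v x|` exceeds every difference of coordinates of `v`, so `v` only
decides ties of `u`. -/
theorem star_lt (u v : Vec n) (x y : ℤ) :
    (star u v).1 x < (star u v).1 y ↔ u.1 x < u.1 y ∨ u.1 x = u.1 y ∧ v.1 x < v.1 y := by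
  have hb : ∀ x, |v.1 x| ≤ ∑ x ∈ points n, |v.1 x| := by
    intro x
    by_cases hx : x ∈ points n
    · exact Finset.single_le_sum (f := fun x => |v.1 x|) (fun _ _ => abs_nonneg _) hx
    · rw [vec_eq_zero v hx]; rw [abs_zero]; exact Finset.sum_nonneg fun x _ => abs_nonneg (v.1 x)
  set M := ∑ x ∈ points n, |v.1 x| with hM
  have hx := abs_le.1 (hb x)
  have hy := abs_le.1 (hb y)
  have hM0 : 0 ≤ M := le_trans (abs_nonneg _) (hb x)
  have e : ∀ x, (star u v).1 x = (1 + 2 * M) * u.1 x + v.1 x := fun x => by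
    simp [star, hM]
  rw [e, e]
  rcases lt_trichotomy (u.1 x) (u.1 y) with h | h | h
  · refine iff_of_true ?_ (Or.inl h)
    nlinarith
  · rw [h]; simp
  · refine iff_of_false ?_ (by omega)
    nlinarith

end Action

section Descent

variable {n : ℕ} [Fact (2 ≤ n)]

/-! ### Projections of chambers onto faces -/

theorem star_eq {u v : Vec n} {x y : ℤ} :
    (star u v).1 x = (star u v).1 y ↔ u.1 x = u.1 y ∧ v.1 x = v.1 y := by
  have h1 := star_lt u v x y
  have h2 := star_lt u v y x
  omega

theorem SameFace.star {u u' v v' : Vec n} (h : SameFace u u') (h' : SameFace v v') :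
    SameFace (star u v) (star u' v') := by
  intro x y hr
  rw [star_lt, star_lt, h x y hr, h' x y hr, h.eq_iff hr]

theorem star_smul (g : D n) (u v : Vec n) :
    SameFace (g • star u v) (star (g • u) (g • v)) := by
  intro x y _
  rw [star_lt, smul_apply, smul_apply, star_lt]; rfl

theorem star_assoc (u v w : Vec n) : SameFace (star u (star v w)) (star (star u v) w) := by
  intro x y _
  rw [star_lt, star_lt, star_lt, star_lt, star_eq]; omega

theorem regular_star (u : Vec n) (w : D n) : Regular (star u (w • rho n)) := by
  intro x y hr hne h
  rw [star_eq, smul_rho_apply _ hr.1, smul_rho_apply _ hr.2.1, EmbeddingLike.apply_eq_iff_eq] at h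
  exact hne h.2

/-- The chamber closest to the chamber of `w` among those that have the face of `u`. -/
noncomputable def proj (u : Vec n) (w : D n) : D n := (regular_star u w).exists_chamber.choose

theorem proj_spec (u : Vec n) (w : D n) : SameFace (proj u w • rho n) (star u (w • rho n)) :=
  (regular_star u w).exists_chamber.choose_spec

theorem proj_eq {u : Vec n} {w g : D n} (h : SameFace (g • rho n) (star u (w • rho n))) :
    proj u w = g := eq_of_sameFace_rho ((proj_spec u w).trans h.symm)

theorem proj_congr {u u' : Vec n} (h : SameFace u u') (w : D n) : proj u w = proj u' w :=
  proj_eq ((proj_spec u' w).trans (h.symm.star (SameFace.refl _)))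

theorem proj_smul (h : D n) (u : Vec n) (w : D n) : proj (h • u) (h * w) = h * proj u w := by
  refine proj_eq ?_
  rw [mul_smul, mul_smul]
  exact ((proj_spec u w).smul h).trans (star_smul _ _ _)

/-- This is associativity of the Tits product in terms of chambers, and it is what makes products of
the formal sums computable. -/
theorem proj_proj (u v : Vec n) (w : D n) : proj u (proj v w) = proj (star u v) w := by
  refine (proj_eq ?_).symm
  exact (proj_spec u _).trans (((SameFace.refl u).star (proj_spec v w)).trans (star_assoc _ _ _))

theorem al_star_pos {u v : Vec n} {i : Fin n} :
    0 < al i (star u v) ↔ 0 < al i u ∨ al i u = 0 ∧ 0 < al i v := by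
  have := star_lt u v (lpt i) (rpt i)
  simp only [al_apply]; omega

theorem al_star_eq_zero {u v : Vec n} {i : Fin n} :
    al i (star u v) = 0 ↔ al i u = 0 ∧ al i v = 0 := by
  have := star_eq (u := u) (v := v) (x := lpt i) (y := rpt i)
  simp only [al_apply]; omega

/-- The orbit of the standard vector of type `J`: the faces of type `J`. -/
noncomputable def orb (J : Finset (Fin n)) : Finset (Vec n) :=
  (Set.finite_range fun g : D n => g • wt J).toFinset

theorem mem_orb {J : Finset (Fin n)} {u : Vec n} : u ∈ orb J ↔ ∃ g : D n, g • wt J = u := by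
  simp [orb]

theorem smul_mem_orb {J : Finset (Fin n)} {u : Vec n} (g : D n) : g • u ∈ orb J ↔ u ∈ orb J := by
  simp only [mem_orb]
  constructor
  · rintro ⟨h, hh⟩; exact ⟨g⁻¹ * h, by rw [mul_smul, hh, inv_smul_smul]⟩
  · rintro ⟨h, rfl⟩; exact ⟨g * h, by rw [mul_smul]⟩

theorem eq_wt_of_dominant {J : Finset (Fin n)} {u : Vec n} (hu : u ∈ orb J) (h : Dominant u) :
    u = wt J := by
  obtain ⟨g, rfl⟩ := mem_orb.1 hu
  exact (dominant_unique (dominant_wt J) h).1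

theorem dominant_of_star {u v : Vec n} (h : Dominant (star u v)) : Dominant u := by
  intro i
  have h1 := h i
  have h2 := al_star_pos (u := u) (v := v) (i := i)
  have h3 := al_star_eq_zero (u := u) (v := v) (i := i)
  omega

/-- After translation by `w⁻¹`, the simple roots outside `J` are positive on `wt J`; those in `J`
vanish there and are positive on `w⁻¹ • rho n` by hypothesis. So the Tits product is the fundamental
chamber. -/
theorem sameFace_of_positive {J : Finset (Fin n)} {w : D n}
    (h : ∀ j ∈ J, 0 < al j (w⁻¹ • rho n)) : SameFace (w • rho n) (star (w • wt J) (rho n)) := by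
  have : SameFace (rho n) (star (wt J) (w⁻¹ • rho n)) := by
    have hpos : ∀ i, 0 < al i (star (wt J) (w⁻¹ • rho n)) := by
      intro i
      rw [al_star_pos]
      by_cases hi : i ∈ J
      · exact Or.inr ⟨al_wt_of_mem hi, h i hi⟩
      · rw [al_wt_of_notMem hi]; exact Or.inl (al_om_self i)
    refine sameFace_of_dominant dominant_rho (fun i => (hpos i).le) fun i => ?_
    have := al_rho_ne (1 : D n) i
    rw [one_smul] at this
    exact iff_of_false this (hpos i).ne'
  have := (this.smul w).trans (star_smul _ _ _)
  rwa [smul_inv_smul] at this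

theorem length_mul_s_lt {w : D n} {i : Fin n} (h : al i (w⁻¹ • rho n) < 0) :
    length (w * s n i) < length w := by
  have h1 := two_mul_length w
  have h2 := two_mul_length (w * s n i)
  have h3 := card_invSet_mul_s_of_neg h
  omega

theorem positive_of_mem_minReps {J : Finset (Fin n)} {w : D n} (h : w ∈ minReps J) {j : Fin n}
    (hj : j ∈ J) : 0 < al j (w⁻¹ • rho n) := by
  have h1 := h (s n j) (Subgroup.subset_closure ⟨j, hj, rfl⟩)
  rcases lt_or_gt_of_ne (al_rho_ne w⁻¹ j) with h2 | h2
  · have := length_mul_s_lt h2; omega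
  · exact h2

/-- If `w` has no descent in `J`, then `w` and a shortest element of its coset are both the
projection of the fundamental chamber onto the same face `w • wt J`, so they coincide. -/
theorem mem_minReps {J : Finset (Fin n)} {w : D n} :
    w ∈ minReps J ↔ ∀ j ∈ J, 0 < al j (w⁻¹ • rho n) := by
  refine ⟨fun h j hj => positive_of_mem_minReps h hj, fun h => ?_⟩
  obtain ⟨v, hv, hmin⟩ := Set.exists_min_image (parabolic J : Set (D n)) (fun v => length (w * v))
    (Set.toFinite _) ⟨1, one_mem _⟩
  have hw : w * v ∈ minReps J := by
    intro v' hv'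
    rw [mul_assoc]
    exact hmin _ (mul_mem hv hv')
  have h1 := sameFace_of_positive h
  have h2 := sameFace_of_positive fun j hj => positive_of_mem_minReps hw hj
  rw [mul_smul w v (wt J), smul_wt_eq_self_iff.2 hv] at h2
  have := eq_of_sameFace_rho (h1.trans h2.symm)
  rwa [← this] at hw

theorem proj_one_smul_wt {J : Finset (Fin n)} {u : Vec n} (hu : u ∈ orb J) :
    proj u 1 • wt J = u ∧ proj u 1 ∈ minReps J := by
  have h := proj_spec u 1
  rw [one_smul] at h
  set g := proj u 1
  have h1 := (h.smul g⁻¹).trans (star_smul _ _ _)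
  rw [inv_smul_smul] at h1
  have h2 : g⁻¹ • u = wt J :=
    eq_wt_of_dominant ((smul_mem_orb _).2 hu) (dominant_of_star (h1.dominant dominant_rho))
  refine ⟨by rw [← h2, smul_inv_smul], mem_minReps.2 fun j hj => ?_⟩
  have h3 : 0 < al j (rho n) := lt_of_le_of_ne (dominant_rho j) (by
    have := al_rho_ne (1 : D n) j; rw [one_smul] at this; exact this.symm)
  rw [h1.al_pos, al_star_pos, h2, al_wt_of_mem hj] at h3
  simpa using h3

/-- The shortest coset representatives are exactly the projections of the fundamental chamber onto
the faces of type `J`. -/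
theorem sumX_eq (R : Type*) [CommRing R] (J : Finset (Fin n)) :
    sumX R n J = ∑ u ∈ orb J, MonoidAlgebra.of R (D n) (proj u 1) := by
  have hproj : ∀ w ∈ minReps J, proj (w • wt J) 1 = w := fun w hw => by
    refine proj_eq ?_
    rw [one_smul]; exact sameFace_of_positive (mem_minReps.1 hw)
  rw [sumX]
  refine Finset.sum_bij' (fun w _ => w • wt J) (fun u _ => proj u 1) ?_ ?_ ?_ ?_ ?_
  · intro w _; exact mem_orb.2 ⟨w, rfl⟩
  · intro u hu; simpa using (proj_one_smul_wt hu).2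
  · intro w hw; exact hproj w (by simpa using hw)
  · intro u hu; exact (proj_one_smul_wt hu).1
  · intro w hw; rw [hproj w (by simpa using hw)]

/-! ### Solomon's theorem -/

open Classical in
/-- The structure constants of the descent algebra. -/
noncomputable def structConst (K J L : Finset (Fin n)) : ℕ :=
  ((orb K ×ˢ orb J).filter fun q => SameFace (star q.2 q.1) (wt L)).card

open Classical in
theorem structConst_eq_of_mem_orb {K J L : Finset (Fin n)} {y : Vec n} (hy : y ∈ orb L) :
    ((orb K ×ˢ orb J).filter fun q => SameFace (star q.2 q.1) y).card = structConst K J L := by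
  obtain ⟨g, rfl⟩ := mem_orb.1 hy
  refine Finset.card_bij' (fun q _ => (g⁻¹ • q.1, g⁻¹ • q.2)) (fun q _ => (g • q.1, g • q.2))
    ?_ ?_ ?_ ?_
  · rintro ⟨u, u'⟩ h
    simp only [Finset.mem_filter, Finset.mem_product, smul_mem_orb] at h ⊢
    refine ⟨h.1, (star_smul g⁻¹ u' u).symm.trans ?_⟩
    have := h.2.smul g⁻¹
    rwa [inv_smul_smul] at this
  · rintro ⟨u, u'⟩ h
    simp only [Finset.mem_filter, Finset.mem_product, smul_mem_orb] at h ⊢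
    exact ⟨h.1, (star_smul g u' u).symm.trans (h.2.smul g)⟩
  · intro q _; simp
  · intro q _; simp

-- Exactly one representative `y`, over all types `L`, lies in the face of `z`. This distributes a
-- sum over arbitrary faces according to their types.
open Classical in
theorem sum_faces {M : Type*} [AddCommMonoid M] (f : D n → M) (z : Vec n) :
    f (proj z 1) = ∑ L : Finset (Fin n), ∑ y ∈ orb L, if SameFace z y then f (proj y 1) else 0 := by
  obtain ⟨L, g, hg⟩ := exists_sameFace z
  rw [Finset.sum_eq_single L, Finset.sum_eq_single (g • wt L), if_pos hg, proj_congr hg]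
  · intro y hy hne
    obtain ⟨h, rfl⟩ := mem_orb.1 hy
    exact if_neg fun hz => hne (sameFace_wt_unique (hz.symm.trans hg)).2
  · intro h; exact absurd (mem_orb.2 ⟨g, rfl⟩) h
  · intro L' _ hne
    refine Finset.sum_eq_zero fun y hy => ?_
    obtain ⟨h, rfl⟩ := mem_orb.1 hy
    exact if_neg fun hz => hne (sameFace_wt_unique (hz.symm.trans hg)).1
  · simp

/-- Solomon's theorem: the product of two of the formal sums. -/
theorem sumX_mul (R : Type*) [CommRing R] (K J : Finset (Fin n)) :
    sumX R n K * sumX R n J = ∑ L, (structConst K J L : R) • sumX R n L := by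
  classical
  have h1 : sumX R n K * sumX R n J =
      ∑ q ∈ orb K ×ˢ orb J, MonoidAlgebra.of R (D n) (proj (star q.2 q.1) 1) := by
    rw [sumX_eq, sumX_eq, Finset.sum_mul, Finset.sum_product]
    refine Finset.sum_congr rfl fun u _ => ?_
    rw [Finset.mul_sum]
    -- For fixed `u`, translation by `proj u 1` permutes the faces of type `J`. By equivariance it
    -- turns the product of two group elements into an iterated projection, that is, into a
    -- projection onto `star u' u`.
    refine Finset.sum_bij' (fun u' _ => proj u 1 • u') (fun u' _ => (proj u 1)⁻¹ • u')
      (fun u' h => (smul_mem_orb _).2 h) (fun u' h => (smul_mem_orb _).2 h)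
      (fun _ _ => inv_smul_smul _ _) (fun _ _ => smul_inv_smul _ _) fun u' _ => ?_
    rw [← map_mul, ← proj_smul, mul_one, proj_proj]
  rw [h1]
  have h2 : ∀ q : Vec n × Vec n, MonoidAlgebra.of R (D n) (proj (star q.2 q.1) 1) =
      ∑ L : Finset (Fin n), ∑ y ∈ orb L,
        if SameFace (star q.2 q.1) y then MonoidAlgebra.of R (D n) (proj y 1) else 0 :=
    fun q => sum_faces (fun g => MonoidAlgebra.of R (D n) g) _
  rw [Finset.sum_congr rfl fun q _ => h2 q, Finset.sum_comm]
  refine Finset.sum_congr rfl fun L _ => ?_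
  rw [Finset.sum_comm, sumX_eq, Finset.smul_sum]
  refine Finset.sum_congr rfl fun y hy => ?_
  rw [← Finset.sum_filter, Finset.sum_const, structConst_eq_of_mem_orb hy, Nat.cast_smul_eq_nsmul]

/-- The first factor of a Tits product is a face of the product. So it is dominant if the product
is, and every simple root that vanishes on the product vanishes on it. -/
theorem subset_of_sameFace_star {J L : Finset (Fin n)} {u u' : Vec n} (hu' : u' ∈ orb J)
    (h : SameFace (star u' u) (wt L)) : u' = wt J ∧ L ⊆ J := by
  have h1 : u' = wt J :=
    eq_wt_of_dominant hu' (dominant_of_star (h.symm.dominant (dominant_wt L)))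
  refine ⟨h1, fun i hi => ?_⟩
  have := (h.al_eq i).2 (al_wt_of_mem hi)
  rw [al_star_eq_zero, h1, al_wt_eq_zero] at this
  exact this.1

theorem structConst_eq_zero {K J L : Finset (Fin n)} (h : ¬ L ⊆ J) : structConst K J L = 0 := by
  classical
  rw [structConst, Finset.card_eq_zero, Finset.filter_eq_empty_iff]
  rintro ⟨u, u'⟩ hq hs
  exact h (subset_of_sameFace_star (Finset.mem_product.1 hq).2 hs).2

/-- Every reflecting hyperplane that contains `v` contains `u`. -/
def Zle (v u : Vec n) : Prop := ∀ x y, Rt n x y → v.1 x = v.1 y → u.1 x = u.1 y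

theorem Zle.refl (v : Vec n) : Zle v v := fun _ _ _ h => h
theorem Zle.trans {u v w : Vec n} (h : Zle u v) (h' : Zle v w) : Zle u w :=
  fun x y hr e => h' x y hr (h x y hr e)

theorem Zle.smul {v u : Vec n} (h : Zle v u) (g : D n) : Zle (g • v) (g • u) :=
  fun _ _ hr => h _ _ (hr.act g⁻¹)

theorem SameFace.zle {v u : Vec n} (h : SameFace v u) : Zle v u :=
  fun _ _ hr => (h.eq_iff hr).1

/-- A small perturbation of `v` in the direction of `u` stays in the face of `v` exactly when `u`
lies in the flat of `v`. -/
theorem sameFace_star_self_iff {v u : Vec n} : SameFace (star v u) v ↔ Zle v u := by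
  constructor
  · intro h x y hr e
    have := (h.eq_iff hr).2 e
    rw [star_eq] at this
    exact this.2
  · intro h x y hr
    rw [star_lt]
    have := h x y hr
    omega

open Classical in
/-- The number of faces of type `J` in the span of the face of `v`. -/
noncomputable def cnt (J : Finset (Fin n)) (v : Vec n) : ℕ := ((orb J).filter fun u => Zle v u).card

theorem structConst_self (K J : Finset (Fin n)) : structConst K J J = cnt K (wt J) := by
  classical
  rw [structConst, cnt]
  refine Finset.card_bij' (fun q _ => q.1) (fun u _ => (u, wt J)) ?_ ?_ ?_ ?_
  · rintro ⟨u, u'⟩ h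
    simp only [Finset.mem_filter, Finset.mem_product] at h ⊢
    obtain ⟨rfl, -⟩ := subset_of_sameFace_star h.1.2 h.2
    exact ⟨h.1.1, sameFace_star_self_iff.1 h.2⟩
  · intro u h
    simp only [Finset.mem_filter, Finset.mem_product] at h ⊢
    exact ⟨⟨h.1, mem_orb.2 ⟨1, one_smul _ _⟩⟩, sameFace_star_self_iff.2 h.2⟩
  · rintro ⟨u, u'⟩ h
    simp only [Finset.mem_filter, Finset.mem_product] at h ⊢
    rw [(subset_of_sameFace_star h.1.2 h.2).1]
  · intro u _; rfl

/-- Every set of simple roots is the descent set of some element. -/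
theorem exists_descents (I : Finset (Fin n)) :
    ∃ w : D n, ∀ j, 0 < al j (w⁻¹ • rho n) ↔ j ∉ I := by
  -- The difference is negative on the simple roots in `I` and positive on the others. The Tits
  -- product with a chamber makes it regular without changing these signs.
  have hreg := regular_star (wt I - wt Iᶜ) (1 : D n)
  obtain ⟨g, hg⟩ := hreg.exists_chamber
  refine ⟨g⁻¹, fun j => ?_⟩
  rw [inv_inv, hg.al_pos, al_star_pos, map_sub]
  by_cases hj : j ∈ I
  · have h1 : j ∉ Iᶜ := by simpa using hj
    rw [al_wt_of_mem hj, al_wt_of_notMem h1]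
    have := al_om_self j
    simp only [hj, not_true_eq_false, iff_false]; omega
  · have h1 : j ∈ Iᶜ := by simpa using hj
    rw [al_wt_of_mem h1, al_wt_of_notMem hj]
    have := al_om_self j
    simp only [hj, not_false_eq_true, iff_true]; omega

open Classical in
theorem coeff_sumX (R : Type*) [CommRing R] (J : Finset (Fin n)) (w : D n) :
    (sumX R n J).coeff w = if w ∈ minReps J then 1 else 0 := by
  rw [sumX, MonoidAlgebra.coeff_sum, Finsupp.finsetSum_apply]
  simp [MonoidAlgebra.of_apply, Finsupp.single_apply]

/-- At an element with descent set `Jᶜ`, the coefficient of a combination is the sum of the `g L`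
over `L ⊆ J`. The resulting system is unitriangular with respect to inclusion. -/
theorem linearIndependent_sumX (R : Type*) [CommRing R] : LinearIndependent R (sumX R n) := by
  classical
  rw [Fintype.linearIndependent_iff]
  intro g hg
  have hsum : ∀ J : Finset (Fin n), ∑ L ∈ J.powerset, g L = 0 := by
    intro J
    obtain ⟨w, hw⟩ := exists_descents Jᶜ
    have h := congrArg (fun a : MonoidAlgebra R (D n) => a.coeff w) hg
    simp only [MonoidAlgebra.coeff_sum, Finsupp.finsetSum_apply, MonoidAlgebra.coeff_smul,
      Finsupp.smul_apply, coeff_sumX, MonoidAlgebra.coeff_zero, Finsupp.zero_apply, smul_eq_mul,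
      mul_ite, mul_one, mul_zero] at h
    rw [← Finset.sum_filter] at h
    convert h using 2
    ext L
    simp only [Finset.mem_powerset, Finset.mem_filter, Finset.mem_univ, true_and, mem_minReps, hw]
    simp [Finset.subset_iff]
  intro J
  induction J using Finset.strongInduction with
  | _ J ih =>
    have := hsum J
    rw [← Finset.sum_erase_add _ _ (Finset.mem_powerset_self J), Finset.sum_eq_zero, zero_add] at this
    · exact this
    · intro L hL
      rw [Finset.mem_erase, Finset.mem_powerset] at hL
      exact ih L (lt_of_le_of_ne hL.2 hL.1)

theorem sumX_univ (R : Type*) [CommRing R] : sumX R n Finset.univ = 1 := by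
  have h : minReps (Finset.univ : Finset (Fin n)) = {1} := by
    ext w
    rw [mem_minReps, Set.mem_singleton_iff]
    refine ⟨fun h => ?_, ?_⟩
    · exact inv_eq_one.1 (eq_one_of_dominant_rho fun i => (h i (Finset.mem_univ i)).le)
    · rintro rfl i -
      rw [inv_one]
      refine lt_of_le_of_ne ?_ (al_rho_ne _ i).symm
      rw [one_smul]; exact dominant_rho i
  rw [sumX]
  have h' : (Set.toFinite (minReps (Finset.univ : Finset (Fin n)))).toFinset = {1} := by
    ext w; rw [Set.Finite.mem_toFinset, h]; simp
  rw [h', Finset.sum_singleton, map_one]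

theorem toSubmodule_descentAlgebra (R : Type*) [CommRing R] :
    Subalgebra.toSubmodule (descentAlgebra R n) = Submodule.span R (Set.range (sumX R n)) := by
  set S := Submodule.span R (Set.range (sumX R n)) with hS
  have hmul : S * S ≤ S := by
    rw [hS, Submodule.span_mul_span, Submodule.span_le]
    rintro _ ⟨_, ⟨K, rfl⟩, _, ⟨J, rfl⟩, rfl⟩
    simp only [SetLike.mem_coe, sumX_mul]
    exact Submodule.sum_mem _ fun L _ => Submodule.smul_mem _ _ (Submodule.subset_span ⟨L, rfl⟩)
  refine le_antisymm (fun a ha => ?_) (Submodule.span_le.2 Algebra.subset_adjoin)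
  induction (show a ∈ Algebra.adjoin R (Set.range (sumX R n)) from ha) using
    Algebra.adjoin_induction with
  | mem x hx => exact Submodule.subset_span hx
  | algebraMap r =>
    rw [Algebra.algebraMap_eq_smul_one, ← sumX_univ]
    exact Submodule.smul_mem _ _ (Submodule.subset_span ⟨_, rfl⟩)
  | add x y hx hy h1 h2 => exact add_mem (h1 hx) (h2 hy)
  | mul x y hx hy h1 h2 => exact hmul (Submodule.mul_mem_mul (h1 hx) (h2 hy))

/-! ### The permutation characters -/

/-- The face `u` is encoded by the right coset of all `h` with `h⁻¹ • wt K = u`. Right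
multiplication by `w` then acts on faces as `w⁻¹`, which has the same fixed points as `w`. -/
theorem permChar_eq_card (K : Finset (Fin n)) (w : D n) [DecidablePred fun u : Vec n => w • u = u] :
    permChar K w = ((orb K).filter fun u => w • u = u).card := by
  let F : Vec n → Set (D n) := fun u => {h | h⁻¹ • wt K = u}
  have hF : ∀ g : D n, MulOpposite.op g • (parabolic K : Set (D n)) = F (g⁻¹ • wt K) := by
    intro g
    ext h
    rw [Set.mem_smul_set_iff_inv_smul_mem]
    simp only [F, Set.mem_ofPred_eq, SetLike.mem_coe, ← smul_wt_eq_self_iff]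
    rw [← MulOpposite.op_inv, op_smul_eq_mul, mul_smul, ← eq_inv_smul_iff, eq_comm]
  have hact : ∀ u, MulOpposite.op w • F u = F (w⁻¹ • u) := by
    intro u
    ext h
    rw [Set.mem_smul_set_iff_inv_smul_mem]
    simp only [F, Set.mem_ofPred_eq]
    rw [← MulOpposite.op_inv, op_smul_eq_mul, mul_inv_rev, inv_inv, mul_smul,
      eq_inv_smul_iff]
  have hinj : Set.InjOn F (orb K : Set (Vec n)) := by
    intro u hu v _ huv
    obtain ⟨g, rfl⟩ := mem_orb.1 hu
    have : g⁻¹ ∈ F (g • wt K) := by simp [F]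
    rw [huv] at this
    simpa [F] using this
  have : {C : Set (D n) | (∃ g : D n, C = MulOpposite.op g • (parabolic K : Set (D n))) ∧
      MulOpposite.op w • C = C} = F '' ((orb K).filter fun u => w • u = u : Finset (Vec n)) := by
    ext C
    simp only [Set.mem_ofPred_eq, Set.mem_image, SetLike.mem_coe, Finset.mem_filter]
    constructor
    · rintro ⟨⟨g, rfl⟩, hC⟩
      rw [hF, hact] at hC
      refine ⟨g⁻¹ • wt K, ⟨mem_orb.2 ⟨_, rfl⟩, ?_⟩, (hF g).symm⟩
      have := hinj ((smul_mem_orb _).2 (mem_orb.2 ⟨_, rfl⟩)) (mem_orb.2 ⟨_, rfl⟩) hC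
      rw [inv_smul_eq_iff] at this
      exact this.symm
    · rintro ⟨u, ⟨hu, hw⟩, rfl⟩
      obtain ⟨g, rfl⟩ := mem_orb.1 hu
      refine ⟨⟨g⁻¹, by rw [hF, inv_inv]⟩, ?_⟩
      rw [hact]; congr 1
      rw [inv_smul_eq_iff]; exact hw.symm
  rw [permChar, this, (hinj.mono fun u hu => ?_ : Set.InjOn F _).ncard_image, Set.ncard_coe_finset]
  exact (Finset.mem_filter.1 hu).1

/-- The coordinates of a vector after a simple reflection. -/
theorem s_smul_apply_eq (j : Fin n) (v : Vec n) (x : ℤ) :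
    (s n j • v).1 x = v.1 x - al j v * ((if x = rpt j then 1 else 0) - (if x = lpt j then 1 else 0)
      - (if x = -rpt j then 1 else 0) + (if x = -lpt j then 1 else 0)) := by
  have hlr := lpt_lt_rpt j
  have hne := lpt_add_rpt j
  have hl := (mem_points.1 (lpt_mem j)).1
  have hr := (mem_points.1 (rpt_mem j)).1
  rw [s_smul_apply, al_apply]
  by_cases h1 : x = lpt j
  · rw [h1, genFun_lpt, if_neg (by omega), if_pos rfl, if_neg (by omega), if_neg (by omega)]; ring
  by_cases h2 : x = rpt j
  · rw [h2, genFun_rpt, if_pos rfl, if_neg (by omega), if_neg (by omega), if_neg (by omega)]; ring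
  by_cases h3 : x = -lpt j
  · rw [h3, genFun_neg, genFun_lpt, vec_neg, vec_neg, if_neg (by omega), if_neg (by omega),
      if_neg (by omega), if_pos rfl]; ring
  by_cases h4 : x = -rpt j
  · rw [h4, genFun_neg, genFun_rpt, vec_neg, vec_neg, if_neg (by omega), if_neg (by omega),
      if_pos rfl, if_neg (by omega)]; ring
  rw [if_neg h2, if_neg h1, if_neg h4, if_neg h3]
  have : genFun j x = x := by
    simp only [genFun, lpt, rpt] at *
    split_ifs at * <;> omega
  rw [this]; ring

/-- The standard pairing of vectors. -/
noncomputable def dot (u v : Vec n) : ℤ := ∑ x ∈ points n, u.1 x * v.1 x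

theorem dot_s_smul (u v : Vec n) (j : Fin n) : dot u (s n j • v) = dot u v - al j v * (2 * al j u) := by
  have hl := lpt_mem j
  have hr := rpt_mem j
  have hl' := neg_mem_points.2 hl
  have hr' := neg_mem_points.2 hr
  simp only [dot, s_smul_apply_eq]
  have : ∀ x, u.1 x * (v.1 x - al j v * ((if x = rpt j then 1 else 0) -
      (if x = lpt j then 1 else 0) - (if x = -rpt j then 1 else 0) + (if x = -lpt j then 1 else 0)))
      = u.1 x * v.1 x - al j v * ((if x = rpt j then u.1 x else 0) -
      (if x = lpt j then u.1 x else 0) - (if x = -rpt j then u.1 x else 0) +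
      (if x = -lpt j then u.1 x else 0)) := by
    intro x; split_ifs <;> ring
  simp only [this]
  rw [Finset.sum_sub_distrib, ← Finset.mul_sum, Finset.sum_add_distrib, Finset.sum_sub_distrib,
    Finset.sum_sub_distrib, Finset.sum_ite_eq', Finset.sum_ite_eq', Finset.sum_ite_eq',
    Finset.sum_ite_eq', if_pos hl, if_pos hr, if_pos hl', if_pos hr', vec_neg, vec_neg, al_apply]
  rw [al_apply]; ring

/-- Pair with the fundamental weight `om i` of the first letter. The other letters are different
from `i` and do not change this pairing, so the first reflection must act trivially on the vector it
receives; then it can be dropped. -/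
theorem al_eq_zero_of_prod_smul {l : List (Fin n)} (hl : l.Nodup) {u : Vec n}
    (h : (l.map (s n)).prod • u = u) : ∀ j ∈ l, al j u = 0 := by
  induction l with
  | nil => simp
  | cons i l ih =>
    rw [List.nodup_cons] at hl
    rw [List.map_cons, List.prod_cons, mul_smul] at h
    set y := (l.map (s n)).prod • u with hy
    have hdot : dot (om i) y = dot (om i) u := by
      have : ∀ m : List (Fin n), i ∉ m → dot (om i) ((m.map (s n)).prod • u) = dot (om i) u := by
        intro m hm
        induction m with
        | nil => simp
        | cons j m ihm =>
          rw [List.mem_cons, not_or] at hm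
          rw [List.map_cons, List.prod_cons, mul_smul, dot_s_smul, ihm hm.2, al_om_of_ne hm.1]; ring
      exact this l hl.1
    have h0 : al i y = 0 := by
      have h1 := dot_s_smul (om i) y i
      rw [h, hdot] at h1
      have h2 : al i y * (2 * al i (om i)) = 0 := by omega
      have := al_om_self i
      rcases mul_eq_zero.1 h2 with h3 | h3
      · exact h3
      · omega
    rw [s_smul_eq_self h0] at h
    rw [h] at h0
    intro j hj
    rcases List.mem_cons.1 hj with rfl | hj
    · exact h0
    · exact ih hl.2 h j hj

/-- A positive root that vanishes on the dominant vector `wt J` involves only simple roots in `J`.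
-/
theorem zle_wt_iff {J : Finset (Fin n)} {u : Vec n} : Zle (wt J) u ↔ ∀ j ∈ J, al j u = 0 := by
  constructor
  · intro h j hj
    have h1 := al_wt_of_mem hj
    rw [al_apply] at h1 ⊢
    have := h _ _ (Rt_simple j) (by omega)
    omega
  · intro h
    have key : ∀ x y, Rt n x y → x ≤ y → (wt J).1 x = (wt J).1 y → u.1 x = u.1 y := by
      intro x y hr hxy e
      obtain ⟨c, hc⟩ := exists_decomp hr hxy
      have h1 := hc (wt J)
      have h2 := hc u
      rw [e, sub_self, eq_comm, Finset.sum_eq_zero_iff_of_nonneg fun i _ =>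
        mul_nonneg (by positivity) (dominant_wt J i)] at h1
      rw [Finset.sum_eq_zero] at h2
      · omega
      · intro i hi
        by_cases hJ : i ∈ J
        · rw [h i hJ, mul_zero]
        · rcases mul_eq_zero.1 (h1 i hi) with h3 | h3
          · rw [h3, zero_mul]
          · exact absurd (al_wt_eq_zero.1 h3) hJ
    intro x y hr e
    rcases le_total x y with hxy | hxy
    · exact key x y hr hxy e
    · exact (key y x hr.symm hxy e.symm).symm

theorem IsCoxeterElement.smul_eq_iff {J : Finset (Fin n)} {c : D n} (hc : IsCoxeterElement J c)
    {u : Vec n} : c • u = u ↔ Zle (wt J) u := by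
  obtain ⟨l, hl, rfl, rfl⟩ := hc
  rw [zle_wt_iff]
  constructor
  · intro h j hj
    exact al_eq_zero_of_prod_smul hl h j (List.mem_toFinset.1 hj)
  · intro h
    have : ∀ m : List (Fin n), (∀ j ∈ m, al j u = 0) → (m.map (s n)).prod • u = u := by
      intro m hm
      induction m with
      | nil => simp
      | cons i m ih =>
        rw [List.map_cons, List.prod_cons, mul_smul, ih fun j hj => hm j (List.mem_cons_of_mem _ hj),
          s_smul_eq_self (hm i List.mem_cons_self)]
    exact this l fun j hj => h j (List.mem_toFinset.2 hj)

theorem permChar_coxeter {J : Finset (Fin n)} {c : D n} (hc : IsCoxeterElement J c)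
    (K : Finset (Fin n)) : permChar K c = cnt K (wt J) := by
  classical
  rw [permChar_eq_card, cnt]
  congr 1
  ext u
  simp only [Finset.mem_filter, hc.smul_eq_iff]

end Descent

/-! ### Simple modules of algebras with triangular structure constants -/

section Triangular

variable {R F A ι : Type*} [CommRing R] [Field F] [Ring A] [Algebra R A]

theorem charModule_smul (χ : A →+* F) (b : A) (y : CharModule χ) :
    b • y = (show CharModule χ from (χ b * (show F from y) : F)) := rfl

theorem isSimpleModule_charModule {χ : A →+* F} (hχ : Function.Surjective χ) :
    IsSimpleModule A (CharModule χ) := by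
  rw [isSimpleModule_iff_toSpanSingleton_surjective]
  refine ⟨inferInstanceAs (Nontrivial F), fun m hm y => ?_⟩
  have hm' : (show F from m) ≠ 0 := hm
  obtain ⟨b, hb⟩ := hχ ((show F from y) / (show F from m))
  refine ⟨b, ?_⟩
  rw [LinearMap.toSpanSingleton_apply, charModule_smul, hb]
  exact div_mul_cancel₀ _ hm'

/-- Each `b` acts on the first module like some scalar `r` of `R`, and an isomorphism carries this
equation over to the second module, where `r` acts by the same `f r`. -/
theorem eq_of_charModule_equiv {f : R →+* F} (hf : Function.Surjective f) {χ ψ : A →+* F}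
    (hχ : ∀ r, χ (algebraMap R A r) = f r) (hψ : ∀ r, ψ (algebraMap R A r) = f r)
    (e : CharModule χ ≃ₗ[A] CharModule ψ) : χ = ψ := by
  ext b
  obtain ⟨r, hr⟩ := hf (χ b)
  let o : CharModule χ := (1 : F)
  have ho : o ≠ 0 := one_ne_zero (α := F)
  have h1 : b • o = algebraMap R A r • o := by
    rw [charModule_smul, charModule_smul, hχ, hr]
  have h2 := congrArg e h1
  rw [map_smul, map_smul, charModule_smul, charModule_smul, hψ, hr] at h2
  have h3 : (show F from e o) ≠ 0 := fun h => ho (e.map_eq_zero_iff.1 h)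
  exact (mul_right_cancel₀ h3 h2).symm

variable [Fintype ι] {x : Finset ι → A} {a : Finset ι → Finset ι → Finset ι → ℕ}

/-- Every simple module of an algebra with triangular structure constants is given by one of the
diagonal characters. -/
theorem exists_equiv_charModule {f : R →+* F} (hf : Function.Surjective f)
    (hker : ∀ r, f r = 0 → algebraMap R A r = 0)
    (hspan : ∀ b : A, ∃ c : Finset ι → R, b = ∑ J, c J • x J)
    (hmul : ∀ K J, x K * x J = ∑ L, a K J L • x L) (ha : ∀ K J L, ¬ L ⊆ J → a K J L = 0)
    {χ : Finset ι → A →+* F} (hχ : ∀ J K, χ J (x K) = a K J J)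
    (hχ' : ∀ J r, χ J (algebraMap R A r) = f r)
    (M : Type*) [AddCommGroup M] [Module A M] [IsSimpleModule A M] :
    ∃ J, Nonempty (M ≃ₗ[A] CharModule (χ J)) := by
  classical
  have := IsSimpleModule.nontrivial A M
  obtain ⟨m, hm⟩ := exists_ne (0 : M)
  have hex : ∃ J, x J • m ≠ 0 := by
    by_contra! h
    obtain ⟨c, hc⟩ := hspan 1
    apply hm
    rw [← one_smul A m, hc, Finset.sum_smul]
    refine Finset.sum_eq_zero fun J _ => ?_
    rw [Algebra.smul_def, mul_smul, h J, smul_zero]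
  -- With `J` minimal, all lower terms of `x K * x J` kill `m`, so `x J • m` is a common eigenvector
  -- of all the `x K`, with the diagonal constants as eigenvalues.
  obtain ⟨J, hJ, hmin⟩ := WellFounded.has_min (r := fun J L : Finset ι => J ⊂ L) wellFounded_lt
    {J | x J • m ≠ 0} hex
  have hlow : ∀ L, L ⊂ J → x L • m = 0 := fun L hL => by
    by_contra h; exact hmin L h hL
  set m' := x J • m with hm'
  have hact : ∀ K, x K • m' = (a K J J : A) • m' := by
    intro K
    rw [hm', ← mul_smul, hmul, Finset.sum_smul, Finset.sum_eq_single J]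
    · rw [nsmul_eq_mul, mul_smul]
    · intro L _ hne
      by_cases hL : L ⊆ J
      · rw [nsmul_eq_mul, mul_smul, hlow L (lt_of_le_of_ne hL hne), smul_zero]
      · rw [ha K J L hL, zero_smul, zero_smul]
    · simp
  have hscal : ∀ b : A, ∃ r : R, b • m' = algebraMap R A r • m' ∧ χ J b = f r := by
    intro b
    obtain ⟨c, rfl⟩ := hspan b
    refine ⟨∑ K, c K * (a K J J : R), ?_, ?_⟩
    · rw [Finset.sum_smul, map_sum, Finset.sum_smul]
      refine Finset.sum_congr rfl fun K _ => ?_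
      rw [Algebra.smul_def, mul_smul, hact, ← mul_smul, map_mul, map_natCast]
    · rw [map_sum, map_sum]
      refine Finset.sum_congr rfl fun K _ => ?_
      rw [Algebra.smul_def, map_mul, hχ', hχ, map_mul, map_natCast]
  have hsurj : ∀ J, Function.Surjective (χ J) := fun J y => by
    obtain ⟨r, rfl⟩ := hf y; exact ⟨_, hχ' J r⟩
  have := isSimpleModule_charModule (hsurj J)
  let o : CharModule (χ J) := (1 : F)
  let ψ := LinearMap.toSpanSingleton A (CharModule (χ J)) o
  have hψ : Function.Surjective ψ := fun y => by
    obtain ⟨b, hb⟩ := hsurj J (show F from y)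
    refine ⟨b, ?_⟩
    change χ J b * 1 = (show F from y)
    rw [mul_one, hb]
  -- An element killed by the character acts on `m'` as a scalar `r` with `f r = 0`, hence as zero.
  -- So the orbit map of `m'` factors through the one-dimensional module.
  have hle : LinearMap.ker ψ ≤ LinearMap.ker (LinearMap.toSpanSingleton A M m') := by
    intro b hb
    rw [LinearMap.mem_ker, LinearMap.toSpanSingleton_apply] at hb ⊢
    obtain ⟨r, h1, h2⟩ := hscal b
    have h3 : χ J b * 1 = 0 := hb
    rw [mul_one, h2] at h3
    rw [h1, hker r h3, zero_smul]
  let g : CharModule (χ J) →ₗ[A] M := ((LinearMap.ker ψ).liftQ _ hle).comp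
    (ψ.quotKerEquivOfSurjective hψ).symm.toLinearMap
  have hg : g ≠ 0 := by
    intro h0
    have : g (ψ 1) = m' := by
      have e : (ψ.quotKerEquivOfSurjective hψ).symm (ψ 1) = Submodule.Quotient.mk 1 := by
        rw [LinearEquiv.symm_apply_eq]; rfl
      simp only [g, LinearMap.comp_apply, LinearEquiv.coe_coe, e]
      rw [Submodule.liftQ_apply, LinearMap.toSpanSingleton_apply, one_smul]
    rw [h0] at this
    exact hJ this.symm
  exact ⟨J, ⟨(LinearEquiv.ofBijective g (LinearMap.bijective_of_ne_zero hg)).symm⟩⟩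

/-- A set of indices that represents every diagonal character once indexes the irreducible
representations. -/
theorem areTheIrreps_of_triangular {f : R →+* F} (hf : Function.Surjective f)
    (hker : ∀ r, f r = 0 → algebraMap R A r = 0)
    (hspan : ∀ b : A, ∃ c : Finset ι → R, b = ∑ J, c J • x J)
    (hmul : ∀ K J, x K * x J = ∑ L, a K J L • x L) (ha : ∀ K J L, ¬ L ⊆ J → a K J L = 0)
    {χ : Finset ι → A →+* F} (hχ : ∀ J K, χ J (x K) = a K J J)
    (hχ' : ∀ J r, χ J (algebraMap R A r) = f r) {I : Set (Finset ι)}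
    (hcover : ∀ J, ∃ J' ∈ I, ∀ K, (a K J J : F) = a K J' J')
    (hinj : ∀ J ∈ I, ∀ J' ∈ I, (∀ K, (a K J J : F) = a K J' J') → J = J') :
    AreTheIrreps.{v} (fun J : I => χ J) where
  simple J := isSimpleModule_charModule fun y => by
    obtain ⟨r, rfl⟩ := hf y; exact ⟨_, hχ' J r⟩
  irredundant := by
    rintro ⟨J, hJ⟩ ⟨J', hJ'⟩ ⟨e⟩
    have h := eq_of_charModule_equiv hf (hχ' J) (hχ' J') e
    refine Subtype.ext (hinj J hJ J' hJ' fun K => ?_)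
    rw [← hχ, ← hχ, h]
  complete M _ _ _ := by
    obtain ⟨J, ⟨e⟩⟩ := exists_equiv_charModule hf hker hspan hmul ha hχ hχ' M
    obtain ⟨J', hJ', h⟩ := hcover J
    have : χ J = χ J' := by
      ext b
      obtain ⟨c, rfl⟩ := hspan b
      simp only [map_sum, Algebra.smul_def, map_mul, hχ', hχ, h]
    refine ⟨⟨J', hJ'⟩, ?_⟩
    rw [this] at e
    exact ⟨e⟩

end Triangular

/-! ### The diagonal characters of the descent algebra and of its reduction modulo `p`. -/

section Characters

variable {n : ℕ} [Fact (2 ≤ n)]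

theorem basisX_mul (R : Type*) [CommRing R] (K J : Finset (Fin n)) :
    basisX R n K * basisX R n J = ∑ L, structConst K J L • basisX R n L := by
  apply Subtype.ext
  rw [AddSubmonoidClass.coe_finsetSum]
  simp only [MulMemClass.coe_mul, basisX, sumX_mul, Nat.cast_smul_eq_nsmul]
  rfl

/-- The basis of the descent algebra given by the formal sums. -/
noncomputable def descentBasis (R : Type*) [CommRing R] (n : ℕ) [Fact (2 ≤ n)] :
    Module.Basis (Finset (Fin n)) R (descentAlgebra R n) :=
  Module.Basis.mk (v := basisX R n)
    (LinearIndependent.of_comp (descentAlgebra R n).val.toLinearMap (linearIndependent_sumX R))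
    (by
      rintro ⟨y, hy⟩ -
      have hy' : y ∈ Submodule.span R (Set.range (sumX R n)) := by
        rwa [← toSubmodule_descentAlgebra]
      have : Submodule.map (descentAlgebra R n).val.toLinearMap
          (Submodule.span R (Set.range (basisX R n))) =
          Submodule.span R (Set.range (sumX R n)) := by
        rw [Submodule.map_span, ← Set.range_comp]; rfl
      rw [← this] at hy'
      obtain ⟨z, hz, hzy⟩ := hy'
      have : z = ⟨y, hy⟩ := Subtype.ext hzy
      rwa [← this])

theorem descentBasis_apply (R : Type*) [CommRing R] (J : Finset (Fin n)) :
    descentBasis R n J = basisX R n J := by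
  rw [descentBasis, Module.Basis.mk_apply]

theorem basisX_eq_sum (R : Type*) [CommRing R] (b : descentAlgebra R n) :
    b = ∑ J, (descentBasis R n).repr b J • basisX R n J := by
  conv_lhs => rw [← (descentBasis R n).sum_repr b]
  simp only [descentBasis_apply]

theorem repr_basisX_mul (R : Type*) [CommRing R] (K J L : Finset (Fin n)) :
    (descentBasis R n).repr (basisX R n K * basisX R n J) L = (structConst K J L : R) := by
  classical
  rw [basisX_mul]
  simp only [← descentBasis_apply, map_sum, map_nsmul, Module.Basis.repr_self,
    Finsupp.finsetSum_apply, Finsupp.smul_apply, Finsupp.single_apply]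
  simp

theorem repr_mul_basisX (R : Type*) [CommRing R] (b : descentAlgebra R n) (J L : Finset (Fin n)) :
    (descentBasis R n).repr (b * basisX R n J) L =
      ∑ K, (descentBasis R n).repr b K * (structConst K J L : R) := by
  conv_lhs => rw [basisX_eq_sum R b, Finset.sum_mul, map_sum, Finsupp.finsetSum_apply]
  refine Finset.sum_congr rfl fun K _ => ?_
  rw [smul_mul_assoc, map_smul, Finsupp.smul_apply, repr_basisX_mul, smul_eq_mul]

/-- The diagonal character of the descent algebra that belongs to `J`. -/
noncomputable def diagChar (R : Type*) [CommRing R] (J : Finset (Fin n)) :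
    descentAlgebra R n →ₐ[R] R :=
  AlgHom.ofLinearMap
    ((Finsupp.lapply J).comp ((descentBasis R n).repr.toLinearMap.comp
      (LinearMap.mulRight R (basisX R n J))))
    (by
      simp only [LinearMap.comp_apply, LinearMap.mulRight_apply, one_mul]
      rw [← descentBasis_apply]; simp)
    (by
      classical
      intro y z
      simp only [LinearMap.comp_apply, LinearMap.mulRight_apply, LinearEquiv.coe_coe,
        Finsupp.lapply_apply, mul_assoc]
      conv_lhs => rw [basisX_eq_sum R (z * basisX R n J), Finset.mul_sum, map_sum,
        Finsupp.finsetSum_apply]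
      -- A term with `L` needs `L ⊆ J` to occur in `z * basisX R n J` and `J ⊆ L` for `y * basisX R
      -- n L` to contribute at `J`; only `L = J` survives.
      rw [Finset.sum_eq_single J]
      · rw [mul_smul_comm, map_smul, Finsupp.smul_apply, smul_eq_mul, mul_comm]
      · intro L _ hne
        rw [mul_smul_comm, map_smul, Finsupp.smul_apply, smul_eq_mul]
        by_cases hL : L ⊆ J
        · rw [repr_mul_basisX R y, Finset.sum_eq_zero, mul_zero]
          intro K _
          rw [structConst_eq_zero fun h => hne (Finset.Subset.antisymm hL h), Nat.cast_zero,
            mul_zero]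
        · rw [repr_mul_basisX R z, Finset.sum_eq_zero, zero_mul]
          intro K _
          rw [structConst_eq_zero hL, Nat.cast_zero, mul_zero]
      · simp)

theorem diagChar_basisX (R : Type*) [CommRing R] (J K : Finset (Fin n)) :
    diagChar R J (basisX R n K) = structConst K J J :=
  repr_basisX_mul R K J J

/-- This reduces the classification to combinatorics: the index set has to meet each class of equal
columns of `cnt` exactly once. -/
theorem indexesIrreps_of_cnt {k : Type u} [Field k] {c : Finset (Fin n) → D n}
    (hc : ∀ J, IsCoxeterElement J (c J)) {I : Set (Finset (Fin n))}
    (hcover : ∀ J, ∃ J' ∈ I, ∀ K, (cnt K (wt J) : k) = cnt K (wt J'))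
    (hinj : ∀ J ∈ I, ∀ J' ∈ I, (∀ K, (cnt K (wt J) : k) = cnt K (wt J')) → J = J') :
    IndexesIrreps.{v, u} k n c I := by
  refine ⟨fun J => diagChar k J.1, fun J K => ?_, ?_⟩
  · rw [diagChar_basisX, permChar_coxeter (hc J), structConst_self]
  · refine areTheIrreps_of_triangular (R := k) (f := RingHom.id k) (x := basisX k n)
      (a := structConst) (χ := fun J => (diagChar k J).toRingHom) Function.surjective_id ?_ ?_
      (basisX_mul k) (fun _ _ _ => structConst_eq_zero) (fun J K => diagChar_basisX k J K) ?_ ?_ ?_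
    · intro r hr; rw [show r = 0 from hr, map_zero]
    · intro b; exact ⟨_, basisX_eq_sum k b⟩
    · intro J r; exact (diagChar k J).commutes r
    · simpa only [structConst_self] using hcover
    · simpa only [structConst_self] using hinj

/-- The diagonal characters of the modular descent algebra. -/
noncomputable def modularDiagChar (p : ℕ) (J : Finset (Fin n)) :
    ModularDescentAlgebra n p →+* ZMod p :=
  Ideal.Quotient.lift (multiples n p) ((Int.castRingHom (ZMod p)).comp (diagChar ℤ J).toRingHom)
    (by
      intro y hy
      obtain ⟨z, rfl⟩ := Ideal.mem_span_singleton'.1 hy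
      rw [map_mul, map_natCast, CharP.cast_eq_zero, mul_zero])

theorem indexesModularIrreps_of_cnt {p : ℕ} [Fact p.Prime] {c : Finset (Fin n) → D n}
    (hc : ∀ J, IsCoxeterElement J (c J)) {I : Set (Finset (Fin n))}
    (hcover : ∀ J, ∃ J' ∈ I, ∀ K, (cnt K (wt J) : ZMod p) = cnt K (wt J'))
    (hinj : ∀ J ∈ I, ∀ J' ∈ I, (∀ K, (cnt K (wt J) : ZMod p) = cnt K (wt J')) → J = J') :
    IndexesModularIrreps.{v} n p c I := by
  have hval : ∀ J K : Finset (Fin n), modularDiagChar p J (basisXbar n p K) = structConst K J J := by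
    intro J K
    rw [modularDiagChar, basisXbar, Ideal.Quotient.lift_mk, RingHom.comp_apply]
    change Int.castRingHom (ZMod p) (diagChar ℤ J (basisX ℤ n K)) = _
    rw [diagChar_basisX]; simp
  refine ⟨fun J => modularDiagChar p J.1, fun J K => ?_, ?_⟩
  · rw [hval, permChar_coxeter (hc J), structConst_self]
  · refine areTheIrreps_of_triangular (R := ℤ) (f := Int.castRingHom (ZMod p))
      (x := basisXbar n p) (a := structConst) (χ := modularDiagChar p)
      (ZMod.ringHom_surjective _) ?_ ?_ ?_ (fun _ _ _ => structConst_eq_zero) hval ?_ ?_ ?_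
    · intro r hr
      obtain ⟨z, rfl⟩ := (ZMod.intCast_zmod_eq_zero_iff_dvd r p).1 hr
      have : ((p : ℕ) : ModularDescentAlgebra n p) = 0 := by
        rw [← map_natCast (Ideal.Quotient.mk (multiples n p)), Ideal.Quotient.eq_zero_iff_mem]
        exact Ideal.mem_span_singleton_self _
      rw [map_mul, map_natCast, this, zero_mul]
    · intro b
      obtain ⟨b, rfl⟩ := Ideal.Quotient.mk_surjective b
      refine ⟨(descentBasis ℤ n).repr b, ?_⟩
      conv_lhs => rw [basisX_eq_sum ℤ b, map_sum]
      exact Finset.sum_congr rfl fun J _ => map_zsmul (Ideal.Quotient.mk (multiples n p)) _ _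
    · intro K J
      simp only [basisXbar]
      rw [← map_mul, basisX_mul, map_sum]
      exact Finset.sum_congr rfl fun J _ => map_nsmul (Ideal.Quotient.mk (multiples n p)) _ _
    · intro J r; rw [eq_intCast, map_intCast, eq_intCast]
    · simpa only [structConst_self] using hcover
    · simpa only [structConst_self] using hinj

end Characters

section Counting

variable {n : ℕ} [Fact (2 ≤ n)]

/-! ### Counting faces in flats modulo a prime -/

theorem cnt_congr {v v' : Vec n} (h : Zle v v') (h' : Zle v' v) (J : Finset (Fin n)) :
    cnt J v = cnt J v' := by
  rw [cnt, cnt]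
  congr 1; ext u
  simp only [Finset.mem_filter]
  exact and_congr_right fun _ => ⟨fun hu => h'.trans hu, fun hu => h.trans hu⟩

theorem zle_smul_iff {v u : Vec n} (g : D n) : Zle (g • v) u ↔ Zle v (g⁻¹ • u) := by
  constructor
  · intro h; have := h.smul g⁻¹; rwa [inv_smul_smul] at this
  · intro h; have := h.smul g; rwa [smul_inv_smul] at this

theorem cnt_smul (g : D n) (v : Vec n) (J : Finset (Fin n)) : cnt J (g • v) = cnt J v := by
  rw [cnt, cnt]
  refine Finset.card_bij' (fun u _ => g⁻¹ • u) (fun u _ => g • u) ?_ ?_ (fun _ _ => smul_inv_smul _ _)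
    (fun _ _ => inv_smul_smul _ _)
  · intro u hu
    simp only [Finset.mem_filter, smul_mem_orb] at hu ⊢
    exact ⟨hu.1, (zle_smul_iff g).1 hu.2⟩
  · intro u hu
    simp only [Finset.mem_filter, smul_mem_orb] at hu ⊢
    exact ⟨hu.1, hu.2.smul g⟩

theorem SameFace.cnt_eq {v v' : Vec n} (h : SameFace v v') (J : Finset (Fin n)) :
    cnt J v = cnt J v' := cnt_congr h.zle h.symm.zle J

/-- An element of order `p` that preserves a flat gives a congruence between the numbers of faces in
the flat and in its subflat of fixed vectors. -/
theorem cnt_modEq {p : ℕ} [Fact p.Prime] {g : D n} (hg : g ^ p = 1) {v v' : Vec n} (hle : Zle v' v)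
    (hpres : ∀ u, Zle v' u → Zle v' (g • u))
    (hfix : ∀ u, Zle v' u → (g • u = u ↔ Zle v u)) (J : Finset (Fin n)) :
    cnt J v ≡ cnt J v' [MOD p] := by
  classical
  let T := {u // u ∈ (orb J).filter fun u => Zle v' u}
  have hT : ∀ u : T, g • u.1 ∈ (orb J).filter fun u => Zle v' u := fun u => by
    have := Finset.mem_filter.1 u.2
    exact Finset.mem_filter.2 ⟨(smul_mem_orb g).2 this.1, hpres _ this.2⟩
  let f : Function.End T := fun u => ⟨g • u.1, hT u⟩
  have hf : ∀ (m : ℕ) (u : T), ((f ^ m) u).1 = g ^ m • u.1 := by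
    intro m
    induction m with
    | zero => intro u; rw [pow_zero, pow_zero, one_smul]; rfl
    | succ m ih =>
      intro u
      rw [pow_succ', pow_succ', mul_smul, ← ih]; rfl
  have hfp : f ^ p ^ 1 = 1 := by
    funext u
    apply Subtype.ext
    rw [hf, pow_one, hg, one_smul]; rfl
  have h1 := Equiv.Perm.card_fixedPoints_modEq hfp
  have h2 : Fintype.card T = cnt J v' := by rw [Fintype.card_coe, cnt]
  have h3 : Fintype.card (Function.fixedPoints f) = cnt J v := by
    rw [cnt, ← Fintype.card_coe]
    refine Fintype.card_congr ⟨fun u => ⟨u.1.1, ?_⟩, fun u => ⟨⟨u.1, ?_⟩, ?_⟩, fun _ => rfl,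
      fun _ => rfl⟩
    · have hu := Finset.mem_filter.1 u.1.2
      refine Finset.mem_filter.2 ⟨hu.1, (hfix _ hu.2).1 ?_⟩
      exact congrArg Subtype.val u.2
    · have hu := Finset.mem_filter.1 u.2
      exact Finset.mem_filter.2 ⟨hu.1, hle.trans hu.2⟩
    · have hu := Finset.mem_filter.1 u.2
      exact Subtype.ext ((hfix _ (hle.trans hu.2)).2 hu.2)
  rw [h2, h3] at h1
  exact h1.symm

theorem prod_smul_eq (g : D n) (v : Vec n) :
    ∏ x ∈ Finset.Icc (1 : ℤ) n, (g • v).1 x = ∏ x ∈ Finset.Icc (1 : ℤ) n, v.1 x := by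
  have := prod_odd_comp (act_mem_oddPerms g⁻¹) (f := v.1) (vec_neg v)
  rw [eps_act, one_mul] at this
  exact this

/-- Elements of `D_n` that change the signs of an even number of coordinates. -/
theorem exists_flip {A : ℤ → Prop} [DecidablePred A] (hA : ∀ x, A (-x) ↔ A x)
    (heven : Even ((Finset.Icc (1 : ℤ) n).filter A).card) :
    ∃ g : D n, g ^ 2 = 1 ∧ ∀ (v : Vec n) (x : ℤ), (g • v).1 x = if A x then -v.1 x else v.1 x := by
  let f : ℤ → ℤ := fun x => if x ∈ points n ∧ A x then -x else x
  have hf : Function.Involutive f := by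
    intro x
    by_cases h : x ∈ points n ∧ A x
    · have h' : -x ∈ points n ∧ A (-x) := ⟨neg_mem_points.2 h.1, (hA x).2 h.2⟩
      simp only [f, if_pos h, if_pos h', neg_neg]
    · simp only [f, if_neg h]
  have hmem : (Function.Involutive.toPerm f hf) ∈ oddPerms n := by
    refine ⟨fun x => ?_, fun x hx => ?_⟩
    · change f (-x) = -f x
      simp only [f, neg_mem_points, hA]
      split_ifs <;> rfl
    · change f x = x
      exact if_neg fun h => hx h.1
  have heps : eps n (Function.Involutive.toPerm f hf) = 1 := by
    have : ∀ x ∈ Finset.Icc (1 : ℤ) n, ((Function.Involutive.toPerm f hf) x).sign = if A x then -1 else 1 := by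
      intro x hx
      have hx' := mem_points_of_Icc hx
      rw [Finset.mem_Icc] at hx
      change (f x).sign = _
      by_cases h : A x
      · rw [if_pos h, show f x = -x from if_pos ⟨hx', h⟩]
        exact Int.sign_eq_neg_one_of_neg (by omega)
      · rw [if_neg h, show f x = x from if_neg fun h' => h h'.2]
        exact Int.sign_eq_one_of_pos (by omega)
    rw [eps, Finset.prod_congr rfl this, ← Finset.prod_filter, Finset.prod_const]
    exact heven.neg_one_pow
  obtain ⟨g, hg⟩ := exists_act_eq hmem heps
  have hg2 : g ^ 2 = 1 := by
    apply act_injective n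
    rw [map_pow, hg, map_one]
    ext x
    rw [pow_two]; exact hf x
  have hinv : g⁻¹ = g := inv_eq_of_mul_eq_one_left (by rw [← pow_two, hg2])
  refine ⟨g, hg2, fun v x => ?_⟩
  rw [smul_apply, hinv, hg]
  change v.1 (f x) = _
  by_cases hx : x ∈ points n
  · by_cases h : A x
    · rw [if_pos h, show f x = -x from if_pos ⟨hx, h⟩, vec_neg]
    · rw [if_neg h, show f x = x from if_neg fun h' => h h'.2]
  · rw [show f x = x from if_neg fun h' => hx h'.1, vec_eq_zero v hx]; simp

theorem one_mem_points : (1 : ℤ) ∈ points n := by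
  have := two_le n; rw [mem_points]; omega

theorem two_mem_points : (2 : ℤ) ∈ points n := by
  have := two_le n; rw [mem_points]; omega

/-- The number of vanishing coordinates is not one. -/
def Normal (v : Vec n) : Prop := ∀ x ∈ points n, v.1 x = 0 → ∃ y ∈ points n, y ≠ x ∧ y ≠ -x ∧ v.1 y = 0

/-- Two vanishing coordinates lie on both hyperplanes `v x = v y` and `v x = -v y`, which together
force the coordinate to vanish on the flat. A single zero coordinate gives no such equations, hence
the condition `Normal`. -/
theorem eq_zero_of_zle {v u : Vec n} (h : Zle v u) {x y : ℤ} (hx : x ∈ points n) (hy : y ∈ points n)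
    (h1 : y ≠ x) (h2 : y ≠ -x) (hvx : v.1 x = 0) (hvy : v.1 y = 0) : u.1 x = 0 := by
  have e1 := h x y ⟨hx, hy, by omega⟩ (by rw [hvx, hvy])
  have e2 := h x (-y) ⟨hx, neg_mem_points.2 hy, by omega⟩ (by rw [hvx, vec_neg, hvy, neg_zero])
  rw [vec_neg] at e2
  omega

theorem Normal.apply_eq_zero {v u : Vec n} (hv : Normal v) (h : Zle v u) {x : ℤ}
    (hx : v.1 x = 0) : u.1 x = 0 := by
  by_cases hp : x ∈ points n
  · obtain ⟨y, hy, h1, h2, h3⟩ := hv x hp hx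
    exact eq_zero_of_zle h hp hy h1 h2 hx h3
  · exact vec_eq_zero u hp

theorem Normal.apply_eq {v u : Vec n} (hv : Normal v) (h : Zle v u) {x y : ℤ} (hx : x ∈ points n)
    (hy : y ∈ points n) (hxy : v.1 x = v.1 y) : u.1 x = u.1 y := by
  by_cases he : x + y = 0
  · have : y = -x := by omega
    subst this
    rw [vec_neg] at hxy
    have := hv.apply_eq_zero h (x := x) (by omega)
    rw [vec_neg, this, neg_zero]
  · exact h x y ⟨hx, hy, he⟩ hxy

theorem Normal.smul {v : Vec n} (hv : Normal v) (g : D n) : Normal (g • v) := by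
  intro x hx h
  obtain ⟨y, hy, h1, h2, h3⟩ := hv _ ((act_mem_points g⁻¹).2 hx) h
  refine ⟨act n g y, (act_mem_points g).2 hy, ?_, ?_, by rwa [smul_apply_act]⟩
  · rintro rfl; exact h1 (act_inv_act g y).symm
  · intro e
    have : act n g⁻¹ (act n g y) = act n g⁻¹ (-x) := by rw [e]
    rw [act_inv_act, act_neg (two_le n)] at this
    exact h2 this

theorem Dominant.abs_le {v : Vec n} (hv : Dominant v) {x y : ℤ} (h1 : 1 ≤ x) (h2 : x < y)
    (hy : y ≤ n) : |v.1 x| ≤ v.1 y := by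
  have hx : x ∈ points n := by rw [mem_points]; omega
  have hy' : y ∈ points n := by rw [mem_points]; omega
  rw [abs_le']
  refine ⟨hv.le ⟨hx, hy', by omega⟩ h2.le, ?_⟩
  rw [← vec_neg]
  exact hv.le ⟨neg_mem_points.2 hx, hy', by omega⟩ (by omega)

theorem al_zero_apply (v : Vec n) (h : 0 < n) : al ⟨0, h⟩ v = v.1 2 + v.1 1 := by
  rw [al_apply]
  simp only [lpt, rpt, if_true]
  rw [vec_neg]; ring

theorem al_one_apply (v : Vec n) (h : 1 < n) : al ⟨1, h⟩ v = v.1 2 - v.1 1 := by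
  rw [al_apply]
  simp [lpt, rpt]

theorem om_zero_apply (h : 0 < n) {x : ℤ} (hx : x ∈ points n) : (om ⟨0, h⟩).1 x = 2 * sg x := by
  rw [om, mkVec_apply hx]; simp

theorem al_zero_om (h : 0 < n) : al ⟨0, h⟩ (om ⟨0, h⟩) = 4 := by
  rw [al_zero_apply, om_zero_apply h two_mem_points, om_zero_apply h one_mem_points]
  simp [sg]

theorem al_one_om (h : 1 < n) : al ⟨1, h⟩ (om ⟨1, h⟩) = 2 := by
  rw [al_one_apply, om, mkVec_apply two_mem_points, mkVec_apply one_mem_points]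
  simp [sg]

/-- If the first coordinate vanishes, both simple roots at the fork take the value of the second
coordinate. On `wt J` these values are `0` or `4` and `0` or `2` respectively, so they can only
agree when both are zero. The factor `2` in `om` at label `0` serves this purpose. -/
theorem normal_wt (J : Finset (Fin n)) : Normal (wt J) := by
  have hn := two_le n
  have key : ∀ x : ℤ, 1 ≤ x → x ≤ n → (wt J).1 x = 0 →
      ∃ y ∈ points n, y ≠ x ∧ y ≠ -x ∧ (wt J).1 y = 0 := by
    intro x h1 h2 h
    rcases eq_or_lt_of_le h1 with rfl | h3
    · refine ⟨2, two_mem_points, by omega, by omega, ?_⟩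
      have e0 := al_zero_apply (wt J) (by omega)
      have e1 := al_one_apply (wt J) (by omega)
      rw [h] at e0 e1
      by_cases j0 : (⟨0, by omega⟩ : Fin n) ∈ J
      · rw [al_wt_of_mem j0] at e0; omega
      · by_cases j1 : (⟨1, by omega⟩ : Fin n) ∈ J
        · rw [al_wt_of_mem j1] at e1; omega
        · rw [al_wt_of_notMem j0, al_zero_om] at e0
          rw [al_wt_of_notMem j1, al_one_om] at e1
          omega
    · refine ⟨1, one_mem_points, by omega, by omega, ?_⟩
      have := (dominant_wt J).abs_le le_rfl h3 h2
      rw [h] at this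
      exact abs_nonpos_iff.1 this
  intro x hx h
  rw [mem_points] at hx
  rcases lt_or_gt_of_ne hx.1 with h1 | h1
  · obtain ⟨y, hy, h2, h3, h4⟩ := key (-x) (by omega) (by omega) (by rw [vec_neg, h, neg_zero])
    exact ⟨y, hy, by omega, by omega, h4⟩
  · exact key x (by omega) (by omega) h

/-! ### Characteristic two -/

theorem zle_zero {u : Vec n} (h : Zle 0 u) : u = 0 := by
  refine vec_ext fun x hx => ?_
  by_cases h1 : x = 1 ∨ x = -1
  · exact eq_zero_of_zle h hx two_mem_points (by omega) (by omega) rfl rfl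
  · exact eq_zero_of_zle h hx one_mem_points (by omega) (by omega) rfl rfl

theorem zle_zero_iff {u : Vec n} : Zle 0 u ↔ u = 0 :=
  ⟨zle_zero, by rintro rfl; exact Zle.refl _⟩

theorem zle_to_zero (v : Vec n) : Zle v 0 := fun _ _ _ _ => rfl

theorem Zle.neg {v u : Vec n} (h : Zle v u) : Zle v (-u) := fun x y hr e => by
  have := h x y hr e
  change -u.1 x = -u.1 y
  rw [this]

theorem eq_neg_self_iff {u : Vec n} : -u = u ↔ u = 0 := by
  constructor
  · intro h
    refine vec_ext fun x _ => ?_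
    have := congrArg (fun w : Vec n => w.1 x) h
    change -u.1 x = u.1 x at this
    change u.1 x = 0
    omega
  · rintro rfl; exact neg_zero

/-- For even `n` the map `-1` belongs to `D_n`; it preserves every flat and fixes only the zero
vector. -/
theorem cnt_modEq_two_of_even (hn : Even n) (v : Vec n) (J : Finset (Fin n)) :
    cnt J 0 ≡ cnt J v [MOD 2] := by
  classical
  obtain ⟨g, hg, hact⟩ := exists_flip (n := n) (A := fun _ => True) (fun _ => Iff.rfl) (by
    rw [Finset.filter_true]; simpa using hn)
  have hneg : ∀ u : Vec n, g • u = -u := fun u => Subtype.ext (funext fun x => by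
    rw [hact, if_pos trivial]; rfl)
  refine cnt_modEq hg (zle_to_zero v) (fun u hu => ?_) (fun u _ => ?_) J
  · rw [hneg]; exact hu.neg
  · rw [hneg, eq_neg_self_iff, zle_zero_iff]

/-- Reversing all coordinates except `|x₀|` is an even number of sign changes, and it acts as `-1`
on the flat because the coordinate `x₀` vanishes there. -/
theorem cnt_modEq_two_of_zero (hn : Odd n) {v : Vec n} {x₀ y₀ : ℤ} (hx : x₀ ∈ points n)
    (hy : y₀ ∈ points n) (h1 : y₀ ≠ x₀) (h2 : y₀ ≠ -x₀) (hvx : v.1 x₀ = 0) (hvy : v.1 y₀ = 0)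
    (J : Finset (Fin n)) : cnt J 0 ≡ cnt J v [MOD 2] := by
  classical
  obtain ⟨g, hg, hact⟩ := exists_flip (n := n) (A := fun x => |x| ≠ |x₀|) (fun x => by rw [abs_neg]) (by
    have hcard : (Finset.Icc (1 : ℤ) n).filter (fun x => |x| ≠ |x₀|) =
        (Finset.Icc (1 : ℤ) n).erase |x₀| := by
      ext x
      rw [Finset.mem_filter, Finset.mem_erase, and_comm]
      refine and_congr_left fun hx => ?_
      rw [Finset.mem_Icc] at hx
      rw [abs_of_pos (by omega)]
    rw [hcard, Finset.card_erase_of_mem (abs_mem_Icc hx)]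
    simpa using hn.tsub_odd odd_one)
  have hneg : ∀ u : Vec n, Zle v u → g • u = -u := fun u hu => Subtype.ext (funext fun x => by
    rw [hact]
    change _ = -u.1 x
    by_cases h : |x| = |x₀|
    · have h0 : u.1 x₀ = 0 := eq_zero_of_zle hu hx hy h1 h2 hvx hvy
      rw [if_neg (by simpa using h)]
      rcases abs_eq_abs.1 h with rfl | rfl
      · rw [h0, neg_zero]
      · rw [vec_neg, h0, neg_zero, neg_zero]
    · rw [if_pos h])
  refine cnt_modEq hg (zle_to_zero v) (fun u hu => ?_) (fun u hu => ?_) J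
  · rw [hneg u hu]; exact hu.neg
  · rw [hneg u hu, eq_neg_self_iff, zle_zero_iff]

theorem exists_odd_block (hn : Odd n) (v : Vec n) :
    ∃ x₀ ∈ Finset.Icc (1 : ℤ) n, Odd ((Finset.Icc (1 : ℤ) n).filter fun x => |v.1 x| = |v.1 x₀|).card := by
  by_contra! h
  have := Finset.card_eq_sum_card_image (fun x => |v.1 x|) (Finset.Icc (1 : ℤ) n)
  have he : Even (Finset.Icc (1 : ℤ) n).card := by
    rw [this]
    refine Finset.even_sum _ fun a ha => ?_
    obtain ⟨x, hx, rfl⟩ := Finset.mem_image.1 ha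
    exact Nat.not_odd_iff_even.1 (h x hx)
  rw [Int.card_Icc] at he
  simp only [add_sub_cancel_right, Int.toNat_natCast] at he
  exact Nat.not_even_iff_odd.2 hn he

/-- If no coordinate vanishes, some block has odd size because `n` is odd. Reversing all the other
blocks is then allowed, and its fixed subflat has vanishing coordinates, which leads back to
`cnt_modEq_two_of_zero`. -/
theorem cnt_modEq_two_of_odd (hn : Odd n) {v : Vec n} (hv : Normal v)
    (hne : ∃ x ∈ Finset.Icc (1 : ℤ) n, v.1 x = 0 ∨ |v.1 x| ≠ |v.1 1|) (J : Finset (Fin n)) :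
    cnt J 0 ≡ cnt J v [MOD 2] := by
  classical
  by_cases h0 : ∃ x ∈ points n, v.1 x = 0
  · obtain ⟨x, hx, h⟩ := h0
    obtain ⟨y, hy, h1, h2, h3⟩ := hv x hx h
    exact cnt_modEq_two_of_zero hn hx hy h1 h2 h h3 J
  push Not at h0
  obtain ⟨x₀, hx₀, hodd⟩ := exists_odd_block hn v
  set A : ℤ → Prop := fun x => |v.1 x| ≠ |v.1 x₀| with hA
  have hAneg : ∀ x, A (-x) ↔ A x := fun x => by simp only [hA]; rw [vec_neg, abs_neg]
  have heven : Even ((Finset.Icc (1 : ℤ) n).filter A).card := by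
    have := Finset.card_filter_add_card_filter_not (s := Finset.Icc (1 : ℤ) n)
      (fun x => |v.1 x| = |v.1 x₀|)
    rw [Int.card_Icc] at this
    simp only [add_sub_cancel_right, Int.toNat_natCast] at this
    rw [← this, Nat.odd_add] at hn
    exact hn.1 hodd
  obtain ⟨g, hg, hact⟩ := exists_flip hAneg heven
  have hAabs : ∀ {x}, A |x| ↔ A x := fun {x} => by
    rcases abs_choice x with h | h <;> rw [h]
    exact hAneg x
  obtain ⟨a, ha, hAa⟩ : ∃ a ∈ Finset.Icc (1 : ℤ) n, A a := by
    obtain ⟨x, hx, h⟩ := hne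
    have h := h.resolve_left (h0 x (mem_points_of_Icc hx))
    by_cases h1 : A 1
    · exact ⟨1, by have := two_le n; rw [Finset.mem_Icc]; omega, h1⟩
    · refine ⟨x, hx, fun h2 => h ?_⟩
      rw [h2]; simp only [hA, not_not] at h1; exact h1.symm
  -- The set of reversed coordinates is even, so it is never a single one; two zero coordinates are
  -- needed for hyperplanes to force vanishing.
  have hother : ∀ x ∈ points n, A x → ∃ y ∈ points n, A y ∧ y ≠ x ∧ y ≠ -x := by
    intro x hx hAx
    by_contra! hcon
    have : (Finset.Icc (1 : ℤ) n).filter A = {|x|} := by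
      ext y
      rw [Finset.mem_filter, Finset.mem_singleton]
      constructor
      · rintro ⟨hy, hAy⟩
        have hyp := mem_points_of_Icc hy
        rw [Finset.mem_Icc] at hy
        rcases abs_cases x with h | h
        · by_contra h3; have := hcon y hyp hAy (by omega); omega
        · by_contra h3
          by_cases h4 : y = x
          · omega
          · have := hcon y hyp hAy h4; omega
      · rintro rfl; exact ⟨abs_mem_Icc hx, hAabs.2 hAx⟩
    rw [this] at heven
    simp at heven
  -- Setting the reversed coordinates to zero gives a vector whose flat is the fixed part of the
  -- flat of `v`.
  let v₂ : Vec n := ⟨fun x => if A x then 0 else v.1 x, fun x => by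
    simp only [hAneg, vec_neg]; split_ifs <;> simp, fun x hx => by
    simp [vec_eq_zero v hx]⟩
  have hv₂ : ∀ x, v₂.1 x = if A x then 0 else v.1 x := fun _ => rfl
  have hle : Zle v v₂ := by
    intro x y _ e
    rw [hv₂, hv₂]
    simp only [hA, e]
  have hmain : cnt J v₂ ≡ cnt J v [MOD 2] := by
    refine cnt_modEq hg hle (fun u hu x y hr e => ?_) (fun u hu => ⟨fun h => ?_, fun h => ?_⟩) J
    · rw [hact, hact, hu x y hr e]
      simp only [hA, e]
    · have hzero : ∀ x, A x → u.1 x = 0 := fun x hx => by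
        have := congrArg (fun w : Vec n => w.1 x) h
        simp only [hact, if_pos hx] at this
        omega
      intro x y hr e
      rw [hv₂, hv₂] at e
      by_cases hx : A x
      · by_cases hy : A y
        · rw [hzero x hx, hzero y hy]
        · rw [if_pos hx, if_neg hy] at e; exact absurd e.symm (h0 y hr.2.1)
      · by_cases hy : A y
        · rw [if_neg hx, if_pos hy] at e; exact absurd e (h0 x hr.1)
        · rw [if_neg hx, if_neg hy] at e; exact hu x y hr e
    · refine vec_ext fun x hx => ?_
      rw [hact]
      by_cases hAx : A x
      · obtain ⟨y, hy, hAy, h1, h2⟩ := hother x hx hAx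
        have := eq_zero_of_zle h hx hy h1 h2 (by rw [hv₂, if_pos hAx]) (by rw [hv₂, if_pos hAy])
        rw [this]; simp
      · rw [if_neg hAx]
  have hap := mem_points_of_Icc ha
  obtain ⟨y, hy, hAy, h1, h2⟩ := hother a hap hAa
  exact (cnt_modEq_two_of_zero hn hap hy h1 h2 (by rw [hv₂, if_pos hAa]) (by rw [hv₂, if_pos hAy]) J).trans
    hmain

/-- As `n` is odd, either the number of negative or the number of positive coordinates is even.
Reversing these moves `v` to a multiple of the all-ones vector. -/
theorem cnt_eq_of_abs_eq (hn : Odd n) {v : Vec n}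
    (h : ∀ x ∈ Finset.Icc (1 : ℤ) n, v.1 x ≠ 0 ∧ |v.1 x| = |v.1 1|) (h0 : 0 < n)
    (J : Finset (Fin n)) : cnt J v = cnt J (om ⟨0, h0⟩) := by
  classical
  have hfin : ∀ u : Vec n, ∀ c : ℤ, c ≠ 0 → (∀ x ∈ Finset.Icc (1 : ℤ) n, u.1 x = c) →
      cnt J u = cnt J (om ⟨0, h0⟩) := by
    intro u c hc hu
    have hval : ∀ x ∈ points n, u.1 x = c * sg x := by
      intro x hx
      have hx' := mem_points.1 hx
      rcases lt_or_gt_of_ne hx'.1 with h | h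
      · have := hu (-x) (Finset.mem_Icc.2 (by omega))
        rw [vec_neg] at this
        simp only [sg, if_neg h.not_gt, if_pos h]; omega
      · have := hu x (Finset.mem_Icc.2 (by omega))
        simp only [sg, if_pos h]; omega
    refine cnt_congr (fun x y hr e => ?_) (fun x y hr e => ?_) J
    · rw [hval x hr.1, hval y hr.2.1] at e
      rw [om_zero_apply h0 hr.1, om_zero_apply h0 hr.2.1, mul_left_cancel₀ hc e]
    · rw [om_zero_apply h0 hr.1, om_zero_apply h0 hr.2.1] at e
      rw [hval x hr.1, hval y hr.2.1, mul_left_cancel₀ two_ne_zero e]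
  set c := |v.1 1|
  have hc : c ≠ 0 := by
    have := two_le n
    exact abs_ne_zero.2 (h 1 (Finset.mem_Icc.2 (by omega))).1
  set A : ℤ → Prop := fun x => v.1 x * x < 0 with hA
  have hAneg : ∀ x, A (-x) ↔ A x := fun x => by simp only [hA]; rw [vec_neg, neg_mul_neg]
  have hAval : ∀ x ∈ Finset.Icc (1 : ℤ) n, v.1 x = if A x then -c else c := by
    intro x hx
    obtain ⟨h1, h2⟩ := h x hx
    rw [Finset.mem_Icc] at hx
    by_cases hAx : A x
    · rw [if_pos hAx, ← h2, abs_of_neg, neg_neg]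
      simp only [hA] at hAx; by_contra h3; nlinarith
    · rw [if_neg hAx, ← h2, abs_of_nonneg]
      simp only [hA] at hAx; by_contra h3; apply hAx; nlinarith
  rcases Nat.even_or_odd ((Finset.Icc (1 : ℤ) n).filter A).card with he | ho
  · obtain ⟨g, -, hact⟩ := exists_flip hAneg he
    rw [← cnt_smul g]
    refine hfin _ c hc fun x hx => ?_
    have := hAval x hx
    rw [hact]; split_ifs at * <;> omega
  · have he : Even ((Finset.Icc (1 : ℤ) n).filter fun x => ¬ A x).card := by
      have := Finset.card_filter_add_card_filter_not (s := Finset.Icc (1 : ℤ) n) A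
      rw [Int.card_Icc] at this
      simp only [add_sub_cancel_right, Int.toNat_natCast] at this
      rw [← this, Nat.odd_add] at hn
      exact hn.1 ho
    obtain ⟨g, -, hact⟩ := exists_flip (fun x => (hAneg x).not) he
    rw [← cnt_smul g]
    refine hfin _ (-c) (neg_ne_zero.2 hc) fun x hx => ?_
    have := hAval x hx
    rw [hact]; split_ifs at * <;> omega

theorem wt_univ : wt (Finset.univ : Finset (Fin n)) = 0 := by simp [wt]

theorem wt_compl_zero (h0 : 0 < n) : wt ({⟨0, h0⟩}ᶜ : Finset (Fin n)) = om ⟨0, h0⟩ := by simp [wt]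

theorem cnt_compl_zero_zero (h0 : 0 < n) : cnt ({⟨0, h0⟩}ᶜ : Finset (Fin n)) 0 = 0 := by
  classical
  rw [cnt, Finset.card_eq_zero, Finset.filter_eq_empty_iff]
  intro u hu hz
  obtain ⟨g, rfl⟩ := mem_orb.1 hu
  have h1 := zle_zero hz
  have h2 := congrArg (fun w : Vec n => w.1 (act n g 1)) h1
  simp only [smul_apply_act, wt_compl_zero] at h2
  rw [om_zero_apply h0 one_mem_points] at h2
  simp [sg] at h2

/-- The product of the coordinates is invariant under `D_n`. On this line it is an `n`-th power, and
odd powers are injective, so the line meets the orbit only once. -/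
theorem cnt_compl_zero_self (hn : Odd n) (h0 : 0 < n) :
    cnt ({⟨0, h0⟩}ᶜ : Finset (Fin n)) (om ⟨0, h0⟩) = 1 := by
  classical
  rw [cnt, Finset.card_eq_one]
  refine ⟨om ⟨0, h0⟩, ?_⟩
  ext u
  rw [Finset.mem_filter, Finset.mem_singleton]
  constructor
  · rintro ⟨hu, hz⟩
    obtain ⟨g, hg⟩ := mem_orb.1 hu
    have hone : ∀ x ∈ Finset.Icc (1 : ℤ) n, u.1 x = u.1 1 := by
      intro x hx
      have hxp := mem_points_of_Icc hx
      rw [Finset.mem_Icc] at hx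
      refine hz x 1 ⟨hxp, one_mem_points, by omega⟩ ?_
      rw [om_zero_apply h0 hxp, om_zero_apply h0 one_mem_points]
      simp only [sg, if_pos (show 0 < x by omega)]; simp
    have hprod := prod_smul_eq g (wt {⟨0, h0⟩}ᶜ)
    rw [hg, wt_compl_zero, Finset.prod_congr rfl hone] at hprod
    have htwo : ∀ x ∈ Finset.Icc (1 : ℤ) n, (om ⟨0, h0⟩ : Vec n).1 x = 2 := by
      intro x hx
      rw [om_zero_apply h0 (mem_points_of_Icc hx)]
      rw [Finset.mem_Icc] at hx
      simp only [sg, if_pos (show 0 < x by omega)]; simp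
    rw [Finset.prod_congr rfl htwo, Finset.prod_const, Finset.prod_const, Int.card_Icc] at hprod
    simp only [add_sub_cancel_right, Int.toNat_natCast] at hprod
    have h2 : u.1 1 = 2 := hn.strictMono_pow.injective hprod
    refine vec_ext fun x hx => ?_
    have hx' := mem_points.1 hx
    rcases lt_or_gt_of_ne hx'.1 with h | h
    · have hm : -x ∈ Finset.Icc (1 : ℤ) n := Finset.mem_Icc.2 (by omega)
      have e1 := hone _ hm
      have e2 := htwo _ hm
      rw [vec_neg] at e1 e2
      omega
    · have hm : x ∈ Finset.Icc (1 : ℤ) n := Finset.mem_Icc.2 (by omega)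
      rw [hone x hm, htwo x hm, h2]
  · rintro rfl
    exact ⟨mem_orb.2 ⟨1, by rw [one_smul, wt_compl_zero]⟩, Zle.refl _⟩

theorem subset_eq_empty_of_components {κ : Comps n} (h : κ.components = []) : κ.subset = ∅ := by
  match κ with
  | .below m hm κ =>
    have hl : κ.length = 0 := by rw [Composition.length, show κ.blocks = [] from h]; rfl
    ext i
    simp [Comps.subset, hl]
  | .one κ hκ => rw [show κ.blocks = [] from h] at hκ; simp at hκ
  | .top κ hκ => rw [show κ.blocks = [] from h] at hκ; simp at hκ
  | .topPrime κ hκ => rw [show κ.blocks = [] from h] at hκ; simp at hκ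

theorem exists_components_nil : ∃ κ : Comps n, κ.subset = ∅ ∧ κ.components = [] :=
  have h : (Comps.below 0 (two_le n) (Composition.ones 0)).components = [] := rfl
  ⟨_, subset_eq_empty_of_components h, h⟩

theorem mem_indexTwoEven {J : Finset (Fin n)} : J ∈ indexTwoEven n ↔ J = Finset.univ := by
  rw [← Finset.compl_eq_empty_iff]
  constructor
  · rintro ⟨κ, h1, h2⟩
    rw [h1, subset_eq_empty_of_components h2]
  · intro h
    obtain ⟨κ, h1, h2⟩ := exists_components_nil (n := n)
    exact ⟨κ, by rw [h, h1], h2⟩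

theorem subset_top_of_single {κ : Composition n} (h : ∃ a ∈ κ.blocks.head?, 2 ≤ a)
    (hκ : κ.blocks = [n]) (h0 : 0 < n) : (Comps.top κ h).subset = {⟨0, h0⟩} := by
  have hl : κ.length = 1 := by rw [Composition.length, hκ]; rfl
  ext i
  simp only [Comps.subset, hl, Finset.mem_filter, Finset.mem_univ, true_and, Finset.mem_singleton,
    Fin.ext_iff]
  exact ⟨fun h => h.elim id fun ⟨j, h1, h2, _⟩ => by omega, Or.inl⟩

theorem mem_indexTwoOdd (h0 : 0 < n) {J : Finset (Fin n)} :
    J ∈ indexTwoOdd n ↔ J = Finset.univ ∨ J = {⟨0, h0⟩}ᶜ := by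
  have hn := two_le n
  rw [← Finset.compl_eq_empty_iff, eq_compl_comm, eq_comm (b := Jᶜ)]
  constructor
  · rintro ⟨κ, h1, h2 | ⟨h2, h3⟩⟩
    · left; rw [h1, subset_eq_empty_of_components h2]
    · right
      match κ with
      | .below m hm κ =>
        have := κ.blocks_sum
        rw [show κ.blocks = [n] from h3] at this
        simp at this; omega
      | .one κ hκ => rw [show κ.blocks = [n] from h3] at hκ; simp at hκ; omega
      | .top κ hκ => rw [h1, subset_top_of_single hκ h3 h0]
      | .topPrime κ hκ => exact absurd trivial h2
  · rintro (h | h)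
    · obtain ⟨κ, h1, h2⟩ := exists_components_nil (n := n)
      exact ⟨κ, by rw [h, h1], Or.inl h2⟩
    · have hb : (Composition.single n h0).blocks = [n] := rfl
      have hh : ∃ a ∈ (Composition.single n h0).blocks.head?, 2 ≤ a := ⟨n, by rw [hb]; rfl, hn⟩
      exact ⟨.top (Composition.single n h0) hh, by rw [h, subset_top_of_single hh hb h0],
        Or.inr ⟨id, hb⟩⟩

theorem indexesModularIrreps_two_of_even (hn : Even n) {c : Finset (Fin n) → D n}
    (hc : ∀ J, IsCoxeterElement J (c J)) : IndexesModularIrreps.{v} n 2 c (indexTwoEven n) := by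
  refine indexesModularIrreps_of_cnt hc (fun J => ?_) (fun J hJ J' hJ' _ => ?_)
  · refine ⟨Finset.univ, mem_indexTwoEven.2 rfl, fun K => ?_⟩
    rw [wt_univ]
    exact (ZMod.natCast_eq_natCast_iff _ _ _).2 (cnt_modEq_two_of_even hn _ K).symm
  · rw [mem_indexTwoEven.1 hJ, mem_indexTwoEven.1 hJ']

theorem indexesModularIrreps_two_of_odd (hn : Odd n) {c : Finset (Fin n) → D n}
    (hc : ∀ J, IsCoxeterElement J (c J)) : IndexesModularIrreps.{v} n 2 c (indexTwoOdd n) := by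
  have h0 : 0 < n := by have := two_le n; omega
  have hdist : ¬ ∀ K, (cnt K (wt (Finset.univ : Finset (Fin n))) : ZMod 2) =
      cnt K (wt ({⟨0, h0⟩}ᶜ : Finset (Fin n))) := by
    intro h
    have := h {⟨0, h0⟩}ᶜ
    rw [wt_univ, wt_compl_zero, cnt_compl_zero_zero, cnt_compl_zero_self hn] at this
    exact absurd this (by decide)
  refine indexesModularIrreps_of_cnt hc (fun J => ?_) (fun J hJ J' hJ' h => ?_)
  · by_cases hne : ∃ x ∈ Finset.Icc (1 : ℤ) n, (wt J).1 x = 0 ∨ |(wt J).1 x| ≠ |(wt J).1 1|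
    · refine ⟨Finset.univ, (mem_indexTwoOdd h0).2 (Or.inl rfl), fun K => ?_⟩
      rw [wt_univ]
      exact (ZMod.natCast_eq_natCast_iff _ _ _).2 (cnt_modEq_two_of_odd hn (normal_wt J) hne K).symm
    · refine ⟨{⟨0, h0⟩}ᶜ, (mem_indexTwoOdd h0).2 (Or.inr rfl), fun K => ?_⟩
      push Not at hne
      rw [wt_compl_zero, cnt_eq_of_abs_eq hn hne h0]
  · rcases (mem_indexTwoOdd h0).1 hJ with rfl | rfl <;>
      rcases (mem_indexTwoOdd h0).1 hJ' with rfl | rfl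
    · rfl
    · exact absurd h hdist
    · exact absurd (fun K => (h K).symm) hdist
    · rfl

end Counting

section Merging

variable {n : ℕ} [Fact (2 ≤ n)]

/-! ### Block sizes -/

/-- The number of points with the same coordinate as `x`. -/
noncomputable def bs (v : Vec n) (x : ℤ) : ℕ := ((points n).filter fun y => v.1 y = v.1 x).card

theorem bs_neg (v : Vec n) (x : ℤ) : bs v (-x) = bs v x := by
  refine Finset.card_bij' (fun y _ => -y) (fun y _ => -y) ?_ ?_ (fun _ _ => neg_neg _)
    (fun _ _ => neg_neg _) <;>
  · intro y hy
    rw [Finset.mem_filter] at hy ⊢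
    rw [neg_mem_points, vec_neg, hy.2]
    exact ⟨hy.1, by rw [vec_neg]; try rw [neg_neg]⟩

theorem bs_congr_of_eq {v : Vec n} {x y : ℤ} (h : v.1 x = v.1 y) : bs v x = bs v y := by
  rw [bs, bs, h]

theorem bs_smul (g : D n) (v : Vec n) (x : ℤ) : bs (g • v) (act n g x) = bs v x := by
  refine Finset.card_bij' (fun y _ => act n g⁻¹ y) (fun y _ => act n g y) ?_ ?_
    (fun y _ => act_act_inv g y) (fun y _ => act_inv_act g y)
  · intro y hy
    rw [Finset.mem_filter] at hy ⊢
    rw [act_mem_points, ← smul_apply, hy.2, smul_apply_act]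
    exact ⟨hy.1, rfl⟩
  · intro y hy
    rw [Finset.mem_filter] at hy ⊢
    rw [act_mem_points, smul_apply_act, smul_apply_act]
    exact hy

theorem bs_pos (v : Vec n) {x : ℤ} (hx : x ∈ points n) : 0 < bs v x :=
  Finset.card_pos.2 ⟨x, Finset.mem_filter.2 ⟨hx, rfl⟩⟩

theorem bs_congr {v v' : Vec n} (hv : Normal v) (hv' : Normal v') (h : Zle v v') (h' : Zle v' v)
    {x : ℤ} (hx : x ∈ points n) : bs v x = bs v' x := by
  rw [bs, bs]
  congr 1
  refine Finset.filter_congr fun y hy => ?_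
  exact ⟨fun e => hv.apply_eq h hy hx e, fun e => hv'.apply_eq h' hy hx e⟩

/-- For a non-zero value, each `y` in `1, …, n` with the right absolute value contributes exactly
one of `y` and `-y`. So `bs` is the block size in the usual sense. -/
theorem bs_eq_card_abs {v : Vec n} {x : ℤ} (hx : v.1 x ≠ 0) :
    bs v x = ((Finset.Icc (1 : ℤ) n).filter fun y => |v.1 y| = |v.1 x|).card := by
  have habs : ∀ y, |v.1 (|y|)| = |v.1 y| := fun y => by
    rcases abs_choice y with h | h <;> rw [h]
    rw [vec_neg, abs_neg]
  refine Finset.card_bij (fun y _ => |y|) ?_ ?_ ?_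
  · intro y hy
    rw [Finset.mem_filter] at hy ⊢
    exact ⟨abs_mem_Icc hy.1, by rw [habs, hy.2]⟩
  · intro y hy z hz h
    rw [Finset.mem_filter] at hy hz
    rcases abs_eq_abs.1 h with rfl | rfl
    · rfl
    · have := hy.2
      rw [vec_neg, hz.2] at this
      omega
  · intro y hy
    rw [Finset.mem_filter] at hy
    have hyp := mem_points_of_Icc hy.1
    have hy1 := (Finset.mem_Icc.1 hy.1).1
    rcases abs_eq_abs.1 hy.2 with h | h
    · exact ⟨y, Finset.mem_filter.2 ⟨hyp, h⟩, abs_of_pos (by omega)⟩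
    · exact ⟨-y, Finset.mem_filter.2 ⟨neg_mem_points.2 hyp, by rw [vec_neg]; omega⟩,
        by rw [abs_neg]; exact abs_of_pos (by omega)⟩

/-! ### Merging `p` blocks of equal size -/

theorem eps_pow {τ : Equiv.Perm ℤ} (h : τ ∈ oddPerms n) (m : ℕ) : eps n (τ ^ m) = eps n τ ^ m := by
  induction m with
  | zero => rw [pow_zero, pow_zero, eps_one]
  | succ m ih => rw [pow_succ, pow_succ, eps_mul (pow_mem h m) h, ih]

/-- Merging `p` blocks of equal size into one block does not change the number of faces of a given
type modulo an odd prime `p`. -/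
theorem cnt_modEq_merge {p : ℕ} [hp : Fact p.Prime] (hp2 : p ≠ 2) {v v' : Vec n} {a : ZMod p → ℤ}
    (ha : Function.Injective fun t => |a t|) (ha0 : ∀ t, a t ≠ 0) {r : ℕ}
    (hcard : ∀ t, ((points n).filter fun x => v'.1 x = a t).card = r) {b : ℤ} (hb : b ≠ 0)
    (h1 : ∀ x ∈ points n, v.1 x = b ↔ ∃ t, v'.1 x = a t)
    (h3 : ∀ x ∈ points n, ∀ y ∈ points n, (∀ t, |v'.1 x| ≠ |a t|) → (∀ t, |v'.1 y| ≠ |a t|) →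
      (v.1 x = v.1 y ↔ v'.1 x = v'.1 y)) (J : Finset (Fin n)) :
    cnt J v ≡ cnt J v' [MOD p] := by
  classical
  have hE : ∀ t, ∃ E : Fin r → ℤ, Function.Injective E ∧
      (∀ k, E k ∈ points n ∧ v'.1 (E k) = a t) ∧ ∀ x ∈ points n, v'.1 x = a t → ∃ k, E k = x := by
    intro t
    let e := ((points n).filter fun x => v'.1 x = a t).equivFinOfCardEq (hcard t)
    refine ⟨fun k => (e.symm k).1, Subtype.val_injective.comp e.symm.injective, fun k => ?_,
      fun x hx hxa => ?_⟩
    · exact Finset.mem_filter.1 (e.symm k).2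
    · exact ⟨e ⟨x, Finset.mem_filter.2 ⟨hx, hxa⟩⟩, by simp⟩
  choose E hEinj hEv hEsurj using hE
  -- The points of the `p` blocks and of their negatives are labelled by block, position and sign.
  -- The permutation `σ` below adds one to the block label.
  let F₀ : ZMod p × Fin r × ℤˣ → ℤ := fun q => (q.2.2 : ℤ) * E q.1 q.2.1
  have hmulv : ∀ (w : Vec n) (s : ℤˣ) (x : ℤ), w.1 ((s : ℤ) * x) = s * w.1 x := by
    intro w s x
    rcases Int.units_eq_one_or s with rfl | rfl <;> simp [vec_neg]
  have hmulp : ∀ (s : ℤˣ) (x : ℤ), (s : ℤ) * x ∈ points n ↔ x ∈ points n := by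
    intro s x
    rcases Int.units_eq_one_or s with rfl | rfl
    · simp
    · simp only [Units.val_neg, Units.val_one, neg_mul, one_mul, neg_mem_points]
  have hss : ∀ s : ℤˣ, (s : ℤ) * s = 1 := fun s => by
    rcases Int.units_eq_one_or s with rfl | rfl <;> rfl
  have hFv : ∀ t k s, v'.1 (F₀ (t, k, s)) = s * a t := fun t k s => by
    simp only [F₀]; rw [hmulv, (hEv t k).2]
  have hFp : ∀ t k s, F₀ (t, k, s) ∈ points n := fun t k s => (hmulp _ _).2 (hEv t k).1
  have hFneg : ∀ t k s, F₀ (t, k, -s) = -F₀ (t, k, s) := fun t k s => by simp [F₀]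
  have hFvv : ∀ t k s, v.1 (F₀ (t, k, s)) = s * b := fun t k s => by
    simp only [F₀]; rw [hmulv, (h1 _ (hEv t k).1).2 ⟨t, (hEv t k).2⟩]
  have habs : ∀ s : ℤˣ, |(s : ℤ)| = 1 := fun s => by
    rcases Int.units_eq_one_or s with rfl | rfl <;> simp
  have hval : ∀ (s s' : ℤˣ) (t t' : ZMod p), (s : ℤ) * a t = s' * a t' → s = s' ∧ t = t' := by
    intro s s' t t' h
    have ht : t = t' := ha (by
      have := congrArg abs h
      rwa [abs_mul, abs_mul, habs, habs, one_mul, one_mul] at this)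
    subst ht
    exact ⟨Units.ext (mul_right_cancel₀ (ha0 t) h), rfl⟩
  have hFinj : Function.Injective F₀ := by
    rintro ⟨t, k, s⟩ ⟨t', k', s'⟩ h
    have := congrArg v'.1 h
    rw [hFv, hFv] at this
    obtain ⟨rfl, rfl⟩ := hval _ _ _ _ this
    simp only [F₀] at h
    have := hEinj t (mul_left_cancel₀ (Units.ne_zero s) h)
    rw [this]
  have hFsurj : ∀ x ∈ points n, ∀ (s : ℤˣ) t, v'.1 x = s * a t → ∃ k, F₀ (t, k, s) = x := by
    intro x hx s t h
    obtain ⟨k, hk⟩ := hEsurj t ((s : ℤ) * x) ((hmulp s x).2 hx) (by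
      rw [hmulv, h, ← mul_assoc, hss, one_mul])
    refine ⟨k, ?_⟩
    simp only [F₀]; rw [hk, ← mul_assoc, hss, one_mul]
  let F : ZMod p × Fin r × ℤˣ ↪ ℤ := ⟨F₀, hFinj⟩
  let rot : Equiv.Perm (ZMod p × Fin r × ℤˣ) := Equiv.prodCongr (Equiv.addRight 1) (Equiv.refl _)
  have hrot : ∀ m : ℕ, ∀ q, (rot ^ m) q = (q.1 + m, q.2) := by
    intro m
    induction m with
    | zero => intro q; simp
    | succ m ih =>
      intro q
      rw [pow_succ', Equiv.Perm.mul_apply, ih]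
      simp [rot, add_assoc]
  let σ : Equiv.Perm ℤ := Equiv.Perm.viaEmbeddingHom F rot
  have hσF : ∀ q, σ (F₀ q) = F₀ (q.1 + 1, q.2) := fun q =>
    Equiv.Perm.viaEmbedding_apply rot F q
  have hσn : ∀ x, x ∉ Set.range F₀ → σ x = x := fun x hx =>
    Equiv.Perm.viaEmbedding_apply_of_notMem rot F x hx
  have hσp : σ ^ p = 1 := by
    rw [← map_pow]
    have : rot ^ p = 1 := by
      ext1 q; rw [hrot]; simp
    rw [this, map_one]
  have hrange : ∀ x, x ∈ Set.range F₀ → x ∈ points n := by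
    rintro _ ⟨⟨t, k, s⟩, rfl⟩; exact hFp t k s
  have hσ : σ ∈ oddPerms n := by
    refine ⟨fun x => ?_, fun x hx => hσn x fun h => hx (hrange x h)⟩
    by_cases hx : x ∈ Set.range F₀
    · obtain ⟨⟨t, k, s⟩, rfl⟩ := hx
      rw [← hFneg, hσF, hσF, hFneg]
    · rw [hσn x hx, hσn (-x)]
      rintro ⟨⟨t, k, s⟩, h⟩
      exact hx ⟨(t, k, -s), by rw [hFneg, h, neg_neg]⟩
  have hpodd : Odd p := hp.out.odd_of_ne_two hp2
  -- From `σ ^ p = 1` the `p`-th power of the sign is `1`, and `p` is odd.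
  have heps : eps n σ = 1 := by
    have := eps_pow hσ p
    rw [hσp, eps_one] at this
    exact hpodd.strictMono_pow.injective (by rw [one_pow]; exact this.symm)
  obtain ⟨g, hg⟩ := exists_act_eq hσ heps
  have hgp : g ^ p = 1 := act_injective n (by rw [map_pow, hg, hσp, map_one])
  have hin : ∀ x ∈ points n, ∀ y ∈ points n, v'.1 x = v'.1 y → x ∈ Set.range F₀ →
      ∃ t k k' s, x = F₀ (t, k, s) ∧ y = F₀ (t, k', s) := by
    rintro x hx y hy e ⟨⟨t, k, s⟩, rfl⟩
    rw [hFv] at e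
    obtain ⟨k', hk'⟩ := hFsurj y hy s t e.symm
    exact ⟨t, k, k', s, rfl, hk'.symm⟩
  have hstep : ∀ x ∈ points n, ∀ y ∈ points n, v'.1 x = v'.1 y → v'.1 (σ x) = v'.1 (σ y) := by
    intro x hx y hy e
    by_cases hxr : x ∈ Set.range F₀
    · obtain ⟨t, k, k', s, rfl, rfl⟩ := hin x hx y hy e hxr
      rw [hσF, hσF, hFv, hFv]
    · by_cases hyr : y ∈ Set.range F₀
      · obtain ⟨t, k, k', s, rfl, rfl⟩ := hin y hy x hx e.symm hyr
        rw [hσF, hσF, hFv, hFv]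
      · rw [hσn x hxr, hσn y hyr, e]
  have hiter : ∀ m : ℕ, ∀ x ∈ points n, ∀ y ∈ points n, v'.1 x = v'.1 y →
      v'.1 ((σ ^ m) x) = v'.1 ((σ ^ m) y) := by
    intro m
    induction m with
    | zero => intro x _ y _ e; simpa using e
    | succ m ih =>
      intro x hx y hy e
      rw [pow_succ', Equiv.Perm.mul_apply, Equiv.Perm.mul_apply]
      exact hstep _ (oddPerms_mem (pow_mem hσ m) hx) _ (oddPerms_mem (pow_mem hσ m) hy)
        (ih x hx y hy e)
  have hginv : act n g⁻¹ = σ ^ (p - 1) := by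
    rw [map_inv, hg, inv_eq_iff_mul_eq_one, ← pow_succ', Nat.sub_add_cancel hp.out.one_le, hσp]
  have hnr : ∀ x ∈ points n, x ∉ Set.range F₀ → ∀ t, |v'.1 x| ≠ |a t| := by
    intro x hx hxr t e
    apply hxr
    rcases abs_eq_abs.1 e with h | h
    · obtain ⟨k, hk⟩ := hFsurj x hx 1 t (by simpa using h); exact ⟨_, hk⟩
    · obtain ⟨k, hk⟩ := hFsurj x hx (-1) t (by simpa using h); exact ⟨_, hk⟩
  refine cnt_modEq hgp ?_ ?_ ?_ J
  · intro x y hr e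
    by_cases hxr : x ∈ Set.range F₀
    · obtain ⟨t, k, k', s, rfl, rfl⟩ := hin x hr.1 y hr.2.1 e hxr
      rw [hFvv, hFvv]
    · by_cases hyr : y ∈ Set.range F₀
      · obtain ⟨t, k, k', s, rfl, rfl⟩ := hin y hr.2.1 x hr.1 e.symm hyr
        rw [hFvv, hFvv]
      · exact (h3 x hr.1 y hr.2.1 (hnr x hr.1 hxr) (hnr y hr.2.1 hyr)).2 e
  · intro u hu x y hr e
    have := hiter (p - 1) x hr.1 y hr.2.1 e
    rw [← hginv] at this
    exact hu _ _ (hr.act g⁻¹) this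
  · intro u hu
    constructor
    · intro hgu
      have hmove : ∀ x, u.1 (σ x) = u.1 x := fun x => by
        have := smul_apply_act g u x
        rwa [hgu, hg] at this
      have hmove' : ∀ m : ℕ, ∀ x, u.1 ((σ ^ m) x) = u.1 x := by
        intro m
        induction m with
        | zero => intro x; simp
        | succ m ih => intro x; rw [pow_succ', Equiv.Perm.mul_apply, hmove, ih]
      have hσm : ∀ (m : ℕ) q, (σ ^ m) (F₀ q) = F₀ (q.1 + m, q.2) := by
        intro m q
        have : (σ ^ m) (F₀ q) = F₀ ((rot ^ m) q) := by
          rw [← map_pow]; exact Equiv.Perm.viaEmbedding_apply (rot ^ m) F q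
        rw [this, hrot]
      have hkey : ∀ x y, Rt n x y → v.1 x = v.1 y → x ∈ Set.range F₀ → u.1 x = u.1 y := by
        rintro x y hr e ⟨⟨t, k, s⟩, rfl⟩
        rw [hFvv] at e
        obtain ⟨t', ht'⟩ := (h1 ((s : ℤ) * y) ((hmulp s y).2 hr.2.1)).1 (by
          rw [hmulv, ← e, ← mul_assoc, hss, one_mul])
        rw [hmulv] at ht'
        obtain ⟨k', rfl⟩ := hFsurj y hr.2.1 s t' (by rw [← ht', ← mul_assoc, hss, one_mul])
        -- Rotating by `t' - t` brings the first point into the block of the second one without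
        -- changing its `u`-coordinate; inside one block of `v'` the coordinates of `u` agree.
        have hm := hmove' (t' - t).val (F₀ (t, k, s))
        rw [hσm] at hm
        simp only [ZMod.natCast_val, ZMod.cast_id', id_eq, add_sub_cancel] at hm
        rw [← hm]
        refine hu _ _ ⟨hFp _ _ _, hFp _ _ _, fun h => ?_⟩ (by rw [hFv, hFv])
        have h2 := congrArg v'.1 (eq_neg_of_add_eq_zero_left h)
        rw [vec_neg, hFv, hFv] at h2
        have h3 : (s : ℤ) * a t' = 0 := by omega
        rcases mul_eq_zero.1 h3 with h4 | h4
        · exact Units.ne_zero s h4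
        · exact ha0 _ h4
      intro x y hr e
      by_cases hxr : x ∈ Set.range F₀
      · exact hkey x y hr e hxr
      · by_cases hyr : y ∈ Set.range F₀
        · exact (hkey y x hr.symm e.symm hyr).symm
        · exact hu x y hr ((h3 x hr.1 y hr.2.1 (hnr x hr.1 hxr) (hnr y hr.2.1 hyr)).1 e)
    · intro huv
      have hmove : ∀ x, u.1 (σ x) = u.1 x := by
        intro x
        by_cases hxr : x ∈ Set.range F₀
        · obtain ⟨⟨t, k, s⟩, rfl⟩ := hxr
          rw [hσF]
          refine huv _ _ ⟨hFp _ _ _, hFp _ _ _, fun h => ?_⟩ (by rw [hFvv, hFvv])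
          have h2 := congrArg v.1 (eq_neg_of_add_eq_zero_left h)
          rw [vec_neg, hFvv, hFvv] at h2
          have h3 : (s : ℤ) * b = 0 := by omega
          rcases mul_eq_zero.1 h3 with h4 | h4
          · exact Units.ne_zero s h4
          · exact hb h4
        · rw [hσn x hxr]
      apply Subtype.ext; funext x
      rw [smul_apply]
      have := hmove (act n g⁻¹ x)
      rw [← hg, act_act_inv] at this
      exact this.symm

end Merging

/-! ### Splitting to regular flats and merging to restricted flats. -/

section Splitting

variable {n : ℕ} [Fact (2 ≤ n)]

/-- The number of pairs of points with equal coordinates. -/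
noncomputable def coincidences (v : Vec n) : ℕ :=
  ((points n ×ˢ points n).filter fun q => v.1 q.1 = v.1 q.2).card

theorem coincidences_lt {v v' : Vec n}
    (h : ∀ x ∈ points n, ∀ y ∈ points n, v'.1 x = v'.1 y → v.1 x = v.1 y)
    {x y : ℤ} (hx : x ∈ points n) (hy : y ∈ points n) (h1 : v.1 x = v.1 y) (h2 : v'.1 x ≠ v'.1 y) :
    coincidences v' < coincidences v := by
  refine Finset.card_lt_card ((Finset.ssubset_iff_of_subset ?_).2 ⟨(x, y), ?_, ?_⟩)
  · intro q hq
    simp only [Finset.mem_filter, Finset.mem_product] at hq ⊢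
    exact ⟨hq.1, h _ hq.1.1 _ hq.1.2 hq.2⟩
  · simp only [Finset.mem_filter, Finset.mem_product]; exact ⟨⟨hx, hy⟩, h1⟩
  · simp only [Finset.mem_filter, Finset.mem_product]; exact fun h => h2 h.2

theorem coincidences_le (v : Vec n) : coincidences v ≤ (points n ×ˢ points n).card :=
  Finset.card_filter_le _ _

theorem Normal.of_zero_iff {v v' : Vec n} (hv : Normal v) (h : ∀ x, v'.1 x = 0 ↔ v.1 x = 0) :
    Normal v' := by
  intro x hx hx0
  obtain ⟨y, hy, h1, h2, h3⟩ := hv x hx ((h x).1 hx0)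
  exact ⟨y, hy, h1, h2, (h y).2 h3⟩

/-- The block of `x₀` is cut into `p` pieces of equal size; merging them again returns the flat of
`v`, so `cnt_modEq_merge` applies. -/
theorem exists_split_of_pos {p : ℕ} [hp : Fact p.Prime] (hp2 : p ≠ 2) {v : Vec n} (hN : Normal v)
    {x₀ : ℤ} (h0 : 0 < v.1 x₀) (hx₀ : x₀ ∈ points n) (hdvd : p ∣ bs v x₀) :
    ∃ v' : Vec n, Normal v' ∧ (∀ J, cnt J v ≡ cnt J v' [MOD p]) ∧
      coincidences v' < coincidences v := by
  classical
  set b := v.1 x₀ with hb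
  obtain ⟨r, hr⟩ := hdvd
  set B := (points n).filter fun x => v.1 x = b with hB
  have hcardB : Fintype.card B = Fintype.card (ZMod p × Fin r) := by
    rw [Fintype.card_coe, Fintype.card_prod, ZMod.card, Fintype.card_fin, ← hr]; rfl
  let e : B ≃ ZMod p × Fin r := Fintype.equivOfCardEq hcardB
  let τ : ℤ → ℤ := fun x => if h : x ∈ B then ((e ⟨x, h⟩).1.val : ℤ) else 0
  have hτB : ∀ {x}, x ∉ B → τ x = 0 := fun {x} h => dif_neg h
  have hτ0 : ∀ x, 0 ≤ τ x := fun x => by simp only [τ]; split_ifs <;> positivity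
  have hτp : ∀ x, τ x < p := fun x => by
    simp only [τ]; split_ifs
    · exact_mod_cast ZMod.val_lt _
    · exact_mod_cast hp.out.pos
  have hBmem : ∀ {x}, x ∈ B ↔ x ∈ points n ∧ v.1 x = b := fun {x} => Finset.mem_filter
  have hBneg : ∀ {x}, x ∈ B → -x ∉ B := fun {x} h h' => by
    have h1 := (hBmem.1 h).2
    have h2 := (hBmem.1 h').2
    rw [vec_neg] at h2; omega
  -- Scaling by `p` makes room for the new values `p * b, …, p * b + (p - 1)`, which no other block
  -- attains. The term `τ (-x)` makes the vector odd.
  let v' : Vec n := ⟨fun x => p * v.1 x + τ x - τ (-x), fun x => by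
    simp only [vec_neg, neg_neg]; ring, fun x hx => by
    simp only [vec_eq_zero v hx]
    rw [hτB fun h => hx (hBmem.1 h).1, hτB fun h => hx (neg_mem_points.1 (hBmem.1 h).1)]; ring⟩
  have hv' : ∀ x, v'.1 x = p * v.1 x + τ x - τ (-x) := fun _ => rfl
  have hppos : (0 : ℤ) < p := by exact_mod_cast hp.out.pos
  have hpb : 0 < p * b := mul_pos hppos h0
  have c1 : ∀ {x}, x ∈ B → v'.1 x = p * b + τ x := fun {x} h => by
    rw [hv', (hBmem.1 h).2, hτB (hBneg h)]; ring
  have c2 : ∀ {x}, -x ∈ B → v'.1 x = -(p * b + τ (-x)) := fun {x} h => by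
    rw [← neg_neg (v'.1 x), ← vec_neg, c1 h]
  have c3 : ∀ {x}, x ∉ B → -x ∉ B → v'.1 x = p * v.1 x := fun {x} h h' => by
    rw [hv', hτB h, hτB h']; ring
  let a : ZMod p → ℤ := fun t => p * b + t.val
  have haval : ∀ t, a t = p * b + t.val := fun _ => rfl
  have hapos : ∀ t, 0 < a t := fun t => by rw [haval]; positivity
  have hτe : ∀ q, τ (e.symm q).1 = q.1.val := fun q => by
    simp only [τ, dif_pos (e.symm q).2]; simp
  have hv'a : ∀ {x t}, x ∈ points n → (v'.1 x = a t ↔ x ∈ B ∧ τ x = t.val) := by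
    intro x t hx
    constructor
    · intro h
      rw [haval] at h
      by_cases h1 : x ∈ B
      · rw [c1 h1] at h; exact ⟨h1, by omega⟩
      · by_cases h2 : -x ∈ B
        · rw [c2 h2] at h
          have := hτ0 (-x)
          omega
        · rw [c3 h1 h2] at h
          have ht : (t.val : ℤ) < p := by exact_mod_cast ZMod.val_lt t
          have h3 : (p : ℤ) * (v.1 x - b) = t.val := by rw [mul_sub]; omega
          have h4 : v.1 x = b := by
            by_contra hne
            rcases lt_or_gt_of_ne hne with h5 | h5
            · have : (p : ℤ) * (v.1 x - b) < 0 := mul_neg_of_pos_of_neg hppos (by omega)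
              omega
            · have : (p : ℤ) * 1 ≤ p * (v.1 x - b) := mul_le_mul_of_nonneg_left (by omega) hppos.le
              omega
          exact absurd (hBmem.2 ⟨hx, h4⟩) h1
    · rintro ⟨h1, h2⟩
      rw [c1 h1, h2]
  have hvb : ∀ x ∈ points n, v.1 x = b ↔ ∃ t, v'.1 x = a t := by
    intro x hx
    constructor
    · intro h
      have hxB := hBmem.2 ⟨hx, h⟩
      refine ⟨(e ⟨x, hxB⟩).1, (hv'a hx).2 ⟨hxB, ?_⟩⟩
      simp only [τ, dif_pos hxB]
    · rintro ⟨t, h⟩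
      exact (hBmem.1 ((hv'a hx).1 h).1).2
  have hout : ∀ x ∈ points n, (∀ t, |v'.1 x| ≠ |a t|) → v'.1 x = p * v.1 x := by
    intro x hx h
    refine c3 (fun h1 => ?_) (fun h1 => ?_)
    · obtain ⟨t, ht⟩ := (hvb x hx).1 (hBmem.1 h1).2
      exact h t (by rw [ht])
    · obtain ⟨t, ht⟩ := (hvb _ (hBmem.1 h1).1).1 (hBmem.1 h1).2
      exact h t (by rw [← ht, vec_neg, abs_neg])
  have hzero : ∀ x, v'.1 x = 0 ↔ v.1 x = 0 := by
    intro x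
    by_cases h1 : x ∈ B
    · have := hτ0 x
      have h2 := (hBmem.1 h1).2
      rw [c1 h1]; omega
    · by_cases h2 : -x ∈ B
      · have := hτ0 (-x)
        have h3 := (hBmem.1 h2).2
        rw [vec_neg] at h3
        rw [c2 h2]; omega
      · rw [c3 h1 h2, mul_eq_zero]
        exact or_iff_right hppos.ne'
  have hr0 : 0 < r := by
    have := bs_pos v hx₀
    rw [hr] at this
    exact Nat.pos_of_mul_pos_left this
  refine ⟨v', hN.of_zero_iff hzero, cnt_modEq_merge hp2 (a := a) ?_ (fun t => (hapos t).ne')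
    (r := r) (fun t => ?_) h0.ne' hvb ?_, ?_⟩
  · intro t t' h
    have h2 : |a t| = |a t'| := h
    rw [abs_of_pos (hapos t), abs_of_pos (hapos t'), haval, haval] at h2
    exact ZMod.val_injective p (by exact_mod_cast add_left_cancel h2)
  · rw [← Fintype.card_fin r, ← Finset.card_univ]
    symm
    refine Finset.card_bij (fun k _ => (e.symm (t, k)).1) ?_ ?_ ?_
    · intro k _
      have hm := (e.symm (t, k)).2
      rw [Finset.mem_filter]
      exact ⟨(hBmem.1 hm).1, (hv'a (hBmem.1 hm).1).2 ⟨hm, hτe _⟩⟩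
    · intro k _ k' _ h
      have := e.symm.injective (Subtype.ext h)
      exact (Prod.ext_iff.1 this).2
    · intro x hx
      rw [Finset.mem_filter] at hx
      obtain ⟨h1, h2⟩ := (hv'a hx.1).1 hx.2
      simp only [τ, dif_pos h1, Nat.cast_inj] at h2
      refine ⟨(e ⟨x, h1⟩).2, Finset.mem_univ _, ?_⟩
      rw [← ZMod.val_injective p h2]; simp
  · intro x hx y hy h1 h2
    rw [hout x hx h1, hout y hy h2, mul_right_inj' hppos.ne']
  · have hne : ((0 : ZMod p), (⟨0, hr0⟩ : Fin r)).1.val ≠ ((1 : ZMod p), (⟨0, hr0⟩ : Fin r)).1.val :=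
      fun h => zero_ne_one (ZMod.val_injective p h)
    set q0 : ZMod p × Fin r := (0, ⟨0, hr0⟩)
    set q1 : ZMod p × Fin r := (1, ⟨0, hr0⟩)
    have m0 := (e.symm q0).2
    have m1 := (e.symm q1).2
    refine coincidences_lt ?_ (hBmem.1 m0).1 (hBmem.1 m1).1
      (by rw [(hBmem.1 m0).2, (hBmem.1 m1).2]) ?_
    · have key : ∀ x ∈ points n, ∀ y ∈ points n, v'.1 x = v'.1 y → v.1 x = b → v.1 y = b := by
        intro x hx y hy h h1
        obtain ⟨t, ht⟩ := (hvb x hx).1 h1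
        exact (hvb y hy).2 ⟨t, h ▸ ht⟩
      have key' : ∀ x ∈ points n, ∀ y ∈ points n, v'.1 x = v'.1 y → v.1 x = -b → v.1 y = -b := by
        intro x hx y hy h h1
        have := key (-x) (neg_mem_points.2 hx) (-y) (neg_mem_points.2 hy)
          (by rw [vec_neg, vec_neg, h]) (by rw [vec_neg]; omega)
        rw [vec_neg] at this; omega
      intro x hx y hy h
      by_cases h1 : v.1 x = b
      · rw [h1, key x hx y hy h h1]
      by_cases h2 : v.1 x = -b
      · rw [h2, key' x hx y hy h h2]
      have h3 : v.1 y ≠ b := fun h' => h1 (key y hy x hx h.symm h')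
      have h4 : v.1 y ≠ -b := fun h' => h2 (key' y hy x hx h.symm h')
      have hnB : ∀ z, v.1 z ≠ b → v.1 z ≠ -b → v'.1 z = p * v.1 z := fun z hz hz' =>
        c3 (fun h' => hz (hBmem.1 h').2) (fun h' => hz' (by
          have := (hBmem.1 h').2; rw [vec_neg] at this; omega))
      rw [hnB x h1 h2, hnB y h3 h4] at h
      exact mul_left_cancel₀ hppos.ne' h
    · rw [c1 m0, c1 m1, hτe, hτe]
      intro h
      exact hne (by exact_mod_cast add_left_cancel h)

/-- Every flat can be refined to one without block sizes divisible by `p`, with the same numbers of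
faces modulo `p`. -/
theorem exists_regular {p : ℕ} [hp : Fact p.Prime] (hp2 : p ≠ 2) {v : Vec n} (hN : Normal v) :
    ∃ v' : Vec n, Normal v' ∧ (∀ J, cnt J v ≡ cnt J v' [MOD p]) ∧
      ∀ x ∈ points n, v'.1 x ≠ 0 → ¬ p ∣ bs v' x := by
  induction hk : coincidences v using Nat.strong_induction_on generalizing v with
  | _ k ih =>
    by_cases h : ∀ x ∈ points n, v.1 x ≠ 0 → ¬ p ∣ bs v x
    · exact ⟨v, hN, fun _ => rfl, h⟩
    push Not at h
    obtain ⟨x, hx, h0, hdvd⟩ := h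
    obtain ⟨v₁, hN₁, hc₁, hlt⟩ : ∃ v' : Vec n, Normal v' ∧ (∀ J, cnt J v ≡ cnt J v' [MOD p]) ∧
        coincidences v' < coincidences v := by
      rcases lt_or_gt_of_ne h0 with h1 | h1
      · exact exists_split_of_pos hp2 hN (x₀ := -x) (by rw [vec_neg]; omega) (neg_mem_points.2 hx)
          (by rwa [bs_neg])
      · exact exists_split_of_pos hp2 hN h1 hx hdvd
    obtain ⟨v₂, hN₂, hc₂, hreg⟩ := ih _ (by omega) hN₁ rfl
    exact ⟨v₂, hN₂, fun J => (hc₁ J).trans (hc₂ J), hreg⟩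

/-- Fewer than `p` blocks of each size. -/
def Restricted (p : ℕ) (v : Vec n) : Prop := ∀ x ∈ points n, v.1 x ≠ 0 →
  (((points n).filter fun y => v.1 y ≠ 0 ∧ bs v y = bs v x).image fun y => |v.1 y|).card < p

/-- Failure of `Restricted` supplies `p` blocks of one size, and all of them receive the value `a
0`. The new size is `p` times the old one, so its `p`-free part is unchanged and even sizes stay
even. The growing number of coincidences ensures termination of repeated merging. -/
theorem exists_merge {p : ℕ} [hp : Fact p.Prime] (hp2 : p ≠ 2) {v : Vec n} (hN : Normal v)
    (hR : ¬ Restricted p v) :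
    ∃ v' : Vec n, Normal v' ∧ (∀ J, cnt J v ≡ cnt J v' [MOD p]) ∧
      coincidences v < coincidences v' ∧ (∀ x, (v'.1 x).sign = (v.1 x).sign) ∧
      ∀ x ∈ points n, v.1 x ≠ 0 → ordCompl[p] (bs v' x) = ordCompl[p] (bs v x) ∧
        (Even (bs v x) → Even (bs v' x)) := by
  classical
  simp only [Restricted, not_forall, not_lt] at hR
  obtain ⟨x₀, hx₀, h0, hle⟩ := hR
  obtain ⟨S, hS, hScard⟩ := Finset.exists_subset_card_eq hle
  let e : ZMod p ≃ S := Fintype.equivOfCardEq (by rw [ZMod.card, Fintype.card_coe, hScard])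
  let a : ZMod p → ℤ := fun t => (e t).1
  have hainj : Function.Injective a := Subtype.val_injective.comp e.injective
  have haex : ∀ t, ∃ y ∈ points n, v.1 y = a t ∧ bs v y = bs v x₀ ∧ 0 < a t := by
    intro t
    obtain ⟨y, hy, hya⟩ := Finset.mem_image.1 (hS (e t).2)
    rw [Finset.mem_filter] at hy
    have hpos : 0 < a t := by
      change 0 < (e t).1; rw [← hya]; exact abs_pos.2 hy.2.1
    rcases abs_choice (v.1 y) with h | h
    · exact ⟨y, hy.1, by rw [← h, hya], hy.2.2, hpos⟩
    · exact ⟨-y, neg_mem_points.2 hy.1, by rw [vec_neg, ← h, hya], by rw [bs_neg, hy.2.2], hpos⟩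
  have hapos : ∀ t, 0 < a t := fun t => by obtain ⟨_, _, _, _, h⟩ := haex t; exact h
  have hcard : ∀ t, ((points n).filter fun x => v.1 x = a t).card = bs v x₀ := by
    intro t
    obtain ⟨y, hy, h1, h2, -⟩ := haex t
    rw [← h2, bs, h1]
  have hnot : ∀ {x t t'}, v.1 x = a t → v.1 x ≠ -a t' := fun {x t t'} h h' => by
    have := hapos t
    have := hapos t'
    omega
  let v' : Vec n := ⟨fun x => if ∃ t, v.1 x = a t then a 0 else if ∃ t, v.1 x = -a t then -a 0
      else v.1 x, fun x => by
    have e1 : ∀ t, (v.1 (-x) = a t ↔ v.1 x = -a t) := fun t => by rw [vec_neg]; omega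
    have e2 : ∀ t, (v.1 (-x) = -a t ↔ v.1 x = a t) := fun t => by rw [vec_neg]; omega
    simp only [e1, e2]
    by_cases h1 : ∃ t, v.1 x = a t
    · rw [if_pos h1]
      obtain ⟨t, ht⟩ := h1
      rw [if_neg fun ⟨t', ht'⟩ => hnot ht ht', if_pos ⟨t, ht⟩]
    · rw [if_neg h1, if_neg h1]
      split_ifs
      · rw [neg_neg]
      · rw [vec_neg], fun x hx => by
    have hx0 := vec_eq_zero v hx
    change (if ∃ t, v.1 x = a t then a 0 else if ∃ t, v.1 x = -a t then -a 0 else v.1 x) = 0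
    rw [if_neg fun ⟨t, ht⟩ => by have := hapos t; omega,
      if_neg fun ⟨t, ht⟩ => by have := hapos t; omega, hx0]⟩
  have d1 : ∀ {x}, (∃ t, v.1 x = a t) → v'.1 x = a 0 := fun {x} h => if_pos h
  have d2 : ∀ {x}, (∃ t, v.1 x = -a t) → v'.1 x = -a 0 := fun {x} h => by
    obtain ⟨t, ht⟩ := h
    exact (if_neg fun ⟨t', ht'⟩ => hnot ht' ht).trans (if_pos ⟨t, ht⟩)
  have d3 : ∀ {x}, (¬ ∃ t, v.1 x = a t) → (¬ ∃ t, v.1 x = -a t) → v'.1 x = v.1 x :=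
    fun {x} h h' => (if_neg h).trans (if_neg h')
  have hva : ∀ x, v'.1 x = a 0 ↔ ∃ t, v.1 x = a t := by
    intro x
    refine ⟨fun h => ?_, d1⟩
    by_contra h1
    by_cases h2 : ∃ t, v.1 x = -a t
    · rw [d2 h2] at h; have := hapos 0; omega
    · rw [d3 h1 h2] at h; exact h1 ⟨0, h⟩
  have hva' : ∀ x, v'.1 x = -a 0 ↔ ∃ t, v.1 x = -a t := by
    intro x
    have := hva (-x)
    rw [vec_neg, vec_neg, neg_eq_iff_eq_neg] at this
    simpa only [neg_eq_iff_eq_neg] using this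
  have hsign : ∀ x, (v'.1 x).sign = (v.1 x).sign := by
    intro x
    by_cases h1 : ∃ t, v.1 x = a t
    · rw [d1 h1]
      obtain ⟨t, ht⟩ := h1
      rw [ht, Int.sign_eq_one_of_pos (hapos _), Int.sign_eq_one_of_pos (hapos _)]
    · by_cases h2 : ∃ t, v.1 x = -a t
      · rw [d2 h2]
        obtain ⟨t, ht⟩ := h2
        rw [ht, Int.sign_neg, Int.sign_neg, Int.sign_eq_one_of_pos (hapos _),
          Int.sign_eq_one_of_pos (hapos _)]
      · rw [d3 h1 h2]
  have hzero : ∀ x, v'.1 x = 0 ↔ v.1 x = 0 := fun x => by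
    rw [← Int.sign_eq_zero_iff_zero, hsign, Int.sign_eq_zero_iff_zero]
  have hbs1 : ∀ x, (∃ t, v.1 x = a t) → bs v' x = p * bs v x₀ ∧ bs v x = bs v x₀ := by
    intro x h
    constructor
    · rw [bs, d1 h]
      have : (points n).filter (fun y => v'.1 y = a 0) =
          Finset.univ.biUnion fun t => (points n).filter fun y => v.1 y = a t := by
        ext y
        simp only [Finset.mem_filter, Finset.mem_biUnion, Finset.mem_univ, true_and, hva]
        exact ⟨fun ⟨h1, t, ht⟩ => ⟨t, h1, ht⟩, fun ⟨t, h1, ht⟩ => ⟨h1, t, ht⟩⟩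
      rw [this, Finset.card_biUnion, Finset.sum_congr rfl fun t _ => hcard t, Finset.sum_const,
        Finset.card_univ, ZMod.card, smul_eq_mul]
      intro t _ t' _ hne
      change Disjoint _ _
      rw [Finset.disjoint_left]
      intro y hy hy'
      rw [Finset.mem_filter] at hy hy'
      exact hne (hainj (hy.2.symm.trans hy'.2))
    · obtain ⟨t, ht⟩ := h
      rw [bs, ht, hcard]
  have hordp : ordCompl[p] (p * bs v x₀) = ordCompl[p] (bs v x₀) := by
    have := Nat.ordCompl_self_pow_mul (bs v x₀) 1 hp.out
    rwa [pow_one] at this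
  refine ⟨v', hN.of_zero_iff hzero, fun J => (cnt_modEq_merge hp2 (v := v') (v' := v) (a := a) ?_
    (fun t => (hapos t).ne') hcard (hapos 0).ne' (fun x _ => hva x) ?_ J).symm, ?_, hsign, ?_⟩
  · intro t t' h
    simp only [abs_of_pos (hapos _)] at h
    exact hainj h
  · intro x _ y _ h1 h2
    have key : ∀ x, (∀ t, |v.1 x| ≠ |a t|) → v'.1 x = v.1 x := fun x h =>
      d3 (fun ⟨t, ht⟩ => h t (by rw [ht])) (fun ⟨t, ht⟩ => h t (by rw [ht, abs_neg]))
    rw [key x h1, key y h2]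
  · obtain ⟨y0, hy0, e0, -, -⟩ := haex 0
    obtain ⟨y1, hy1, e1, -, -⟩ := haex 1
    refine coincidences_lt ?_ hy0 hy1 (by rw [d1 ⟨0, e0⟩, d1 ⟨1, e1⟩]) ?_
    · intro x _ y _ h
      change (if _ then _ else _) = (if _ then _ else _)
      rw [h]
    · rw [e0, e1]
      exact fun h => zero_ne_one (hainj h)
  · intro x hx hx0
    by_cases h1 : ∃ t, v.1 x = a t
    · obtain ⟨h2, h3⟩ := hbs1 x h1
      rw [h2, h3]
      exact ⟨hordp, fun h => h.mul_left p⟩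
    by_cases h1' : ∃ t, v.1 x = -a t
    · have h4 : ∃ t, v.1 (-x) = a t := by
        obtain ⟨t, ht⟩ := h1'
        exact ⟨t, by rw [vec_neg, ht, neg_neg]⟩
      obtain ⟨h2, h3⟩ := hbs1 (-x) h4
      rw [bs_neg] at h2 h3
      rw [h2, h3]
      exact ⟨hordp, fun h => h.mul_left p⟩
    · have : bs v' x = bs v x := by
        rw [bs, bs]
        congr 1
        refine Finset.filter_congr fun y _ => ?_
        rw [d3 h1 h1']
        constructor
        · intro h
          by_cases g1 : ∃ t, v.1 y = a t
          · rw [d1 g1] at h; exact absurd ⟨0, h.symm⟩ h1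
          by_cases g2 : ∃ t, v.1 y = -a t
          · rw [d2 g2] at h; exact absurd ⟨0, h.symm⟩ h1'
          rwa [d3 g1 g2] at h
        · intro h
          rw [d3 (by rwa [h]) (by rwa [h]), h]
      rw [this]
      exact ⟨rfl, id⟩

/-- Merging blocks until there are fewer than `p` blocks of each size. -/
theorem exists_restricted {p : ℕ} [hp : Fact p.Prime] (hp2 : p ≠ 2) {v : Vec n} (hN : Normal v) :
    ∃ v' : Vec n, Normal v' ∧ (∀ J, cnt J v ≡ cnt J v' [MOD p]) ∧ Restricted p v' ∧
      (∀ x, (v'.1 x).sign = (v.1 x).sign) ∧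
      ∀ x ∈ points n, v.1 x ≠ 0 → ordCompl[p] (bs v' x) = ordCompl[p] (bs v x) ∧
        (Even (bs v x) → Even (bs v' x)) := by
  induction hk : (points n ×ˢ points n).card - coincidences v using Nat.strong_induction_on
    generalizing v with
  | _ k ih =>
    by_cases h : Restricted p v
    · exact ⟨v, hN, fun _ => rfl, h, fun _ => rfl, fun _ _ _ => ⟨rfl, id⟩⟩
    obtain ⟨v₁, hN₁, hc₁, hlt, hs₁, ho₁⟩ := exists_merge hp2 hN h
    have hle := coincidences_le v₁
    obtain ⟨v₂, hN₂, hc₂, hR, hs₂, ho₂⟩ := ih _ (by omega) hN₁ rfl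
    refine ⟨v₂, hN₂, fun J => (hc₁ J).trans (hc₂ J), hR, fun x => (hs₂ x).trans (hs₁ x),
      fun x hx h0 => ?_⟩
    have h1 : v₁.1 x ≠ 0 := by
      rw [Ne, ← Int.sign_eq_zero_iff_zero, hs₁, Int.sign_eq_zero_iff_zero]
      exact h0
    have h2 := ho₁ x hx h0
    have h3 := ho₂ x hx h1
    exact ⟨h3.1.trans h2.1, fun h => h3.2 (h2.2 h)⟩

end Splitting

/-! ### Stabilizers of flats and invariants of columns. -/

section Separation

variable {n : ℕ} [Fact (2 ≤ n)]

/-- The stabilizer of the flat spanned by the face of a vector. -/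
def flatStabilizer (v : Vec n) : Subgroup (D n) where
  carrier := {h | Zle v (h • v)}
  one_mem' := by
    change Zle v ((1 : D n) • v)
    rw [one_smul]; exact Zle.refl v
  mul_mem' := by
    intro a b (ha : Zle v (a • v)) (hb : Zle v (b • v))
    change Zle v ((a * b) • v)
    rw [mul_smul]
    exact ha.trans (hb.smul a)
  inv_mem' := by
    intro a (ha : Zle v (a • v))
    have key : ∀ m : ℕ, Zle v (a ^ m • v) := by
      intro m
      induction m with
      | zero => rw [pow_zero, one_smul]; exact Zle.refl v
      | succ m ih => rw [pow_succ', mul_smul]; exact ha.trans (ih.smul a)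
    -- Membership asks for one inclusion only; finiteness of the order supplies the inverse.
    have hinv : a⁻¹ = a ^ (orderOf a - 1) := by
      rw [inv_eq_iff_mul_eq_one, ← pow_succ', Nat.sub_add_cancel (orderOf_pos a), pow_orderOf_eq_one]
    change Zle v (a⁻¹ • v)
    rw [hinv]
    exact key _

theorem mem_flatStabilizer {v : Vec n} {h : D n} : h ∈ flatStabilizer v ↔ Zle v (h • v) := Iff.rfl

theorem zle_of_mem_flatStabilizer {v : Vec n} {h : D n} (hh : h ∈ flatStabilizer v) :
    Zle (h • v) v := by
  have := (mem_flatStabilizer.1 (inv_mem hh)).smul h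
  rwa [smul_inv_smul] at this

/-- The element permutes the values of `v`, in cycles of `p`-power length. A moved value would give
at least `p` blocks of the same size, against the restriction. -/
theorem smul_eq_self_of_restricted {p : ℕ} (hp : p.Prime) (hp2 : p ≠ 2) {v : Vec n} (hN : Normal v)
    (hR : Restricted p v) {h : D n} (hh : h ∈ flatStabilizer v) {k : ℕ} (hk : h ^ p ^ k = 1) :
    h • v = v := by
  classical
  refine vec_ext fun x hx => ?_
  by_contra hne
  let f : ℕ → ℤ → ℤ := fun i y => act n (h ^ i)⁻¹ y
  have hfv : ∀ i y, v.1 (f i y) = (h ^ i • v).1 y := fun _ _ => rfl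
  have hfmem : ∀ {y} i, y ∈ points n → f i y ∈ points n := fun i hy => (act_mem_points _).2 hy
  have hfadd : ∀ i j y, f i (f j y) = f (i + j) y := fun i j y => by
    simp only [f]
    rw [← Equiv.Perm.mul_apply, ← map_mul, ← mul_inv_rev, ← pow_add, add_comm]
  -- Since `h` preserves the flat, the value of `v` at the moved point depends only on the value at
  -- the point. So `h` induces a map `π` on values.
  have hex : ∀ c : ℤ, ∃ d : ℤ, ∀ y ∈ points n, v.1 y = c → v.1 (f 1 y) = d := by
    intro c
    by_cases hc : ∃ y ∈ points n, v.1 y = c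
    · obtain ⟨y, hy, hyc⟩ := hc
      refine ⟨v.1 (f 1 y), fun z hz hzc => ?_⟩
      rw [hfv, hfv, pow_one]
      exact hN.apply_eq hh hz hy (hzc.trans hyc.symm)
    · exact ⟨0, fun y hy hyc => absurd ⟨y, hy, hyc⟩ hc⟩
  choose π hπ using hex
  have hπ1 : ∀ y ∈ points n, π (v.1 y) = v.1 (f 1 y) := fun y hy => (hπ _ y hy rfl).symm
  have hπi : ∀ i, ∀ y ∈ points n, π^[i] (v.1 y) = v.1 (f i y) := by
    intro i
    induction i with
    | zero => intro y _; rw [hfv, pow_zero, one_smul]; rfl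
    | succ i ih =>
      intro y hy
      rw [Function.iterate_succ_apply', ih y hy, hπ1 _ (hfmem i hy), hfadd, add_comm]
  have hx0 : v.1 x ≠ 0 := fun h0 => hne ((hN.apply_eq_zero hh h0).trans h0.symm)
  have hxi0 : ∀ i, v.1 (f i x) ≠ 0 := fun i h0 => hx0
    ((hN.smul (h ^ i)).apply_eq_zero (zle_of_mem_flatStabilizer (pow_mem hh i)) h0)
  have hbs : ∀ i, bs v (f i x) = bs v x := fun i => by
    have h1 := bs_smul (h ^ i) v (f i x)
    rw [show act n (h ^ i) (f i x) = x from act_act_inv _ _] at h1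
    rw [← h1]
    exact (bs_congr hN (hN.smul _) (pow_mem hh i) (zle_of_mem_flatStabilizer (pow_mem hh i)) hx).symm
  have hper : ∀ y ∈ points n, Function.IsPeriodicPt π (p ^ k) (v.1 y) := fun y hy => by
    change π^[p ^ k] (v.1 y) = v.1 y
    rw [hπi _ y hy, hfv, hk, one_smul]
  set d := Function.minimalPeriod π (v.1 x) with hd
  have hpd : p ∣ d := by
    obtain ⟨j, -, hj⟩ := (Nat.dvd_prime_pow hp).1 (hper x hx).minimalPeriod_dvd
    rcases Nat.eq_zero_or_pos j with rfl | hj0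
    · rw [pow_zero] at hj
      have h1 := Function.iterate_minimalPeriod (f := π) (x := v.1 x)
      rw [hj, hπi _ x hx, hfv, pow_one] at h1
      exact absurd h1 hne
    · exact hd ▸ hj ▸ dvd_pow_self p hj0.ne'
  have hxper : v.1 x ∈ Function.periodicPts π := ⟨p ^ k, pow_pos hp.pos k, hper x hx⟩
  have hd0 : 0 < d := Function.minimalPeriod_pos_of_mem_periodicPts hxper
  have hple : p ≤ d := Nat.le_of_dvd hd0 hpd
  have habs : ∀ i j, i < j → j < p → |v.1 (f i x)| ≠ |v.1 (f j x)| := by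
    intro i j hij hj he
    rcases abs_eq_abs.1 he with h1 | h1
    · rw [← hπi i x hx, ← hπi j x hx] at h1
      exact hij.ne (Function.iterate_injOn_Iio_minimalPeriod (show i < _ by omega)
        (show j < _ by omega) h1)
    -- If two values in the cycle are opposite, moving on by `j - i` twice returns to the start.
    -- Then `p` divides `2 * (j - i)`, which is impossible for odd `p` and `0 < j - i < p`.
    · have e1 : f (j - i) (f i x) = f j x := by rw [hfadd]; congr 1; omega
      have h2 : Function.IsPeriodicPt π ((j - i) + (j - i)) (v.1 (f i x)) := by
        change π^[_] _ = _
        rw [Function.iterate_add_apply, hπi _ _ (hfmem i hx), e1,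
          show v.1 (f j x) = v.1 (-f i x) by rw [vec_neg]; omega,
          hπi _ _ (neg_mem_points.2 (hfmem i hx)),
          show f (j - i) (-f i x) = -f j x by rw [← e1]; exact act_neg (two_le n) _ _, vec_neg]
        omega
      have h3 := h2.minimalPeriod_dvd
      rw [← hπi i x hx, Function.minimalPeriod_apply_iterate hxper, ← hd] at h3
      have h4 := hpd.trans h3
      rw [← two_mul] at h4
      rcases hp.dvd_mul.1 h4 with h5 | h5
      · exact hp2 ((Nat.prime_dvd_prime_iff_eq hp Nat.prime_two).1 h5)
      · have := Nat.le_of_dvd (by omega) h5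
        omega
  have hle := Finset.card_le_card_of_injOn (s := Finset.range p)
    (t := ((points n).filter fun y => v.1 y ≠ 0 ∧ bs v y = bs v x).image fun y => |v.1 y|)
    (fun i => |v.1 (f i x)|)
    (fun i _ => Finset.mem_coe.2 (Finset.mem_image.2 ⟨f i x, Finset.mem_filter.2
      ⟨hfmem i hx, hxi0 i, hbs i⟩, rfl⟩))
    (fun i hi j hj he => by
      have hi := Finset.mem_range.1 hi
      have hj := Finset.mem_range.1 hj
      rcases lt_trichotomy i j with h1 | h1 | h1
      · exact absurd he (habs i j h1 hj)
      · exact h1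
      · exact absurd he.symm (habs j i h1 hi))
  rw [Finset.card_range] at hle
  exact absurd (hR x hx hx0) (by omega)

/-- The faces in the flat of `v` that have the same type as `v` form one orbit of the stabilizer of
the flat: an element that moves the face of `v` into the flat preserves the flat. -/
theorem cnt_eq_index {v : Vec n} {K : Finset (Fin n)} {g : D n} (hv : SameFace v (g • wt K)) :
    cnt K v = (MulAction.stabilizer (flatStabilizer v) (g • wt K)).index := by
  rw [MulAction.index_stabilizer, cnt, ← Set.ncard_coe_finset]
  congr 1
  ext u
  simp only [Finset.coe_filter, Set.mem_ofPred_eq, MulAction.mem_orbit_iff, mem_orb]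
  constructor
  · rintro ⟨⟨h, rfl⟩, hz⟩
    have e : (h * g⁻¹) • g • wt K = h • wt K := by rw [← mul_smul]; group
    refine ⟨⟨h * g⁻¹, ?_⟩, e⟩
    rw [mem_flatStabilizer]
    refine hz.trans ?_
    rw [← e]
    exact (hv.smul _).symm.zle
  · rintro ⟨⟨h, hh⟩, rfl⟩
    exact ⟨⟨h * g, mul_smul _ _ _⟩, (mem_flatStabilizer.1 hh).trans (hv.smul h).zle⟩

/-- A Sylow `p`-subgroup of the stabilizer of the flat fixes `v`, hence lies in the stabilizer of
its face. The index of the latter divides the index of the Sylow subgroup, which is prime to `p`. -/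
theorem not_dvd_cnt {p : ℕ} [hp : Fact p.Prime] (hp2 : p ≠ 2) {v : Vec n} (hN : Normal v)
    (hR : Restricted p v) {K : Finset (Fin n)} {g : D n} (hv : SameFace v (g • wt K)) :
    ¬ p ∣ cnt K v := by
  obtain ⟨P⟩ : Nonempty (Sylow p (flatStabilizer v)) := inferInstance
  have hle : (P : Subgroup (flatStabilizer v)) ≤
      MulAction.stabilizer (flatStabilizer v) (g • wt K) := by
    intro h hh
    obtain ⟨k, hk⟩ := P.isPGroup' ⟨h, hh⟩
    have hk' : (h : D n) ^ p ^ k = 1 := congrArg (fun x => ((x : flatStabilizer v) : D n))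
      (congrArg Subtype.val hk)
    have h1 := smul_eq_self_of_restricted hp.out hp2 hN hR h.2 hk'
    rw [MulAction.mem_stabilizer_iff]
    have h2 := hv.smul (h : D n)
    rw [h1, ← mul_smul] at h2
    have h3 := (sameFace_wt_unique (hv.symm.trans h2)).2
    rw [mul_smul] at h3
    exact h3.symm
  intro hdvd
  rw [cnt_eq_index hv] at hdvd
  exact P.not_dvd_index (hdvd.trans (Subgroup.index_dvd_of_le hle))

theorem cnt_self_pos {v : Vec n} {K : Finset (Fin n)} {g : D n} (hv : SameFace v (g • wt K)) :
    cnt K v ≠ 0 := by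
  classical
  exact (Finset.card_pos.2 ⟨g • wt K, Finset.mem_filter.2 ⟨mem_orb.2 ⟨g, rfl⟩, hv.zle⟩⟩).ne'

theorem exists_zle_smul {v v' : Vec n} {K : Finset (Fin n)} {g : D n} (hv : SameFace v (g • wt K))
    (h : cnt K v' ≠ 0) : ∃ h : D n, Zle v' (h • v) := by
  classical
  obtain ⟨u, hu⟩ := Finset.card_pos.1 (Nat.pos_of_ne_zero h)
  rw [Finset.mem_filter, mem_orb] at hu
  obtain ⟨⟨a, rfl⟩, hz⟩ := hu
  refine ⟨a * g⁻¹, hz.trans ?_⟩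
  have := (hv.smul (a * g⁻¹)).symm.zle
  rwa [← mul_smul, inv_mul_cancel_right] at this

/-- Flats with the same numbers of faces are conjugate, if they have enough faces. -/
theorem exists_zle_smul_and {F : Type*} [Field F] {v v' : Vec n}
    (h : ∀ J, (cnt J v : F) = cnt J v')
    (hv : ∀ K (g : D n), SameFace v (g • wt K) → (cnt K v : F) ≠ 0)
    (hv' : ∀ K (g : D n), SameFace v' (g • wt K) → (cnt K v' : F) ≠ 0) :
    ∃ a : D n, Zle v' (a • v) ∧ Zle (a • v) v' := by
  obtain ⟨K, g, hK⟩ := exists_sameFace v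
  obtain ⟨K', g', hK'⟩ := exists_sameFace v'
  obtain ⟨a, ha⟩ := exists_zle_smul hK (v' := v') fun h0 => hv K g hK (by rw [h, h0, Nat.cast_zero])
  obtain ⟨b, hb⟩ := exists_zle_smul hK' (v' := v) fun h0 =>
    hv' K' g' hK' (by rw [← h, h0, Nat.cast_zero])
  -- The composite of the two inclusions shows that `a * b` preserves the flat of `v'`, so both
  -- inclusions are equalities.
  have h1 := hb.smul a
  rw [← mul_smul] at h1
  exact ⟨a, ha, h1.trans (zle_of_mem_flatStabilizer (mem_flatStabilizer.2 (ha.trans h1)))⟩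

/-- The number of points with non-zero coordinate in blocks whose size has `p`-free part `r`. -/
noncomputable def blockCount (p : ℕ) (v : Vec n) (r : ℕ) : ℕ :=
  ((points n).filter fun x => v.1 x ≠ 0 ∧ ordCompl[p] (bs v x) = r).card

theorem blockCount_smul (p : ℕ) (g : D n) (v : Vec n) (r : ℕ) :
    blockCount p (g • v) r = blockCount p v r := by
  refine Finset.card_bij' (fun y _ => act n g⁻¹ y) (fun y _ => act n g y) ?_ ?_
    (fun y _ => act_act_inv g y) (fun y _ => act_inv_act g y)
  · intro y hy
    rw [Finset.mem_filter] at hy ⊢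
    have := bs_smul g v (act n g⁻¹ y)
    rw [act_act_inv] at this
    rw [act_mem_points, ← this]
    exact hy
  · intro y hy
    rw [Finset.mem_filter] at hy ⊢
    rw [act_mem_points, bs_smul, smul_apply_act]
    exact hy

theorem blockCount_congr {p : ℕ} {v v' : Vec n} (h : ∀ x ∈ points n, v.1 x = 0 ↔ v'.1 x = 0)
    (h' : ∀ x ∈ points n, v.1 x ≠ 0 → ordCompl[p] (bs v x) = ordCompl[p] (bs v' x)) (r : ℕ) :
    blockCount p v r = blockCount p v' r := by
  rw [blockCount, blockCount]
  congr 1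
  refine Finset.filter_congr fun x hx => ?_
  rw [Ne, Ne, h x hx]
  exact and_congr_right fun h0 => by rw [h' x hx (mt (h x hx).1 h0)]

/-- The product of the signs of the coordinates. -/
noncomputable def parity (v : Vec n) : ℤ := ∏ x ∈ Finset.Icc (1 : ℤ) n, (v.1 x).sign

theorem parity_smul (g : D n) (v : Vec n) : parity (g • v) = parity v := by
  have := prod_odd_comp (act_mem_oddPerms g⁻¹) (f := fun x => (v.1 x).sign)
    (fun x => by rw [vec_neg, Int.sign_neg])
  rw [eps_act, one_mul] at this
  exact this

/-- On a block of `v` the product of the signs of the two vectors is constant, and an even block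
size makes its total contribution `1`. -/
theorem parity_eq_of_zle {v v' : Vec n} (hN : Normal v) (h : Zle v v')
    (h0 : ∀ x ∈ points n, v.1 x ≠ 0) (h0' : ∀ x ∈ points n, v'.1 x ≠ 0)
    (heven : ∀ x ∈ points n, Even (bs v x)) : parity v = parity v' := by
  have hsq : ∀ {c : ℤ}, c ≠ 0 → c.sign * c.sign = 1 := fun {c} hc => by
    rcases lt_or_gt_of_ne hc with h | h
    · rw [Int.sign_eq_neg_one_of_neg h]; rfl
    · rw [Int.sign_eq_one_of_pos h]; rfl
  have hprod : ∏ x ∈ Finset.Icc (1 : ℤ) n, ((v.1 x).sign * (v'.1 x).sign) = 1 := by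
    rw [← Finset.prod_fiberwise_of_maps_to (t := (Finset.Icc (1 : ℤ) n).image fun x => |v.1 x|)
      (g := fun x => |v.1 x|) (fun x hx => Finset.mem_image_of_mem _ hx)]
    refine Finset.prod_eq_one fun c hc => ?_
    obtain ⟨x, hx, rfl⟩ := Finset.mem_image.1 hc
    have hxp := mem_points_of_Icc hx
    have hconst : ∀ y ∈ (Finset.Icc (1 : ℤ) n).filter (fun y => |v.1 y| = |v.1 x|),
        (v.1 y).sign * (v'.1 y).sign = (v.1 x).sign * (v'.1 x).sign := by
      intro y hy
      obtain ⟨hy, he⟩ := Finset.mem_filter.1 hy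
      have hyp := mem_points_of_Icc hy
      rcases abs_eq_abs.1 he with h1 | h1
      · rw [h1, hN.apply_eq h hyp hxp h1]
      · rw [← vec_neg] at h1
        rw [h1, hN.apply_eq h hyp (neg_mem_points.2 hxp) h1, vec_neg, vec_neg, Int.sign_neg,
          Int.sign_neg, neg_mul_neg]
    rw [Finset.prod_congr rfl hconst, Finset.prod_const, ← bs_eq_card_abs (h0 x hxp)]
    obtain ⟨m, hm⟩ := heven x hxp
    rw [hm, pow_add, ← mul_pow, mul_mul_mul_comm, hsq (h0 x hxp), hsq (h0' x hxp), one_mul, one_pow]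
  have hsq' : parity v' * parity v' = 1 := by
    rw [parity, ← Finset.prod_mul_distrib]
    exact Finset.prod_eq_one fun x hx => hsq (h0' x (mem_points_of_Icc hx))
  rw [Finset.prod_mul_distrib] at hprod
  calc parity v = parity v * (parity v' * parity v') := by rw [hsq', mul_one]
    _ = (parity v * parity v') * parity v' := by ring
    _ = parity v' := by rw [show parity v * parity v' = 1 from hprod, one_mul]

theorem parity_congr {v v' : Vec n} (h : ∀ x, (v.1 x).sign = (v'.1 x).sign) :
    parity v = parity v' := Finset.prod_congr rfl fun x _ => h x

/-- Uniform version for characteristic `p` or zero: in characteristic zero the count for the flat's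
own type is positive, so nothing has to be merged. -/
theorem exists_reduced {F : Type*} [Field F] {p : ℕ} [CharP F p] (hp2 : p ≠ 2) {v : Vec n}
    (hN : Normal v) : ∃ v' : Vec n, Normal v' ∧ (∀ J, (cnt J v : F) = cnt J v') ∧
      (∀ x, (v'.1 x).sign = (v.1 x).sign) ∧
      (∀ x ∈ points n, v.1 x ≠ 0 → ordCompl[p] (bs v' x) = ordCompl[p] (bs v x) ∧
        (Even (bs v x) → Even (bs v' x))) ∧
      ∀ K (g : D n), SameFace v' (g • wt K) → (cnt K v' : F) ≠ 0 := by
  rcases CharP.char_is_prime_or_zero F p with hp | rfl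
  · have := Fact.mk hp
    obtain ⟨v', h1, h2, h3, h4, h5⟩ := exists_restricted hp2 hN
    refine ⟨v', h1, fun J => (CharP.natCast_eq_natCast F p).2 (h2 J), h4, h5, fun K g hK => ?_⟩
    rw [Ne, CharP.cast_eq_zero_iff F p]
    exact not_dvd_cnt hp2 h1 h3 hK
  · refine ⟨v, hN, fun _ => rfl, fun _ => rfl, fun _ _ _ => ⟨rfl, id⟩, fun K g hK => ?_⟩
    rw [Ne, CharP.cast_eq_zero_iff F 0, zero_dvd_iff]
    exact cnt_self_pos hK

/-- The block sizes up to powers of the characteristic, and the parity if all blocks are even, are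
determined by the numbers of faces. -/
theorem invariants_of_cnt_eq {F : Type*} [Field F] {p : ℕ} [CharP F p] (hp2 : p ≠ 2) {v v' : Vec n}
    (hN : Normal v) (hN' : Normal v') (h : ∀ J, (cnt J v : F) = cnt J v') :
    (∀ r, blockCount p v r = blockCount p v' r) ∧
    ((∀ x ∈ points n, v.1 x ≠ 0 ∧ Even (bs v x)) → (∀ x ∈ points n, v'.1 x ≠ 0) →
      parity v = parity v') := by
  obtain ⟨w, hw, hc, hs, ho, hne⟩ := exists_reduced (F := F) hp2 hN
  obtain ⟨w', hw', hc', hs', ho', hne'⟩ := exists_reduced (F := F) hp2 hN'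
  obtain ⟨a, ha, ha'⟩ := exists_zle_smul_and (fun J => by rw [← hc, h, hc']) hne hne'
  have z : ∀ x, w.1 x = 0 ↔ v.1 x = 0 := fun x => by
    rw [← Int.sign_eq_zero_iff_zero, hs, Int.sign_eq_zero_iff_zero]
  have z' : ∀ x, w'.1 x = 0 ↔ v'.1 x = 0 := fun x => by
    rw [← Int.sign_eq_zero_iff_zero, hs', Int.sign_eq_zero_iff_zero]
  constructor
  · intro r
    rw [blockCount_congr (v := v) (v' := w) (fun x _ => (z x).symm)
        (fun x hx h0 => (ho x hx h0).1.symm),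
      blockCount_congr (v := v') (v' := w') (fun x _ => (z' x).symm)
        (fun x hx h0 => (ho' x hx h0).1.symm), ← blockCount_smul p a w]
    exact blockCount_congr (fun x _ => ⟨(hw.smul a).apply_eq_zero ha', hw'.apply_eq_zero ha⟩)
      (fun x hx _ => by rw [bs_congr (hw.smul a) hw' ha' ha hx]) r
  · intro he h0'
    rw [← parity_congr hs, ← parity_congr hs', ← parity_smul a w]
    refine parity_eq_of_zle (hw.smul a) ha' (fun x hx h0 => ?_)
      (fun x hx h0 => h0' x hx ((z' x).1 h0)) (fun x hx => ?_)
    · exact (he _ ((act_mem_points _).2 hx)).1 ((z _).1 h0)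
    · have hx' : act n a⁻¹ x ∈ points n := (act_mem_points _).2 hx
      have := bs_smul a w (act n a⁻¹ x)
      rw [act_act_inv] at this
      rw [this]
      exact (ho _ hx' (he _ hx').1).2 (he _ hx').2

end Separation

/-! ### Interval partitions -/

/-- The size of the interval that contains `x`, when `L` lists the sizes of consecutive intervals
starting after `off`. -/
def intervalSize : List ℕ → ℕ → ℕ → ℕ
  | [], _, _ => 0
  | l :: L, off, x => if x ≤ off + l then l else intervalSize L (off + l) x

theorem exists_intervalSize_eq {L : List ℕ} (hL : ∀ l ∈ L, 0 < l) (off : ℕ) {l : ℕ} (hl : l ∈ L) :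
    ∃ x ∈ Finset.Ioc off (off + L.sum), intervalSize L off x = l := by
  induction L generalizing off with
  | nil => simp at hl
  | cons a L ih =>
    have ha := hL a (by simp)
    rcases List.mem_cons.1 hl with rfl | h
    · refine ⟨off + l, Finset.mem_Ioc.2 ⟨by omega, by simp⟩, by simp [intervalSize]⟩
    · obtain ⟨x, hx, hx'⟩ := ih (fun l hl => hL l (List.mem_cons_of_mem _ hl)) (off + a) h
      rw [Finset.mem_Ioc] at hx
      refine ⟨x, Finset.mem_Ioc.2 ⟨by omega, by rw [List.sum_cons]; omega⟩, ?_⟩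
      rw [intervalSize, if_neg (by omega), hx']

theorem intervalSize_mem {L : List ℕ} {off x : ℕ} (hx : x ∈ Finset.Ioc off (off + L.sum)) :
    intervalSize L off x ∈ L := by
  induction L generalizing off with
  | nil => simp at hx
  | cons a L ih =>
    rw [Finset.mem_Ioc, List.sum_cons] at hx
    rw [intervalSize]
    split_ifs with h
    · simp
    · exact List.mem_cons_of_mem _ (ih (Finset.mem_Ioc.2 (by omega)))

theorem card_intervalSize_eq (L : List ℕ) (off r : ℕ) :
    ((Finset.Ioc off (off + L.sum)).filter fun x => intervalSize L off x = r).card =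
      r * L.count r := by
  induction L generalizing off with
  | nil => simp
  | cons a L ih =>
    have hd : Disjoint (Finset.Ioc off (off + a)) (Finset.Ioc (off + a) (off + a + L.sum)) := by
      rw [Finset.disjoint_left]
      intro x hx hx'
      rw [Finset.mem_Ioc] at hx hx'
      omega
    have hu : Finset.Ioc off (off + (a :: L).sum) =
        Finset.Ioc off (off + a) ∪ Finset.Ioc (off + a) (off + a + L.sum) := by
      ext x
      rw [Finset.mem_union, Finset.mem_Ioc, Finset.mem_Ioc, Finset.mem_Ioc, List.sum_cons]
      omega
    rw [hu, Finset.filter_union,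
      Finset.card_union_of_disjoint (Finset.disjoint_filter_filter hd), List.count_cons, mul_add,
      ← ih (off + a), add_comm]
    congr 1
    · refine congrArg Finset.card (Finset.filter_congr fun x hx => ?_)
      rw [Finset.mem_Ioc] at hx
      rw [intervalSize, if_neg (by omega)]
    · by_cases h : a = r
      · subst h
        rw [Finset.filter_true_of_mem, Nat.card_Ioc]
        · simp
        · intro x hx
          rw [intervalSize, if_pos (Finset.mem_Ioc.1 hx).2]
      · rw [Finset.filter_false_of_mem]
        · simp [h]
        · intro x hx
          rw [intervalSize, if_pos (Finset.mem_Ioc.1 hx).2]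
          exact h

theorem pairwise_of_intervalSize {L : List ℕ} (hL : ∀ l ∈ L, 0 < l) {off : ℕ}
    (h : ∀ x ∈ Finset.Ioc off (off + L.sum), ∀ y ∈ Finset.Ioc off (off + L.sum), x < y →
      intervalSize L off y ≤ intervalSize L off x) : L.Pairwise (· ≥ ·) := by
  induction L generalizing off with
  | nil => exact List.Pairwise.nil
  | cons a L ih =>
    have ha := hL a (by simp)
    have hL' : ∀ l ∈ L, 0 < l := fun l hl => hL l (List.mem_cons_of_mem _ hl)
    have hs : ∀ x, off + a < x → intervalSize (a :: L) off x = intervalSize L (off + a) x :=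
      fun x hx => by rw [intervalSize, if_neg (by omega)]
    rw [List.sum_cons] at h
    rw [List.pairwise_cons]
    constructor
    · intro l hl
      obtain ⟨y, hy, rfl⟩ := exists_intervalSize_eq hL' (off + a) hl
      rw [Finset.mem_Ioc] at hy
      have := h (off + a) (Finset.mem_Ioc.2 (by omega)) y (Finset.mem_Ioc.2 (by omega)) hy.1
      rw [hs y hy.1, intervalSize, if_pos le_rfl] at this
      exact this
    · refine ih hL' (off := off + a) fun x hx y hy hxy => ?_
      rw [Finset.mem_Ioc] at hx hy
      rw [← hs x hx.1, ← hs y hy.1]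
      exact h x (Finset.mem_Ioc.2 (by omega)) y (Finset.mem_Ioc.2 (by omega)) hxy

theorem eq_of_noJump {a : ℕ → ℕ} {x y : ℕ} (hxy : x ≤ y)
    (h : ∀ z, x ≤ z → z < y → a z = a (z + 1)) : a x = a y := by
  induction y, hxy using Nat.le_induction with
  | base => rfl
  | succ y hy ih => rw [ih fun z h1 h2 => h z h1 (by omega), h y hy (by omega)]

theorem le_of_steps {a : ℕ → ℕ} {N : ℕ} (ha : ∀ z < N, a z ≤ a (z + 1)) {x y : ℕ} (hxy : x ≤ y)
    (hy : y ≤ N) : a x ≤ a y := by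
  induction y, hxy using Nat.le_induction with
  | base => exact le_rfl
  | succ y _ ih => exact (ih (by omega)).trans (ha y (by omega))

/-- The level sets of a function that jumps exactly at the ends of intervals. -/
theorem card_level_eq_intervalSize {a : ℕ → ℕ} {N : ℕ} (ha : ∀ z < N, a z ≤ a (z + 1))
    {L : List ℕ} (hL : ∀ l ∈ L, 0 < l) {off : ℕ} (hN : off + L.sum = N)
    (hjump : ∀ x, off ≤ x → x < N →
      (a x < a (x + 1) ↔ ∃ j < L.length, x = off + (L.take j).sum))
    {x : ℕ} (hx : x ∈ Finset.Ioc off N) :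
    ((Finset.Ioc off N).filter fun y => a y = a x).card = intervalSize L off x := by
  induction L generalizing off with
  | nil => simp at hN; rw [Finset.mem_Ioc] at hx; omega
  | cons l L ih =>
    have hl := hL l (by simp)
    have hL' : ∀ l ∈ L, 0 < l := fun l hl => hL l (List.mem_cons_of_mem _ hl)
    rw [List.sum_cons] at hN
    rw [Finset.mem_Ioc] at hx
    have hstep : ∀ z, off < z → z < off + l → a z = a (z + 1) := by
      intro z h1 h2
      refine le_antisymm (ha z (by omega)) (not_lt.1 fun h => ?_)
      obtain ⟨j, hj, hj'⟩ := (hjump z h1.le (by omega)).1 h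
      cases j with
      | zero => simp at hj'; omega
      | succ j => rw [List.take_succ_cons, List.sum_cons] at hj'; omega
    have hconst : ∀ z, off < z → z ≤ off + l → a z = a (off + l) := fun z h1 h2 =>
      eq_of_noJump h2 fun y h3 h4 => hstep y (by omega) h4
    have hgt : ∀ z, off + l < z → z ≤ N → a (off + l) < a z := by
      intro z h1 h2
      have hLne : 0 < L.length := by
        rcases L with _ | ⟨b, L⟩
        · simp at hN; omega
        · simp
      have := (hjump (off + l) (by omega) (by omega)).2 ⟨1, by simpa using hLne, by simp⟩
      exact this.trans_le (le_of_steps ha h1 h2)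
    rw [intervalSize]
    split_ifs with h
    · rw [hconst x hx.1 h]
      have : (Finset.Ioc off N).filter (fun y => a y = a (off + l)) = Finset.Ioc off (off + l) := by
        ext y
        rw [Finset.mem_filter, Finset.mem_Ioc, Finset.mem_Ioc]
        constructor
        · rintro ⟨h1, h2⟩
          refine ⟨h1.1, not_lt.1 fun h3 => ?_⟩
          have := hgt y h3 h1.2
          omega
        · intro h1
          exact ⟨⟨h1.1, by omega⟩, hconst y h1.1 h1.2⟩
      rw [this, Nat.card_Ioc, Nat.add_sub_cancel_left]
    · rw [← ih hL' (off := off + l) (by omega) (fun z h1 h2 => ?_) (Finset.mem_Ioc.2 (by omega))]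
      · congr 1
        ext y
        rw [Finset.mem_filter, Finset.mem_filter, Finset.mem_Ioc, Finset.mem_Ioc]
        constructor
        · rintro ⟨h1, h2⟩
          refine ⟨⟨not_le.1 fun h3 => ?_, h1.2⟩, h2⟩
          have := hgt x (by omega) hx.2
          rw [← hconst y h1.1 h3] at this
          omega
        · rintro ⟨h1, h2⟩
          exact ⟨⟨by omega, h1.2⟩, h2⟩
      · rw [hjump z (by omega) h2]
        constructor
        · rintro ⟨j, hj, hj'⟩
          cases j with
          | zero => simp at hj'; omega
          | succ j =>
            rw [List.take_succ_cons, List.sum_cons] at hj'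
            exact ⟨j, by simpa using hj, by omega⟩
        · rintro ⟨j, hj, hj'⟩
          refine ⟨j + 1, by simpa using hj, ?_⟩
          rw [List.take_succ_cons, List.sum_cons]
          omega

/-! ### Compositions -/

/-- A composition is determined by its boundaries, and `0` is always one of them, hence the
condition on `B`. -/
theorem exists_composition {N : ℕ} (B : Finset ℕ) (h0 : 0 < N → 0 ∈ B) :
    ∃ κ : Composition N, ∀ x < N, x ∈ B ↔ ∃ j < κ.length, x = κ.sizeUpTo j := by
  classical
  let c : CompositionAsSet N :=
    { boundaries := Finset.univ.filter fun i => i = Fin.last N ∨ (i : ℕ) ∈ B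
      zero_mem := by
        rw [Finset.mem_filter]
        refine ⟨Finset.mem_univ _, ?_⟩
        rcases Nat.eq_zero_or_pos N with rfl | h
        · left; rfl
        · right; exact h0 h
      getLast_mem := by simp }
  refine ⟨c.toComposition, fun x hx => ?_⟩
  have h1 : x ∈ B ↔ (⟨x, by omega⟩ : Fin (N + 1)) ∈ c.toComposition.boundaries := by
    rw [c.toComposition_boundaries]
    simp only [c, Finset.mem_filter, Finset.mem_univ, true_and]
    constructor
    · exact Or.inr
    · rintro (h | h)
      · have := congrArg Fin.val h
        simp at this; omega
      · exact h
  rw [h1, Composition.boundaries, Finset.mem_map]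
  constructor
  · rintro ⟨j, -, hj⟩
    have hj' : c.toComposition.sizeUpTo j = x := congrArg Fin.val hj
    refine ⟨j, ?_, hj'.symm⟩
    have := j.2
    by_contra h
    have : (j : ℕ) = c.toComposition.length := by omega
    rw [this, Composition.sizeUpTo_length] at hj'
    omega
  · rintro ⟨j, hj, hj'⟩
    exact ⟨⟨j, by omega⟩, Finset.mem_univ _, Fin.ext hj'.symm⟩

theorem Composition.exists_head {N : ℕ} (κ : Composition N) (hN : 0 < N) :
    κ.blocks.head? = some (κ.sizeUpTo 1) ∧ 1 ≤ κ.sizeUpTo 1 := by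
  have hpos := κ.length_pos_iff.2 hN
  have h1 : κ.blocks.head? = some (κ.sizeUpTo 1) := by
    rw [Composition.sizeUpTo]
    rcases h : κ.blocks with _ | ⟨a, L⟩
    · rw [Composition.length, h] at hpos; simp at hpos
    · simp
  refine ⟨h1, κ.one_le_blocks (List.mem_of_mem_head? h1)⟩

theorem Composition.sizeUpTo_one_le {N : ℕ} (κ : Composition N) {j : ℕ} (hj : 1 ≤ j) :
    κ.sizeUpTo 1 ≤ κ.sizeUpTo j := κ.monotone_sizeUpTo hj

/-! ### Elements of `𝒞(n)` and subsets of the generators. -/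

section Comps

variable {n : ℕ} [Fact (2 ≤ n)]

theorem sizeUpTo_one_of_head {κ : Composition n} (h : κ.blocks.head? = some 1) : κ.sizeUpTo 1 = 1 := by
  have := (Composition.exists_head κ (by have := two_le n; omega)).1
  rw [h, Option.some_inj] at this
  exact this.symm

theorem two_le_sizeUpTo_one {κ : Composition n} (h : ∃ a ∈ κ.blocks.head?, 2 ≤ a) :
    2 ≤ κ.sizeUpTo 1 := by
  have h1 := (Composition.exists_head κ (by have := two_le n; omega)).1
  obtain ⟨a, ha, h2⟩ := h
  rw [Option.mem_def, h1, Option.some_inj] at ha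
  omega

theorem Comps.pos {κ : Comps n} : ∀ l ∈ κ.components, 0 < l := by
  match κ with
  | .below m hm κ => exact fun l h => κ.blocks_pos h
  | .one κ h => exact fun l h => κ.blocks_pos h
  | .top κ h => exact fun l h => κ.blocks_pos h
  | .topPrime κ h => exact fun l h => κ.blocks_pos h

theorem Comps.sum_le (κ : Comps n) : κ.components.sum ≤ n := by
  match κ with
  | .below m hm κ => have := κ.blocks_sum; change κ.blocks.sum ≤ n; omega
  | .one κ h => exact κ.blocks_sum.le
  | .top κ h => exact κ.blocks_sum.le
  | .topPrime κ h => exact κ.blocks_sum.le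

/-- The ends of the intervals of the composition, in terms of the corresponding subset. -/
theorem Comps.jump_iff (κ : Comps n) (h0 : 0 < n) (h1 : 1 < n) {x : ℕ} (hx : x < n) :
    (∃ j < κ.components.length, x = n - κ.components.sum + (κ.components.take j).sum) ↔
      if x = 0 then ⟨0, h0⟩ ∈ κ.subset ∨ ⟨1, h1⟩ ∈ κ.subset
      else if x = 1 then ⟨0, h0⟩ ∈ κ.subset ∧ ⟨1, h1⟩ ∈ κ.subset
      else ⟨x, hx⟩ ∈ κ.subset := by
  match κ with
  | .below m hm κ =>
    have hs := κ.blocks_sum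
    simp only [Comps.subset, Comps.components, Finset.mem_filter, Finset.mem_univ, true_and, hs]
    change (∃ j < κ.length, x = n - m + κ.sizeUpTo j) ↔ _
    split_ifs with e0 e1
    · subst e0
      exact ⟨fun h => Or.inl h, fun h => h.elim id fun ⟨j, _, hj⟩ => by omega⟩
    · subst e1
      exact ⟨fun ⟨j, _, hj⟩ => by omega, fun h => h.2⟩
    · exact Iff.rfl
  | .one κ h =>
    have hs := κ.blocks_sum
    have hh := sizeUpTo_one_of_head h
    simp only [Comps.subset, Comps.components, Finset.mem_filter, Finset.mem_univ, true_and, hs]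
    change (∃ j < κ.length, x = n - n + κ.sizeUpTo j) ↔ _
    rw [Nat.sub_self]; simp only [zero_add]
    have hlen : 1 < κ.length := by
      by_contra hle
      rw [κ.sizeUpTo_ofLength_le 1 (by omega)] at hh
      omega
    split_ifs with e0 e1
    · subst e0
      exact iff_of_true ⟨0, by omega, by simp⟩ (Or.inl (Or.inl trivial))
    · subst e1
      exact iff_of_true ⟨1, hlen, hh.symm⟩ ⟨Or.inl trivial, Or.inr (Or.inl trivial)⟩
    · constructor
      · rintro ⟨j, hj, hj'⟩
        refine Or.inr (Or.inr ⟨j, hj, ?_, hj'⟩)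
        by_contra hlt
        have : j = 0 ∨ j = 1 := by omega
        rcases this with rfl | rfl
        · simp at hj'; omega
        · omega
      · rintro (h | h | ⟨j, hj, _, hj'⟩)
        · exact absurd h e0
        · exact absurd h e1
        · exact ⟨j, hj, hj'⟩
  | .top κ h =>
    have hs := κ.blocks_sum
    have hh := two_le_sizeUpTo_one h
    simp only [Comps.subset, Comps.components, Finset.mem_filter, Finset.mem_univ, true_and, hs]
    change (∃ j < κ.length, x = n - n + κ.sizeUpTo j) ↔ _
    rw [Nat.sub_self]; simp only [zero_add]
    have hlen := κ.length_pos_iff.2 h0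
    have hj0 : ∀ j, κ.sizeUpTo j ≠ 1 := fun j hj => by
      rcases Nat.eq_zero_or_pos j with rfl | hpos
      · simp at hj
      · have := Composition.sizeUpTo_one_le κ hpos; omega
    split_ifs with e0 e1
    · subst e0
      exact iff_of_true ⟨0, by omega, by simp⟩ (Or.inl (Or.inl trivial))
    · subst e1
      refine iff_of_false (fun ⟨j, _, hj⟩ => hj0 j hj.symm) fun hc => ?_
      rcases hc.2 with h | ⟨j, _, _, hj⟩
      · omega
      · exact hj0 j hj.symm
    · constructor
      · rintro ⟨j, hj, hj'⟩
        refine Or.inr ⟨j, hj, Nat.pos_of_ne_zero ?_, hj'⟩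
        rintro rfl
        simp at hj'; omega
      · rintro (h | ⟨j, hj, _, hj'⟩)
        · exact absurd h e0
        · exact ⟨j, hj, hj'⟩
  | .topPrime κ h =>
    have hs := κ.blocks_sum
    have hh := two_le_sizeUpTo_one h
    simp only [Comps.subset, Comps.components, Finset.mem_filter, Finset.mem_univ, true_and, hs]
    change (∃ j < κ.length, x = n - n + κ.sizeUpTo j) ↔ _
    rw [Nat.sub_self]; simp only [zero_add]
    have hlen := κ.length_pos_iff.2 h0
    have hj0 : ∀ j, κ.sizeUpTo j ≠ 1 := fun j hj => by
      rcases Nat.eq_zero_or_pos j with rfl | hpos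
      · simp at hj
      · have := Composition.sizeUpTo_one_le κ hpos; omega
    split_ifs with e0 e1
    · subst e0
      exact iff_of_true ⟨0, by omega, by simp⟩ (Or.inr (Or.inl trivial))
    · subst e1
      refine iff_of_false (fun ⟨j, _, hj⟩ => hj0 j hj.symm) fun hc => ?_
      rcases hc.1 with h | ⟨j, _, h3, hj⟩
      · omega
      · have := Composition.sizeUpTo_one_le κ h3; omega
    · constructor
      · rintro ⟨j, hj, hj'⟩
        refine Or.inr ⟨j, hj, Nat.pos_of_ne_zero ?_, hj'⟩
        rintro rfl
        simp at hj'; omega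
      · rintro (h | ⟨j, hj, _, hj'⟩)
        · exact absurd h e1
        · exact ⟨j, hj, hj'⟩

/-- Having the components of an element of `𝒞_n'` without being primed leaves only `𝒞_n`, because
the sum is `n` and the first part is at least `2`. -/
theorem Comps.notMem_subset_of_components_eq {κ κ' : Comps n} (h1 : 1 < n) (hp : κ.InPrime)
    (hp' : ¬ κ'.InPrime) (h : κ.components = κ'.components) : ⟨1, h1⟩ ∉ κ'.subset := by
  match κ with
  | .below m hm c => exact absurd hp id
  | .one c _ => exact absurd hp id
  | .top c _ => exact absurd hp id
  | .topPrime c hc =>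
    match κ' with
    | .below m hm c' =>
      have h2 := c'.blocks_sum
      rw [← show c.blocks = c'.blocks from h, c.blocks_sum] at h2
      omega
    | .one c' hc' =>
      obtain rfl : c = c' := Composition.ext h
      obtain ⟨a, ha, h2⟩ := hc
      rw [hc', Option.mem_some_iff] at ha; omega
    | .top c' hc' =>
      simp only [Comps.subset, Finset.mem_filter, Finset.mem_univ, true_and]
      rintro (h | ⟨j, _, h3, hj⟩)
      · omega
      · have := Composition.sizeUpTo_one_le c' h3
        have := two_le_sizeUpTo_one hc'
        omega
    | .topPrime c' hc' => exact absurd trivial hp'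

theorem Comps.notMem_subset_of_inPrime {κ : Comps n} (h0 : 0 < n) (h : κ.InPrime) :
    ⟨0, h0⟩ ∉ κ.subset ∧ κ.components.sum = n := by
  match κ with
  | .below m hm κ => exact absurd h id
  | .one κ _ => exact absurd h id
  | .top κ _ => exact absurd h id
  | .topPrime κ h' =>
    refine ⟨?_, κ.blocks_sum⟩
    simp only [Comps.subset, Finset.mem_filter, Finset.mem_univ, true_and]
    rintro (h | ⟨j, _, h3, hj⟩)
    · omega
    · have := Composition.sizeUpTo_one_le κ h3
      have := two_le_sizeUpTo_one h'
      omega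

/-- The sum and the first part of the list tell the kinds apart, except for the two copies `𝒞_n` and
`𝒞_n'`. -/
theorem Comps.ext_components {κ κ' : Comps n} (h : κ.components = κ'.components)
    (hp : κ.InPrime ↔ κ'.InPrime) : κ = κ' := by
  have key : ∀ {m m'} {c : Composition m} {c' : Composition m'}, c.blocks = c'.blocks → m = m' :=
    fun {m m' c c'} e => by rw [← c.blocks_sum, ← c'.blocks_sum, e]
  match κ, κ' with
  | .below m hm c, .below m' hm' c' =>
    have e : c.blocks = c'.blocks := h
    obtain rfl := key e
    rw [Composition.ext e]
  | .one c hc, .one c' hc' =>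
    obtain rfl : c = c' := Composition.ext h
    rfl
  | .top c hc, .top c' hc' =>
    obtain rfl : c = c' := Composition.ext h
    rfl
  | .topPrime c hc, .topPrime c' hc' =>
    obtain rfl : c = c' := Composition.ext h
    rfl
  | .below m hm c, .one c' hc' => have := key (c := c) (c' := c') h; omega
  | .below m hm c, .top c' hc' => have := key (c := c) (c' := c') h; omega
  | .one c hc, .below m' hm' c' => have := key (c := c) (c' := c') h; omega
  | .top c hc, .below m' hm' c' => have := key (c := c) (c' := c') h; omega
  | .one c hc, .top c' hc' =>
    obtain rfl : c = c' := Composition.ext h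
    obtain ⟨a, ha, h2⟩ := hc'
    rw [hc, Option.mem_some_iff] at ha; omega
  | .top c hc, .one c' hc' =>
    obtain rfl : c = c' := Composition.ext h
    obtain ⟨a, ha, h2⟩ := hc
    rw [hc', Option.mem_some_iff] at ha; omega
  | .topPrime c hc, .below m' hm' c' => exact absurd (hp.1 trivial) id
  | .topPrime c hc, .one c' hc' => exact absurd (hp.1 trivial) id
  | .topPrime c hc, .top c' hc' => exact absurd (hp.1 trivial) id
  | .below m hm c, .topPrime c' hc' => exact absurd (hp.2 trivial) id
  | .one c hc, .topPrime c' hc' => exact absurd (hp.2 trivial) id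
  | .top c hc, .topPrime c' hc' => exact absurd (hp.2 trivial) id

/-- Every set of generators corresponds to a composition. -/
theorem exists_comps_subset_eq (T : Finset (Fin n)) : ∃ κ : Comps n, κ.subset = T := by
  classical
  have hn := two_le n
  let z : Fin n := ⟨0, by omega⟩
  let o : Fin n := ⟨1, by omega⟩
  let B : Finset ℕ := T.image Fin.val
  have hB : ∀ {x : ℕ} (hx : x < n), x ∈ B ↔ (⟨x, hx⟩ : Fin n) ∈ T := by
    intro x hx
    rw [Finset.mem_image]
    exact ⟨fun ⟨i, hi, h⟩ => by subst h; exact hi, fun h => ⟨_, h, rfl⟩⟩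
  -- The four cases for `s_{1'}` and `s_1` correspond to `𝒞_1`, `𝒞_n`, `𝒞_n'` and `𝒞_{<n}`, in this
  -- order.
  by_cases h0 : z ∈ T <;> by_cases h1 : o ∈ T
  · obtain ⟨κ, hκ⟩ := exists_composition (N := n) B fun _ => (hB (by omega)).2 h0
    obtain ⟨hh, hpos⟩ := Composition.exists_head κ (by omega)
    have hone : κ.sizeUpTo 1 = 1 := by
      obtain ⟨j, hj, hj'⟩ := (hκ 1 (by omega)).1 ((hB (by omega)).2 h1)
      rcases Nat.eq_zero_or_pos j with rfl | hjp
      · simp at hj'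
      · have := Composition.sizeUpTo_one_le κ hjp; omega
    refine ⟨.one κ (by rw [hh, hone]), ?_⟩
    ext i
    simp only [Comps.subset, Finset.mem_filter, Finset.mem_univ, true_and]
    constructor
    · rintro (h | h | ⟨j, hj, _, hj'⟩)
      · rwa [show i = z from Fin.ext h]
      · rwa [show i = o from Fin.ext h]
      · exact (hB i.2).1 ((hκ i i.2).2 ⟨j, hj, hj'⟩)
    · intro h
      obtain ⟨j, hj, hj'⟩ := (hκ i i.2).1 ((hB i.2).2 h)
      rcases j with _ | _ | j
      · left; simpa using hj'
      · right; left; rw [hj']; exact hone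
      · exact Or.inr (Or.inr ⟨_, hj, by omega, hj'⟩)
  · obtain ⟨κ, hκ⟩ := exists_composition (N := n) B fun _ => (hB (by omega)).2 h0
    obtain ⟨hh, hpos⟩ := Composition.exists_head κ (by omega)
    have htwo : 2 ≤ κ.sizeUpTo 1 := by
      by_contra hlt
      have he : κ.sizeUpTo 1 = 1 := by omega
      by_cases hl : 1 < κ.length
      · exact h1 ((hB (by omega)).1 ((hκ 1 (by omega)).2 ⟨1, hl, he.symm⟩))
      · rw [κ.sizeUpTo_ofLength_le 1 (by omega)] at he; omega
    refine ⟨.top κ ⟨_, hh, htwo⟩, ?_⟩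
    ext i
    simp only [Comps.subset, Finset.mem_filter, Finset.mem_univ, true_and]
    constructor
    · rintro (h | ⟨j, hj, _, hj'⟩)
      · rwa [show i = z from Fin.ext h]
      · exact (hB i.2).1 ((hκ i i.2).2 ⟨j, hj, hj'⟩)
    · intro h
      obtain ⟨j, hj, hj'⟩ := (hκ i i.2).1 ((hB i.2).2 h)
      rcases j with _ | j
      · left; simpa using hj'
      · exact Or.inr ⟨_, hj, by omega, hj'⟩
  -- In the primed copy the initial boundary `0` stands for `s_1`, so the label `1` is replaced by
  -- `0`.
  · obtain ⟨κ, hκ⟩ := exists_composition (N := n) ((insert 0 B).erase 1) fun _ => by simp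
    obtain ⟨hh, hpos⟩ := Composition.exists_head κ (by omega)
    have htwo : 2 ≤ κ.sizeUpTo 1 := by
      by_contra hlt
      have he : κ.sizeUpTo 1 = 1 := by omega
      by_cases hl : 1 < κ.length
      · have := (hκ 1 (by omega)).2 ⟨1, hl, he.symm⟩
        simp at this
      · rw [κ.sizeUpTo_ofLength_le 1 (by omega)] at he; omega
    refine ⟨.topPrime κ ⟨_, hh, htwo⟩, ?_⟩
    ext i
    simp only [Comps.subset, Finset.mem_filter, Finset.mem_univ, true_and]
    constructor
    · rintro (h | ⟨j, hj, h2, hj'⟩)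
      · rwa [show i = o from Fin.ext h]
      · have h3 := (hκ i i.2).2 ⟨j, hj, hj'⟩
        have := Composition.sizeUpTo_one_le κ h2
        rw [Finset.mem_erase, Finset.mem_insert] at h3
        exact (hB i.2).1 (h3.2.resolve_left (by omega))
    · intro h
      by_cases hi : (i : ℕ) = 1
      · exact Or.inl hi
      obtain ⟨j, hj, hj'⟩ := (hκ i i.2).1
        (Finset.mem_erase.2 ⟨hi, Finset.mem_insert_of_mem ((hB i.2).2 h)⟩)
      refine Or.inr ⟨j, hj, Nat.pos_of_ne_zero ?_, hj'⟩
      rintro rfl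
      rw [Composition.sizeUpTo_zero] at hj'
      exact h0 (by rwa [show i = z from Fin.ext hj'] at h)
  · rcases T.eq_empty_or_nonempty with rfl | hT
    · obtain ⟨κ, h, -⟩ := exists_components_nil (n := n)
      exact ⟨κ, h⟩
    set a := T.min' hT with ha
    have haT : a ∈ T := T.min'_mem hT
    have ha2 : 2 ≤ (a : ℕ) := by
      by_contra hlt
      have : (a : ℕ) = 0 ∨ (a : ℕ) = 1 := by omega
      rcases this with h | h
      · exact h0 (by rwa [show a = z from Fin.ext h] at haT)
      · exact h1 (by rwa [show a = o from Fin.ext h] at haT)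
    have han := a.2
    have hle : ∀ i ∈ T, (a : ℕ) ≤ i := fun i hi => T.min'_le i hi
    obtain ⟨κ, hκ⟩ := exists_composition (N := n - a) (B.image fun x => x - a) fun _ =>
      Finset.mem_image.2 ⟨a, (hB a.2).2 haT, by omega⟩
    refine ⟨.below (n - a) (by omega) κ, ?_⟩
    ext i
    simp only [Comps.subset, Finset.mem_filter, Finset.mem_univ, true_and]
    rw [show n - (n - (a : ℕ)) = a by omega]
    constructor
    · rintro ⟨j, hj, hj'⟩
      have := i.2
      obtain ⟨y, hy, hy'⟩ := Finset.mem_image.1 ((hκ (i - a) (by omega)).2 ⟨j, hj, by omega⟩)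
      obtain ⟨b, hb, rfl⟩ := Finset.mem_image.1 hy
      have := hle b hb
      rwa [show i = b from Fin.ext (by omega)]
    · intro h
      have := hle i h
      have := i.2
      obtain ⟨j, hj, hj'⟩ := (hκ (i - a) (by omega)).1
        (Finset.mem_image.2 ⟨i, (hB i.2).2 h, rfl⟩)
      exact ⟨j, hj, by omega⟩

end Comps

/-! ### Reading components and parity off dominant vectors, and choosing representatives. -/

section Shape

variable {n : ℕ} [Fact (2 ≤ n)]

/-- The dominant vector `v` lies in the face that corresponds to `κ`. -/
structure HasShape (v : Vec n) (κ : Comps n) : Prop where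
  dominant : Dominant v
  normal : Normal v
  al_eq_zero : ∀ i, al i v = 0 ↔ i ∉ κ.subset

theorem natCast_mem_points {x : ℕ} (h1 : 1 ≤ x) (h2 : x ≤ n) : (x : ℤ) ∈ points n := by
  rw [mem_points]; omega

theorem apply_zero (v : Vec n) : v.1 0 = 0 := vec_eq_zero v (by rw [mem_points]; simp)

theorem Dominant.nonneg {v : Vec n} (hv : Dominant v) {x : ℤ} (h1 : 2 ≤ x) (h2 : x ≤ n) :
    0 ≤ v.1 x := (abs_nonneg _).trans (hv.abs_le le_rfl (by omega : (1 : ℤ) < x) h2)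

theorem Dominant.natAbs_le_succ {v : Vec n} (hv : Dominant v) {z : ℕ} (hz : z < n) :
    (v.1 (z : ℤ)).natAbs ≤ (v.1 ((z + 1 : ℕ) : ℤ)).natAbs := by
  rcases Nat.eq_zero_or_pos z with rfl | h
  · rw [Nat.cast_zero, apply_zero]; simp
  · have := hv.abs_le (x := z) (y := (z + 1 : ℕ)) (by omega) (by omega) (by omega)
    rw [abs_le'] at this
    omega

/-- The absolute values of a dominant vector form a weakly increasing sequence, starting with `0` at
`0`. At the fork of the diagram, `v 1 = 0` means that both simple roots vanish, and `|v 1| < v 2`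
means that neither does. -/
theorem HasShape.jump {v : Vec n} {κ : Comps n} (h : HasShape v κ) {x : ℕ} (hx : x < n) :
    (v.1 (x : ℤ)).natAbs < (v.1 ((x + 1 : ℕ) : ℤ)).natAbs ↔
      ∃ j < κ.components.length, x = n - κ.components.sum + (κ.components.take j).sum := by
  have hn := two_le n
  rw [κ.jump_iff (by omega) (by omega) hx]
  have e0 := al_zero_apply v (by omega)
  have e1 := al_one_apply v (by omega)
  have a0 := h.al_eq_zero ⟨0, by omega⟩
  have a1 := h.al_eq_zero ⟨1, by omega⟩
  have h12 := h.dominant.abs_le (x := 1) (y := 2) le_rfl (by omega) (by omega)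
  split_ifs with c0 c1
  · subst c0
    rw [Nat.cast_zero, apply_zero, Nat.zero_add, Nat.cast_one, Int.natAbs_zero, Int.natAbs_pos]
    rw [← not_iff_not, not_not, not_or, ← a0, ← a1]
    constructor
    -- Normality gives a second vanishing coordinate, and dominance then forces the second
    -- coordinate to vanish too.
    · intro hv1
      obtain ⟨y, hy, h1, h2, h3⟩ := h.normal 1 one_mem_points hv1
      have hv2 : v.1 2 = 0 := by
        have key : ∀ y : ℤ, 2 ≤ y → y ≤ n → v.1 y = 0 → v.1 2 = 0 := by
          intro y hy1 hy2 hy0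
          rcases eq_or_lt_of_le hy1 with rfl | hlt
          · exact hy0
          · have := h.dominant.abs_le (x := 2) (by omega) hlt hy2
            rw [hy0] at this
            exact abs_nonpos_iff.1 this
        rw [mem_points] at hy
        rcases lt_or_ge 0 y with hpos | hneg
        · exact key y (by omega) (by omega) h3
        · exact key (-y) (by omega) (by omega) (by rw [vec_neg, h3, neg_zero])
      omega
    · intro hh; omega
  · subst c1
    rw [Nat.cast_one, show ((1 + 1 : ℕ) : ℤ) = 2 from rfl]
    rw [← not_iff_not, not_and_or, ← a0, ← a1]
    rw [abs_le'] at h12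
    omega
  · have hx2 : 2 ≤ x := by omega
    have e : al ⟨x, hx⟩ v = v.1 ((x + 1 : ℕ) : ℤ) - v.1 (x : ℤ) := by
      rw [al_apply]; simp [lpt, rpt, c0]
    have ax := h.al_eq_zero ⟨x, hx⟩
    rw [← not_iff_not, ← ax, e]
    have h1 := h.dominant.nonneg (x := x) (by omega) (by omega)
    have h2 := h.dominant.abs_le (x := x) (y := (x + 1 : ℕ)) (by omega) (by omega) (by omega)
    rw [abs_of_nonneg h1] at h2
    omega

theorem HasShape.apply_eq_zero_iff {v : Vec n} {κ : Comps n} (h : HasShape v κ) {x : ℕ}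
    (hx : x ≤ n) : v.1 (x : ℤ) = 0 ↔ x ≤ n - κ.components.sum := by
  have hsum := κ.sum_le
  constructor
  · intro h0
    by_contra hlt
    have hlen : 0 < κ.components.length := by
      rw [List.length_pos_iff]
      intro he
      rw [he] at hlt
      simp at hlt; omega
    have h1 := (h.jump (x := n - κ.components.sum) (by omega)).2 ⟨0, hlen, by simp⟩
    have h2 := le_of_steps (a := fun z : ℕ => (v.1 (z : ℤ)).natAbs)
      (fun z hz => h.dominant.natAbs_le_succ hz)
      (show n - κ.components.sum + 1 ≤ x by omega) hx
    omega
  · intro hle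
    have h1 := eq_of_noJump (a := fun z : ℕ => (v.1 (z : ℤ)).natAbs) (Nat.zero_le x) (fun z _ hz =>
      le_antisymm (h.dominant.natAbs_le_succ (by omega)) (not_lt.1 fun hlt => by
        obtain ⟨j, _, hj⟩ := (h.jump (by omega)).1 hlt
        omega))
    simp only [Nat.cast_zero, apply_zero] at h1
    omega

theorem card_filter_Icc_eq_card_Ioc (A : ℤ → Prop) [DecidablePred A] (off : ℕ)
    (hoff : ∀ x : ℕ, 1 ≤ x → x ≤ off → ¬ A x) :
    ((Finset.Icc (1 : ℤ) n).filter A).card = ((Finset.Ioc off n).filter fun x : ℕ => A (x : ℤ)).card := by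
  symm
  refine Finset.card_bij (fun (x : ℕ) _ => (x : ℤ)) ?_ (fun _ _ _ _ h => Int.natCast_inj.1 h) ?_
  · intro x hx
    rw [Finset.mem_filter, Finset.mem_Ioc] at hx
    rw [Finset.mem_filter, Finset.mem_Icc]
    exact ⟨by omega, hx.2⟩
  · intro x hx
    rw [Finset.mem_filter, Finset.mem_Icc] at hx
    lift x to ℕ using by omega
    refine ⟨x, ?_, rfl⟩
    rw [Finset.mem_filter, Finset.mem_Ioc]
    have := mt (hoff x (by omega)) (not_not.2 hx.2)
    exact ⟨by omega, hx.2⟩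

theorem card_filter_points {A : ℤ → Prop} [DecidablePred A] (hA : ∀ x, A (-x) ↔ A x) :
    ((points n).filter A).card = 2 * ((Finset.Icc (1 : ℤ) n).filter A).card := by
  have hu : (points n).filter A = (Finset.Icc (1 : ℤ) n).filter A ∪
      ((Finset.Icc (1 : ℤ) n).filter A).image (fun x => -x) := by
    ext x
    simp only [Finset.mem_union, Finset.mem_image, Finset.mem_filter, mem_points, Finset.mem_Icc]
    constructor
    · rintro ⟨h, hx⟩
      rcases lt_or_gt_of_ne h.1 with h1 | h1
      · exact Or.inr ⟨-x, ⟨by omega, (hA x).2 hx⟩, neg_neg x⟩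
      · exact Or.inl ⟨by omega, hx⟩
    · rintro (⟨h, hx⟩ | ⟨y, ⟨h, hy⟩, rfl⟩)
      · exact ⟨by omega, hx⟩
      · exact ⟨by omega, (hA y).2 hy⟩
  rw [hu, Finset.card_union_of_disjoint, Finset.card_image_of_injective _ neg_injective, two_mul]
  rw [Finset.disjoint_left]
  intro x hx hx'
  obtain ⟨y, hy, rfl⟩ := Finset.mem_image.1 hx'
  simp only [Finset.mem_filter, Finset.mem_Icc] at hx hy
  omega

theorem HasShape.bs_natCast {v : Vec n} {κ : Comps n} (h : HasShape v κ) {x : ℕ}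
    (hx : x ∈ Finset.Ioc (n - κ.components.sum) n) :
    bs v x = intervalSize κ.components (n - κ.components.sum) x := by
  have hx' := Finset.mem_Ioc.1 hx
  have hx0 : v.1 (x : ℤ) ≠ 0 := by rw [Ne, h.apply_eq_zero_iff hx'.2]; omega
  have hsum := κ.sum_le
  rw [bs_eq_card_abs hx0, card_filter_Icc_eq_card_Ioc _ (n - κ.components.sum),
    ← card_level_eq_intervalSize (a := fun z : ℕ => (v.1 (z : ℤ)).natAbs)
      (fun z hz => h.dominant.natAbs_le_succ hz) κ.pos (Nat.sub_add_cancel hsum)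
      (fun y _ hy => h.jump hy) hx]
  · simp only [Int.natAbs_eq_natAbs_iff, abs_eq_abs]
  · intro y _ hy he
    rw [(h.apply_eq_zero_iff (by omega)).2 hy, abs_zero, eq_comm, abs_eq_zero] at he
    exact hx0 he

theorem natAbs_mem_Ioc {v : Vec n} {κ : Comps n} (h : HasShape v κ) {x : ℤ} (hx : x ∈ points n)
    (h0 : v.1 x ≠ 0) :
    x.natAbs ∈ Finset.Ioc (n - κ.components.sum) n ∧ bs v x = bs v x.natAbs := by
  rw [mem_points] at hx
  have hle : x.natAbs ≤ n := by omega
  have hz := h.apply_eq_zero_iff hle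
  rcases Int.natAbs_eq x with he | he
  · rw [← he] at hz
    exact ⟨Finset.mem_Ioc.2 ⟨not_le.1 (mt hz.2 h0), hle⟩, by rw [← he]⟩
  · have e : ((x.natAbs : ℕ) : ℤ) = -x := by omega
    rw [e, vec_neg, neg_eq_zero] at hz
    exact ⟨Finset.mem_Ioc.2 ⟨not_le.1 (mt hz.2 h0), hle⟩, by rw [e, bs_neg]⟩

theorem HasShape.bs_mem {v : Vec n} {κ : Comps n} (h : HasShape v κ) {x : ℤ} (hx : x ∈ points n)
    (h0 : v.1 x ≠ 0) : bs v x ∈ κ.components := by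
  obtain ⟨h1, h2⟩ := natAbs_mem_Ioc h hx h0
  rw [h2, h.bs_natCast h1]
  exact intervalSize_mem (by rwa [Nat.sub_add_cancel κ.sum_le])

theorem HasShape.exists_bs_eq {v : Vec n} {κ : Comps n} (h : HasShape v κ) {l : ℕ}
    (hl : l ∈ κ.components) : ∃ x ∈ points n, v.1 x ≠ 0 ∧ bs v x = l := by
  obtain ⟨x, hx, hx'⟩ := exists_intervalSize_eq κ.pos (n - κ.components.sum) hl
  rw [Nat.sub_add_cancel κ.sum_le] at hx
  have hm := Finset.mem_Ioc.1 hx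
  refine ⟨x, natCast_mem_points (by omega) hm.2, ?_, by rw [h.bs_natCast hx, hx']⟩
  rw [Ne, h.apply_eq_zero_iff hm.2]
  omega

theorem ordCompl_eq_self {p l : ℕ} (hp : p.Prime ∨ p = 0) (h : ¬ p ∣ l) : ordCompl[p] l = l := by
  rcases hp with hp | rfl
  · exact (Nat.ordCompl_eq_self_iff_zero_or_not_dvd l hp).2 (Or.inr h)
  · exact Nat.ordCompl_of_not_prime l 0 Nat.not_prime_zero

/-- For regular `κ` the `p`-free part of a block size is the size itself. Each part `r` then covers
`r` coordinates, and both signs are counted. -/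
theorem HasShape.blockCount_eq {v : Vec n} {κ : Comps n} (h : HasShape v κ) {p : ℕ}
    (hp : p.Prime ∨ p = 0) (hreg : κ.IsRegular p) (r : ℕ) :
    blockCount p v r = 2 * (r * κ.components.count r) := by
  rw [blockCount, card_filter_points (A := fun x => v.1 x ≠ 0 ∧ ordCompl[p] (bs v x) = r)
      (fun x => by rw [vec_neg, bs_neg, neg_ne_zero]),
    card_filter_Icc_eq_card_Ioc _ (n - κ.components.sum),
    ← card_intervalSize_eq κ.components (n - κ.components.sum) r, Nat.sub_add_cancel κ.sum_le]
  · congr 2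
    refine Finset.filter_congr fun x hx => ?_
    have hm := Finset.mem_Ioc.1 hx
    have h0 : v.1 (x : ℤ) ≠ 0 := by rw [Ne, h.apply_eq_zero_iff hm.2]; omega
    rw [← h.bs_natCast hx, ordCompl_eq_self hp
      (hreg _ (h.bs_mem (natCast_mem_points (by omega) hm.2) h0))]
    exact and_iff_right h0
  · intro x h1 h2 h3
    exact h3.1 ((h.apply_eq_zero_iff (by omega)).2 h2)

theorem HasShape.isPartition {v : Vec n} {κ : Comps n} (h : HasShape v κ)
    (ho : ∀ x ∈ points n, ∀ y ∈ points n, v.1 x ≠ 0 → |v.1 x| < |v.1 y| → bs v y ≤ bs v x) :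
    κ.IsPartition := by
  refine pairwise_of_intervalSize κ.pos (off := n - κ.components.sum) ?_
  rw [Nat.sub_add_cancel κ.sum_le]
  intro x hx y hy hxy
  have hx' := Finset.mem_Ioc.1 hx
  have hy' := Finset.mem_Ioc.1 hy
  have hx0 : v.1 (x : ℤ) ≠ 0 := by rw [Ne, h.apply_eq_zero_iff hx'.2]; omega
  rw [← h.bs_natCast hx, ← h.bs_natCast hy]
  have hle := h.dominant.abs_le (x := x) (y := y) (by omega) (by omega) (by omega)
  have hnn := h.dominant.nonneg (x := y) (by omega) (by omega)
  rw [← abs_of_nonneg hnn] at hle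
  rcases eq_or_lt_of_le hle with he | hlt
  · rcases abs_eq_abs.1 he with h1 | h1
    · exact (bs_congr_of_eq h1).ge
    · rw [← bs_neg v x]
      exact (bs_congr_of_eq (by rw [vec_neg, h1, neg_neg])).ge
  · exact ho _ (natCast_mem_points (by omega) hx'.2) _ (natCast_mem_points (by omega) hy'.2) hx0 hlt

theorem HasShape.apply_ne_zero {v : Vec n} {κ : Comps n} (h : HasShape v κ)
    (hs : κ.components.sum = n) {x : ℤ} (hx : x ∈ points n) : v.1 x ≠ 0 := by
  rw [mem_points] at hx
  have key : ∀ y : ℕ, 1 ≤ y → y ≤ n → v.1 (y : ℤ) ≠ 0 := fun y h1 h2 => by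
    rw [Ne, h.apply_eq_zero_iff h2]; omega
  rcases lt_or_gt_of_ne hx.1 with h1 | h1
  · have := key x.natAbs (by omega) (by omega)
    rwa [show ((x.natAbs : ℕ) : ℤ) = -x by omega, vec_neg, neg_ne_zero] at this
  · have := key x.natAbs (by omega) (by omega)
    rwa [show ((x.natAbs : ℕ) : ℤ) = x by omega] at this

/-- Only the first coordinate of a dominant vector can be negative. -/
theorem HasShape.parity_eq {v : Vec n} {κ : Comps n} (h : HasShape v κ)
    (hs : κ.components.sum = n) : parity v = (v.1 1).sign := by
  have hn := two_le n
  rw [parity]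
  refine Finset.prod_eq_single_of_mem 1 (Finset.mem_Icc.2 (by omega)) fun x hx h1 => ?_
  have hx' := Finset.mem_Icc.1 hx
  have h2 := h.dominant.nonneg (x := x) (by omega) (by omega)
  have h3 := h.apply_ne_zero hs (mem_points_of_Icc hx)
  exact Int.sign_eq_one_of_pos (by omega)

theorem HasShape.parity_eq_one {v : Vec n} {κ : Comps n} (h : HasShape v κ)
    (hs : κ.components.sum = n) (h1 : 1 < n) (hm : ⟨1, h1⟩ ∉ κ.subset) : parity v = 1 := by
  rw [h.parity_eq hs]
  have e := al_one_apply v h1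
  rw [(h.al_eq_zero _).2 hm] at e
  have h2 := h.dominant.nonneg (x := 2) le_rfl (by omega)
  have h3 := h.apply_ne_zero hs two_mem_points
  exact Int.sign_eq_one_of_pos (by omega)

theorem HasShape.parity_eq_neg_one {v : Vec n} {κ : Comps n} (h : HasShape v κ) (hp : κ.InPrime) :
    parity v = -1 := by
  have hn := two_le n
  obtain ⟨hm, hs⟩ := Comps.notMem_subset_of_inPrime (κ := κ) (by omega) hp
  rw [h.parity_eq hs]
  have e := al_zero_apply v (by omega)
  rw [(h.al_eq_zero _).2 hm] at e
  have h2 := h.dominant.nonneg (x := 2) le_rfl (by omega)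
  have h3 := h.apply_ne_zero hs two_mem_points
  exact Int.sign_eq_neg_one_of_neg (by omega)

/-! ### Ordering the blocks by size -/

theorem bs_congr_of_iff {v w : Vec n} (h : ∀ x y, w.1 x = w.1 y ↔ v.1 x = v.1 y) (x : ℤ) :
    bs w x = bs v x := by
  rw [bs, bs]
  exact congrArg Finset.card (Finset.filter_congr fun y _ => h y x)

/-- A flat does not see the absolute values of its blocks, so they can be chosen to make larger
blocks come first. -/
theorem exists_ordered (v : Vec n) : ∃ w : Vec n, (∀ x y, w.1 x = w.1 y ↔ v.1 x = v.1 y) ∧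
    (∀ x ∈ points n, ∀ y ∈ points n, w.1 x ≠ 0 → |w.1 x| < |w.1 y| → bs w y ≤ bs w x) := by
  set M : ℤ := 1 + ∑ x ∈ points n, |v.1 x| with hM
  have hMx : ∀ x, |v.1 x| < M := by
    intro x
    by_cases hx : x ∈ points n
    · have := Finset.single_le_sum (f := fun x => |v.1 x|) (fun _ _ => abs_nonneg _) hx
      omega
    · rw [vec_eq_zero v hx, abs_zero]
      have := Finset.sum_nonneg fun x (_ : x ∈ points n) => abs_nonneg (v.1 x)
      omega
  have hM0 : 0 < M := (abs_nonneg _).trans_lt (hMx 0)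
  set C : ℤ := ((points n).card : ℤ) with hC
  have hbC : ∀ x, (bs v x : ℤ) ≤ C := fun x => by
    rw [hC]; exact_mod_cast Finset.card_filter_le _ _
  -- As `M` exceeds all `|v x|`, the block size decides first, in decreasing order, and `|v x|`
  -- separates blocks of equal size.
  let f : ℤ → ℤ := fun x => (C - bs v x) * M + |v.1 x|
  have hf : ∀ x, v.1 x ≠ 0 → 0 < f x := fun x hx =>
    add_pos_of_nonneg_of_pos (mul_nonneg (by have := hbC x; omega) hM0.le) (abs_pos.2 hx)
  have hfb : ∀ x y, bs v x < bs v y → f y < f x := by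
    intro x y hlt
    have h1 := hMx y
    have h2 := abs_nonneg (v.1 x)
    have h3 : (C - bs v y + 1) * M ≤ (C - bs v x) * M :=
      mul_le_mul_of_nonneg_right (by omega) hM0.le
    simp only [f]
    rw [add_mul, one_mul] at h3
    omega
  have hfe : ∀ x y, f x = f y → bs v x = bs v y ∧ |v.1 x| = |v.1 y| := by
    intro x y he
    have hb : bs v x = bs v y := by
      rcases lt_trichotomy (bs v x) (bs v y) with h | h | h
      · exact absurd he (hfb x y h).ne'
      · exact h
      · exact absurd he (hfb y x h).ne
    refine ⟨hb, ?_⟩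
    simp only [f, hb] at he
    exact add_left_cancel he
  let w : Vec n := ⟨fun x => (v.1 x).sign * f x, fun x => by
    simp only [f, vec_neg, bs_neg, abs_neg, Int.sign_neg, neg_mul], fun x hx => by
    simp only [vec_eq_zero v hx, Int.sign_zero, zero_mul]⟩
  have hw : ∀ x, w.1 x = (v.1 x).sign * f x := fun _ => rfl
  have hsw : ∀ x, (w.1 x).sign = (v.1 x).sign := by
    intro x
    rw [hw, Int.sign_mul]
    by_cases h0 : v.1 x = 0
    · simp [h0]
    · rw [Int.sign_eq_one_of_pos (hf x h0), mul_one, Int.sign_sign]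
  have hw0 : ∀ x, w.1 x = 0 ↔ v.1 x = 0 := fun x => by
    rw [← Int.sign_eq_zero_iff_zero, hsw, Int.sign_eq_zero_iff_zero]
  have habs : ∀ x, v.1 x ≠ 0 → |w.1 x| = f x := by
    intro x h0
    rw [hw, abs_mul, abs_of_pos (hf x h0)]
    rcases lt_or_gt_of_ne h0 with h | h
    · rw [Int.sign_eq_neg_one_of_neg h]; simp
    · rw [Int.sign_eq_one_of_pos h]; simp
  have hiff : ∀ x y, w.1 x = w.1 y ↔ v.1 x = v.1 y := by
    intro x y
    constructor
    · intro he
      by_cases h0 : v.1 x = 0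
      · rw [h0, eq_comm, ← hw0, ← he, hw0, h0]
      · have h0' : v.1 y ≠ 0 := by rwa [Ne, ← hw0, ← he, hw0]
        have h1 := (hfe x y (by rw [← habs x h0, ← habs y h0', he])).2
        have h2 : (v.1 x).sign = (v.1 y).sign := by rw [← hsw, he, hsw]
        rw [← Int.sign_mul_abs (v.1 x), h1, h2, Int.sign_mul_abs]
    · intro he
      rw [hw, hw]
      simp only [f]
      rw [he, bs_congr_of_eq he]
  refine ⟨w, hiff, fun x _ y _ h0 hlt => ?_⟩
  rw [bs_congr_of_iff hiff, bs_congr_of_iff hiff]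
  have hx0 := mt (hw0 x).2 h0
  have hy0 : v.1 y ≠ 0 := by
    rw [Ne, ← hw0]
    intro hy
    rw [hy, abs_zero] at hlt
    exact absurd (abs_nonneg (w.1 x)) (by omega)
  rw [habs x hx0, habs y hy0] at hlt
  by_contra hlt'
  have := hfb x y (by omega)
  omega

/-- Reversing a whole block together with its negative preserves all equalities of coordinates, so
the flat is the same; an odd block size changes the parity. -/
theorem exists_flip_block (v : Vec n) {x₀ : ℤ} (h0 : v.1 x₀ ≠ 0) (hodd : Odd (bs v x₀)) :
    ∃ w : Vec n, (∀ x y, w.1 x = w.1 y ↔ v.1 x = v.1 y) ∧ (∀ x, |w.1 x| = |v.1 x|) ∧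
      parity w = -parity v := by
  let w : Vec n := ⟨fun x => if |v.1 x| = |v.1 x₀| then -v.1 x else v.1 x, fun x => by
    simp only [vec_neg, abs_neg]; split_ifs <;> rfl, fun x hx => by
    simp only [vec_eq_zero v hx]; simp⟩
  have hw : ∀ x, w.1 x = if |v.1 x| = |v.1 x₀| then -v.1 x else v.1 x := fun _ => rfl
  have habs : ∀ x, |w.1 x| = |v.1 x| := fun x => by
    rw [hw]; split_ifs
    · rw [abs_neg]
    · rfl
  refine ⟨w, fun x y => ?_, habs, ?_⟩
  · constructor
    · intro he
      have h1 : |v.1 x| = |v.1 y| := by rw [← habs, he, habs]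
      rw [hw, hw, h1] at he
      split_ifs at he
      · exact neg_injective he
      · exact he
    · intro he
      rw [hw, hw, he]
  · have : parity w = ∏ x ∈ Finset.Icc (1 : ℤ) n,
        ((if |v.1 x| = |v.1 x₀| then -1 else 1) * (v.1 x).sign) := by
      refine Finset.prod_congr rfl fun x _ => ?_
      rw [hw]; split_ifs
      · rw [Int.sign_neg, neg_one_mul]
      · rw [one_mul]
    rw [this, Finset.prod_mul_distrib, ← Finset.prod_filter, Finset.prod_const,
      ← bs_eq_card_abs h0, hodd.neg_one_pow, neg_one_mul]
    rfl

theorem exists_ordered_of_parity (v : Vec n) :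
    ∃ w : Vec n, (∀ x y, w.1 x = w.1 y ↔ v.1 x = v.1 y) ∧
    (∀ x ∈ points n, ∀ y ∈ points n, w.1 x ≠ 0 → |w.1 x| < |w.1 y| → bs w y ≤ bs w x) ∧
    ∀ x ∈ points n, w.1 x ≠ 0 → Odd (bs w x) → parity w ≠ -1 := by
  obtain ⟨w, h1, h2⟩ := exists_ordered v
  by_cases h : ∀ x ∈ points n, w.1 x ≠ 0 → Odd (bs w x) → parity w ≠ -1
  · exact ⟨w, h1, h2, h⟩
  push Not at h
  obtain ⟨x, hx, hx0, hodd, hpar⟩ := h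
  obtain ⟨w', h3, h4, h5⟩ := exists_flip_block w hx0 hodd
  refine ⟨w', fun x y => (h3 x y).trans (h1 x y), fun x hx y hy h0 hlt => ?_, fun _ _ _ _ => ?_⟩
  · rw [bs_congr_of_iff h3, bs_congr_of_iff h3]
    rw [h4, h4] at hlt
    exact h2 x hx y hy (by rwa [Ne, ← abs_eq_zero, ← h4, abs_eq_zero]) hlt
  · rw [h5, hpar]; decide

end Shape

/-! ### The index set meets every class of equal columns exactly once. -/

section Index

variable {n : ℕ} [Fact (2 ≤ n)]

theorem exists_regular_cast {F : Type*} [Field F] {p : ℕ} [CharP F p] (hp2 : p ≠ 2) {v : Vec n}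
    (hN : Normal v) : ∃ v' : Vec n, Normal v' ∧ (∀ J, (cnt J v : F) = cnt J v') ∧
      ∀ x ∈ points n, v'.1 x ≠ 0 → ¬ p ∣ bs v' x := by
  rcases CharP.char_is_prime_or_zero F p with hp | rfl
  · have := Fact.mk hp
    obtain ⟨v', h1, h2, h3⟩ := exists_regular hp2 hN
    exact ⟨v', h1, fun J => (CharP.natCast_eq_natCast F p).2 (h2 J), h3⟩
  · refine ⟨v, hN, fun _ => rfl, fun x hx _ h => ?_⟩
    have := bs_pos v hx
    rw [zero_dvd_iff] at h
    omega

theorem HasShape.of_smul {w : Vec n} (hN : Normal w) {g : D n} (hg : Dominant (g • w)) :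
    ∃ κ : Comps n, HasShape (g • w) κ ∧ SameFace (g • w) (wt κ.subsetᶜ) := by
  obtain ⟨κ, hκ⟩ := exists_comps_subset_eq (Finset.univ.filter fun i => al i (g • w) ≠ 0)
  have h : HasShape (g • w) κ := ⟨hg, hN.smul g, fun i => by rw [hκ]; simp⟩
  exact ⟨κ, h, sameFace_of_dominant hg (dominant_wt _) fun i => by
    rw [al_wt_eq_zero, Finset.mem_compl, h.al_eq_zero]⟩

theorem hasShape_wt {J : Finset (Fin n)} {κ : Comps n} (h : Jᶜ = κ.subset) : HasShape (wt J) κ :=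
  ⟨dominant_wt J, normal_wt J, fun i => by rw [al_wt_eq_zero, ← h, Finset.mem_compl, not_not]⟩

/-- Every column of the matrix of marks agrees with one from the index set. -/
theorem exists_mem_indexReg {F : Type*} [Field F] {p : ℕ} [CharP F p] (hp2 : p ≠ 2)
    (J : Finset (Fin n)) :
    ∃ J' ∈ indexReg n p, ∀ K, (cnt K (wt J) : F) = cnt K (wt J') := by
  obtain ⟨v, hN, hc, hreg⟩ := exists_regular_cast (F := F) hp2 (normal_wt J)
  obtain ⟨w, hiff, hord, hpar⟩ := exists_ordered_of_parity v
  have hzero : ∀ x, w.1 x = 0 ↔ v.1 x = 0 := fun x => by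
    have := hiff x 0
    rwa [apply_zero, apply_zero] at this
  have hNw : Normal w := hN.of_zero_iff hzero
  have hcw : ∀ K, cnt K v = cnt K w := fun K =>
    cnt_congr (fun x y _ => (hiff x y).2) (fun x y _ => (hiff x y).1) K
  obtain ⟨g, hg⟩ := exists_dominant w
  obtain ⟨κ, hκ, hface⟩ := HasShape.of_smul hNw hg
  have hbs : ∀ x, bs (g • w) x = bs w (act n g⁻¹ x) := fun x => by
    have := bs_smul g w (act n g⁻¹ x)
    rwa [act_act_inv] at this
  have hmem : ∀ {x}, x ∈ points n → act n g⁻¹ x ∈ points n := (act_mem_points g⁻¹).2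
  refine ⟨κ.subsetᶜ, ⟨κ, compl_compl _, ?_, ?_, ?_⟩, fun K => ?_⟩
  · refine hκ.isPartition fun x hx y hy h0 hlt => ?_
    rw [hbs, hbs]
    exact hord _ (hmem hx) _ (hmem hy) h0 hlt
  · intro l hl
    obtain ⟨x, hx, h0, rfl⟩ := hκ.exists_bs_eq hl
    rw [hbs, bs_congr_of_iff hiff]
    exact hreg _ (hmem hx) (mt (hzero _).2 h0)
  · by_cases hp : κ.InPrime
    · refine Or.inr ⟨hp, fun l hl => ?_⟩
      by_contra hodd
      obtain ⟨x, hx, h0, rfl⟩ := hκ.exists_bs_eq hl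
      rw [Nat.not_even_iff_odd, hbs] at hodd
      refine hpar _ (hmem hx) h0 hodd ?_
      rw [← parity_smul g w]
      exact hκ.parity_eq_neg_one hp
    · exact Or.inl hp
  · rw [hc, hcw, ← cnt_smul g w, hface.cnt_eq]

/-- The counts give the multiplicity of every positive part, and a non-increasing list is determined
by its multiplicities. -/
theorem components_eq_of_blockCount_eq {v v' : Vec n} {κ κ' : Comps n} (h : HasShape v κ)
    (h' : HasShape v' κ') {p : ℕ} (hp : p.Prime ∨ p = 0) (hreg : κ.IsRegular p)
    (hreg' : κ'.IsRegular p) (hpart : κ.IsPartition) (hpart' : κ'.IsPartition)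
    (hb : ∀ r, blockCount p v r = blockCount p v' r) : κ.components = κ'.components := by
  refine List.Perm.eq_of_pairwise' hpart hpart' (List.perm_iff_count.2 fun r => ?_)
  have h1 := hb r
  rw [h.blockCount_eq hp hreg, h'.blockCount_eq hp hreg'] at h1
  rcases Nat.eq_zero_or_pos r with rfl | hr
  · rw [List.count_eq_zero_of_not_mem fun hm => absurd (κ.pos _ hm) (lt_irrefl 0),
      List.count_eq_zero_of_not_mem fun hm => absurd (κ'.pos _ hm) (lt_irrefl 0)]
  · exact Nat.eq_of_mul_eq_mul_left hr (Nat.eq_of_mul_eq_mul_left two_pos h1)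

/-- With even blocks and no zeros the parity is determined by the column; it is `-1` for the primed
copy and `1` for `𝒞_n`. -/
theorem not_inPrime_of_inPrime {F : Type*} [Field F] {p : ℕ} [CharP F p] (hp2 : p ≠ 2)
    {J J' : Finset (Fin n)} {κ κ' : Comps n} (h : HasShape (wt J) κ) (h' : HasShape (wt J') κ')
    (hL : κ.components = κ'.components) (hc : ∀ K, (cnt K (wt J) : F) = cnt K (wt J'))
    (hp : κ.InPrime) (he : κ.AllEven) : κ'.InPrime := by
  have hn := two_le n
  by_contra hp'
  have hs := (Comps.notMem_subset_of_inPrime (κ := κ) (by omega) hp).2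
  have hs' : κ'.components.sum = n := by rw [← hL, hs]
  have h1 := (invariants_of_cnt_eq (F := F) hp2 (normal_wt J) (normal_wt J') hc).2
    (fun x hx => ⟨h.apply_ne_zero hs hx, he _ (h.bs_mem hx (h.apply_ne_zero hs hx))⟩)
    (fun x hx => h'.apply_ne_zero hs' hx)
  rw [h.parity_eq_neg_one hp, h'.parity_eq_one hs' (by omega)
    (Comps.notMem_subset_of_components_eq _ hp hp' hL)] at h1
  exact absurd h1 (by decide)

/-- The columns from the index set are distinct. -/
theorem eq_of_mem_indexReg {F : Type*} [Field F] {p : ℕ} [CharP F p] (hp2 : p ≠ 2)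
    {J J' : Finset (Fin n)} (hJ : J ∈ indexReg n p) (hJ' : J' ∈ indexReg n p)
    (hc : ∀ K, (cnt K (wt J) : F) = cnt K (wt J')) : J = J' := by
  obtain ⟨κ, hκ, hpart, hreg, hp⟩ := hJ
  obtain ⟨κ', hκ', hpart', hreg', hp'⟩ := hJ'
  have h := hasShape_wt hκ
  have h' := hasShape_wt hκ'
  have hL := components_eq_of_blockCount_eq h h' (CharP.char_is_prime_or_zero F p) hreg hreg'
    hpart hpart' (invariants_of_cnt_eq (F := F) hp2 (normal_wt J) (normal_wt J') hc).1
  have hiff : κ.InPrime ↔ κ'.InPrime := by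
    constructor
    · intro hi
      exact not_inPrime_of_inPrime hp2 h h' hL hc hi (hp.resolve_left (not_not.2 hi)).2
    · intro hi
      exact not_inPrime_of_inPrime hp2 h' h hL.symm (fun K => (hc K).symm) hi
        (hp'.resolve_left (not_not.2 hi)).2
  obtain rfl := Comps.ext_components hL hiff
  exact compl_injective (hκ.trans hκ'.symm)

/-- No positive part is divisible by `0`, so `0`-regularity is no condition and characteristic zero
becomes the case `p = 0`. -/
theorem indexZero_eq : indexZero n = indexReg n 0 := by
  ext J
  constructor
  · rintro ⟨κ, h1, h2, h3⟩
    refine ⟨κ, h1, h2, fun l hl h => ?_, h3⟩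
    have := κ.pos l hl
    rw [zero_dvd_iff] at h
    omega
  · rintro ⟨κ, h1, h2, -, h3⟩
    exact ⟨κ, h1, h2, h3⟩

end Index

end DescentD

theorem mainTheorem4 (n : ℕ) (hn : 2 ≤ n) (c : Finset (Fin n) → D n)
    (hc : ∀ J, IsCoxeterElement J (c J)) :
    -- the formal sums of the `X_J` form a basis of the descent algebra
    (∀ (R : Type u) [CommRing R], LinearIndependent R (sumX R n) ∧
      Subalgebra.toSubmodule (descentAlgebra R n) = Submodule.span R (Set.range (sumX R n))) ∧
    -- characteristic zero
    (∀ (k : Type u) [Field k] [CharZero k], IndexesIrreps.{v, u} k n c (indexZero n)) ∧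
    -- odd characteristic
    (∀ (p : ℕ) [Fact p.Prime], p ≠ 2 → IndexesModularIrreps.{v} n p c (indexReg n p)) ∧
    -- characteristic two
    (Even n → IndexesModularIrreps.{v} n 2 c (indexTwoEven n)) ∧
    (Odd n → IndexesModularIrreps.{v} n 2 c (indexTwoOdd n)) := by
  have := Fact.mk hn
  refine ⟨fun R _ => ⟨linearIndependent_sumX R, toSubmodule_descentAlgebra R⟩, fun k _ _ => ?_,
    fun p _ hp2 => ?_, fun h => indexesModularIrreps_two_of_even h hc,
    fun h => indexesModularIrreps_two_of_odd h hc⟩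
  · have := CharP.ofCharZero k
    rw [indexZero_eq]
    exact indexesIrreps_of_cnt hc (exists_mem_indexReg (by decide))
      fun J hJ J' hJ' h => eq_of_mem_indexReg (by decide) hJ hJ' h
  · exact indexesModularIrreps_of_cnt hc (exists_mem_indexReg hp2)
      fun J hJ J' hJ' h => eq_of_mem_indexReg hp2 hJ hJ' h
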